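/- Let $n\ge 1$ and consider the system $\dot x_i=h_i(x_1,\dots,x_i)\,x_{i+1}+f_i(x_1,\dots,x_i)$ for $1\le i<n$ and $\dot x_n=h_n(x_1,\dots,x_n)\,u+f_n(x_1,\dots,x_n)$, where all $f_i,h_i$ are continuously differentiable, $|h_i|>0$ everywhere (with unknown sign), $f_i(0)=0$ for $i<n$, and $f_n(0)$ is arbitrary (possibly $\neq 0$). Controller. Fix $T>0$ and put $\mu(t)=T/(T-t)$ on $[0,T)$. Let $K_i,U_i,a_i,Q_i,c_{ij}$ ($j<i$ or $j=i+1\le n$), $\zeta_n,\varsigma,\varepsilon$ be positive constants with $Q_i>\sum_{j=i+1}^n c_{ji}+c_{i-1,i}$ (where $c_{01}:=0$); let $\beta_i>1$ with $\beta_{i+1}\ge 3\beta_i$; let $\kappa\in[0,\beta_n]$; and let $\theta_i:\mathbb N\to\mathbb R$ be nondecreasing with $\theta_i(0)>0$ and $\theta_i(k)\to\infty$. With integers $\sigma_i$ and barriers $\hat\chi_i>0$ that are piecewise constant in time, and $\hat\Theta_i=(-1)^{\sigma_i}\theta_i(\sigma_i)$, define $s_1=x_1$, $$x_{i+1}^*=\hat\Theta_i\Big[-K_is_i-\frac{\mu^{\beta_i}U_is_i}{\hat\chi_i^2-s_i^2}\Big]\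 (1\le i\le n),\qquad s_{i+1}=x_{i+1}-x_{i+1}^*\ (1\le i<n),\qquad u=x_{n+1}^*,$$ $V_i=\frac12\ln\frac{\hat\chi_i^2}{\hat\chi_i^2-s_i^2}$ and $\mathcal S_i=V_i-\eta_i$, where $$\dot\eta_i=-a_i\mu^{\beta_i}\eta_i-Q_i\mu^{\beta_i}s_i^2+\sum_{j<i}c_{ij}\mu^{\beta_j}s_j^2+\frac{c_{i,i+1}s_{i+1}^2}{\mu^{\beta_i}}\quad(i<n),$$ $$\dot\eta_n=-a_n\mu^{\beta_n}\eta_n-Q_n\mu^{\kappa}s_n^2+\sum_{j<n}c_{nj}\mu^{\beta_j}s_j^2+\frac{\zeta_n}{\mu^{\beta_n}}.$$ The closed loop evolves inside the barriers, $|s_i|<\hat\chi_i$. Switching rule. At $t=0$: $\sigma_i=1$, $\hat\chi_i(0)>|s_i(0)|$, $\eta_i(0)=V_i(0)+\varepsilon$. Put $t_s^0=0$. After the switching time $t_s^m$ the parameters $\sigma_i,\hat\chi_i$ stay constant until $t_s^{m+1}$, the infimum of the times $t\in[t_s^m,T)$ at which some $\mathcal S_i(t)>0$ along the solution with these parameters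 frozen (if there is no such time, there is no further switching). At $t_s^{m+1}$ the state $x$ is continuous and the following updates are made in this order: $\sigma_i$ increases by one for each $i$ with $\mathcal S_i\ge 0$ just before the switching and is unchanged for the other $i$; for $i=1,\dots,n$ successively, $s_i$ is recomputed and, if $|s_i|\ge\hat\chi_i$, $\hat\chi_i$ is replaced by $|s_i|+\varsigma$; $V_i$ is recomputed and, if $V_i\ge\eta_i$, $\eta_i$ is reset to $V_i+\varepsilon$. Then, for every initial state $x(0)$ and every such choice of $\hat\chi_i(0)$, the closed-loop system has a solution on $[0,T)$ (with switching times not accumulating before $T$), and every such solution satisfies: 1) all signals except $\mu$, that is $x_i,s_i,x_{i+1}^*,u,\sigma_i,\hat\Theta_i,\hat\chi_i,\eta_i,V_i,\mathcal S_i$, are bounded on $[0,T)$; 2) $x_i(t)\to 0$ as $t\to T^-$ for all $i=1,\dots,n$. -/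

import Mathlib

noncomputable section

namespace PrescribedTime

/-- A strict-feedback plant of order `n + 1`; the index `i : Fin (n + 1)` is the `(i+1)`-st channel.
`f i` and `h i` are functions of the first `i + 1` state variables only. -/
structure Plant (n : ℕ) where
  /-- control gains -/
  h : (i : Fin (n + 1)) → (Fin (i.val + 1) → ℝ) → ℝ
  /-- nonlinearities -/
  f : (i : Fin (n + 1)) → (Fin (i.val + 1) → ℝ) → ℝ
  h_contDiff : ∀ i, ContDiff ℝ 1 (h i)
  f_contDiff : ∀ i, ContDiff ℝ 1 (f i)
  /-- the gains never vanish; their signs are unknown -/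
  h_abs_pos : ∀ i z, 0 < |h i z|

/-- The first `i + 1` coordinates of a state vector. -/
def trunc {n : ℕ} (x : Fin (n + 1) → ℝ) (i : Fin (n + 1)) : Fin (i.val + 1) → ℝ :=
  fun j => x (Fin.castLE i.isLt j)

/-- Right-hand side of the plant: `h_i(x_1..x_i) x_{i+1} + f_i(x_1..x_i)`, where the variable
following the last state is the input `u`. -/
def Plant.rhs {n : ℕ} (P : Plant n) (x : Fin (n + 1) → ℝ) (u : ℝ) (i : Fin (n + 1)) : ℝ :=
  P.h i (trunc x i) * (Fin.snoc (α := fun _ => ℝ) x u : Fin (n + 2) → ℝ) i.succ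
    + P.f i (trunc x i)

/-- The design parameters of controller and switching rule. None of them refers to the plant. -/
structure Design (n : ℕ) where
  /-- prescribed time -/
  T : ℝ
  K : Fin (n + 1) → ℝ
  U : Fin (n + 1) → ℝ
  β : Fin (n + 1) → ℝ
  a : Fin (n + 1) → ℝ
  Q : Fin (n + 1) → ℝ
  /-- only the entries `c i j` with `j < i` or `j = i + 1` are used -/
  c : Fin (n + 1) → Fin (n + 1) → ℝ
  ζ : ℝ
  /-- exponent of `μ` in front of `s²` in the last auxiliary equation -/
  κ : ℝ
  /-- magnitudes of the switching gains -/
  θ : Fin (n + 1) → ℕ → ℝ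
  /-- barrier increment -/
  ς : ℝ
  /-- reset margin -/
  ε : ℝ
  T_pos : 0 < T
  K_pos : ∀ i, 0 < K i
  U_pos : ∀ i, 0 < U i
  a_pos : ∀ i, 0 < a i
  c_pos : ∀ i j, (j < i ∨ j.val = i.val + 1) → 0 < c i j
  ζ_pos : 0 < ζ
  ς_pos : 0 < ς
  ε_pos : 0 < ε
  one_lt_β : ∀ i, 1 < β i
  β_growth : ∀ i : Fin n, 3 * β i.castSucc ≤ β i.succ
  Q_pos : ∀ i, 0 < Q i
  Q_large : ∀ i, ∑ j with i < j ∨ j.val + 1 = i.val, c j i < Q i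
  κ_nonneg : 0 ≤ κ
  κ_le : κ ≤ β (Fin.last n)
  θ_zero_pos : ∀ i, 0 < θ i 0
  θ_mono : ∀ i, Monotone (θ i)
  θ_tendsto : ∀ i, Filter.Tendsto (θ i) Filter.atTop Filter.atTop

namespace Design

variable {n : ℕ} (D : Design n)

/-- The time-varying gain `μ(t) = T / (T - t)`. -/
def μ (t : ℝ) : ℝ := D.T / (D.T - t)

/-- The switching gain `Θ_i = (-1)^{σ_i} θ_i(σ_i)`. -/
def Θ (σ : Fin (n + 1) → ℕ) (i : Fin (n + 1)) : ℝ := (-1) ^ σ i * D.θ i (σ i)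

/-- The feedback law of one channel,
`Θ_i [ -K_i s - μ^{β_i} U_i s / (χ_i² - s²) ]`, as a function of the error `s`. -/
def law (t : ℝ) (σ : Fin (n + 1) → ℕ) (χ : Fin (n + 1) → ℝ) (i : Fin (n + 1)) (s : ℝ) : ℝ :=
  D.Θ σ i * (-(D.K i) * s - D.μ t ^ D.β i * D.U i * s / (χ i ^ 2 - s ^ 2))

/-- The virtual control errors: `s_1 = x_1`, `s_{i+1} = x_{i+1} - x*_{i+1}` with
`x*_{i+1}` the feedback law of channel `i` at `s_i`. -/
def err (t : ℝ) (σ : Fin (n + 1) → ℕ) (χ x : Fin (n + 1) → ℝ) (i : Fin (n + 1)) : ℝ :=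
  Fin.induction (motive := fun _ => ℝ) (x 0)
    (fun j sj => x j.succ - D.law t σ χ j.castSucc sj) i

/-- The virtual control `x*_{i+1}` produced by channel `i`. -/
def virt (t : ℝ) (σ : Fin (n + 1) → ℕ) (χ x : Fin (n + 1) → ℝ) (i : Fin (n + 1)) : ℝ :=
  D.law t σ χ i (D.err t σ χ x i)

/-- The control input `u`, the virtual control produced by the last channel. -/
def input (t : ℝ) (σ : Fin (n + 1) → ℕ) (χ x : Fin (n + 1) → ℝ) : ℝ :=
  D.virt t σ χ x (Fin.last n)

/-- The barrier Lyapunov functions `V_i = (1/2) ln (χ_i² / (χ_i² - s_i²))`. -/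
def V (t : ℝ) (σ : Fin (n + 1) → ℕ) (χ x : Fin (n + 1) → ℝ) (i : Fin (n + 1)) : ℝ :=
  1 / 2 * Real.log (χ i ^ 2 / (χ i ^ 2 - D.err t σ χ x i ^ 2))

/-- The right-hand side of the auxiliary equation for `η_i`. The last equation contains the
additional term `ζ / μ^{β}`; the sum over `j = i + 1` is empty in the last equation. -/
def etaRhs (t : ℝ) (σ : Fin (n + 1) → ℕ) (χ x η : Fin (n + 1) → ℝ) (i : Fin (n + 1)) : ℝ :=
  -(D.a i) * D.μ t ^ D.β i * η i
    - D.Q i * D.μ t ^ (if i = Fin.last n then D.κ else D.β i) * D.err t σ χ x i ^ 2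
    + ∑ j with j < i, D.c i j * D.μ t ^ D.β j * D.err t σ χ x j ^ 2
    + ∑ j with j.val = i.val + 1, D.c i j * D.err t σ χ x j ^ 2 / D.μ t ^ D.β i
    + (if i = Fin.last n then D.ζ / D.μ t ^ D.β i else 0)

/-- The supervisory functions `S_i = V_i - η_i`. -/
def supervisor (t : ℝ) (σ : Fin (n + 1) → ℕ) (χ x η : Fin (n + 1) → ℝ) (i : Fin (n + 1)) : ℝ :=
  D.V t σ χ x i - η i

/-- `(x, η)` solves the closed loop on `[a, e)` with the adaptive parameters frozen at `(σ, χ)`.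
The controller is only defined inside the barriers `|s_i| < χ_i`. -/
structure IsFlow (P : Plant n) (σ : Fin (n + 1) → ℕ) (χ : Fin (n + 1) → ℝ) (a e : ℝ)
    (x η : ℝ → Fin (n + 1) → ℝ) : Prop where
  barrier : ∀ t ∈ Set.Ico a e, ∀ i, |D.err t σ χ (x t) i| < χ i
  plant : ∀ t ∈ Set.Ico a e, ∀ i,
    HasDerivWithinAt (fun τ => x τ i) (P.rhs (x t) (D.input t σ χ (x t)) i) (Set.Ico a e) t
  aux : ∀ t ∈ Set.Ico a e, ∀ i,
    HasDerivWithinAt (fun τ => η τ i) (D.etaRhs t σ χ (x t) (η t) i) (Set.Ico a e) t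

/-- The parameter update at a switching time `t`, from `(σ, χ, x, η)` to `(σ', χ', x', η')`:
first `σ`, then the barriers (channel after channel: `s_i` is recomputed with the new
`σ` and the new `χ_1, …, χ_{i-1}`, the only barriers on which it depends), then `η`.
A switching time is an infimum of times with `S_i > 0`, so there the channels that
triggered it have `S_i = 0`; the update test is therefore `0 ≤ S_i`. -/
structure IsUpdate (t : ℝ) (σ : Fin (n + 1) → ℕ) (χ x η : Fin (n + 1) → ℝ)
    (σ' : Fin (n + 1) → ℕ) (χ' x' η' : Fin (n + 1) → ℝ) : Prop where
  state : x' = x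
  gain : ∀ i, (0 ≤ D.supervisor t σ χ x η i → σ' i = σ i + 1) ∧
    (D.supervisor t σ χ x η i < 0 → σ' i = σ i)
  barrier : ∀ i, (χ i ≤ |D.err t σ' χ' x i| → χ' i = |D.err t σ' χ' x i| + D.ς) ∧
    (|D.err t σ' χ' x i| < χ i → χ' i = χ i)
  reset : ∀ i, (η i ≤ D.V t σ' χ' x i → η' i = D.V t σ' χ' x i + D.ε) ∧
    (D.V t σ' χ' x i < η i → η' i = η i)

/-- The signals `σ, χ, x, η` behave according to the switching rule between the consecutive
switching times `a` and `b`. On `[a, b)` they follow a solution `(y, w)` with frozen parameters.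
Either no supervisory function becomes positive on `[a, T)`, and then `b = T`; or `b` is the
infimum of the times at which one of them is positive along the solution with frozen
parameters, and the parameters are updated at `b`. -/
def IsPhase (P : Plant n) (σ : ℝ → Fin (n + 1) → ℕ) (χ x η : ℝ → Fin (n + 1) → ℝ)
    (a b : ℝ) : Prop :=
  ∃ e, a < e ∧ e ≤ D.T ∧ ∃ y w : ℝ → Fin (n + 1) → ℝ,
    D.IsFlow P (σ a) (χ a) a e y w ∧ y a = x a ∧ w a = η a ∧
    (∀ t ∈ Set.Ico a b, σ t = σ a ∧ χ t = χ a ∧ x t = y t ∧ η t = w t) ∧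
    ((b = D.T ∧ e = D.T ∧
        ∀ t ∈ Set.Ico a D.T, ∀ i, D.supervisor t (σ a) (χ a) (y t) (w t) i ≤ 0) ∨
      (b < e ∧
        IsGLB {t | t ∈ Set.Ico a e ∧ ∃ i, 0 < D.supervisor t (σ a) (χ a) (y t) (w t) i} b ∧
        D.IsUpdate b (σ a) (χ a) (y b) (w b) (σ b) (χ b) (x b) (η b)))

/-- The initial value `σ_i(0) = 1`. -/
def σinit (n : ℕ) : Fin (n + 1) → ℕ := fun _ => 1

/-- `(σ, χ, x, η)` is a solution on `[0, T)` of the hybrid closed-loop system with initial state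
`x0` and initial barriers `χ0`; `ts` is the sequence of switching times, continued by `T`
if there are only finitely many of them. Switching times do not accumulate before `T`. -/
structure IsClosedLoop (P : Plant n) (x0 χ0 : Fin (n + 1) → ℝ) (ts : ℕ → ℝ)
    (σ : ℝ → Fin (n + 1) → ℕ) (χ x η : ℝ → Fin (n + 1) → ℝ) : Prop where
  start : ts 0 = 0
  state_init : x 0 = x0
  gain_init : σ 0 = σinit n
  barrier_init : χ 0 = χ0
  aux_init : ∀ i, η 0 i = D.V 0 (σinit n) χ0 x0 i + D.ε
  phase : ∀ m, ts m < D.T → D.IsPhase P σ χ x η (ts m) (ts (m + 1))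
  after : ∀ m, ts m = D.T → ts (m + 1) = D.T
  exhaust : ∀ τ < D.T, ∃ m, τ < ts m

end Design

end PrescribedTime

end

/-! ### The time-varying gain, the errors, and their derivatives -/

noncomputable section

namespace PrescribedTime

open Set Filter Topology

/-! Everything rests on the finiteness of the number of switchings. Suppose there are infinitely
many, with accumulation point at most `T`. By strong induction on the channel, every `σ_i` is
eventually constant (`eventually_σ_const`); but each switching increases some `σ_i`, a contradiction
(`IsRun.exists_eq_T`).

For the induction step, let the gains of the channels before `i` be settled. The error `s_j` depends
only on parameters of channels before `j`, so the barriers up to channel `i` no longer move and the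
auxiliary variables before `i` are no longer reset: later channels may switch, but the earlier ones
see a single uninterrupted evolution (`supervised_of_switch`). In it `V_j ≤ η_j`, and `s_j² ≤ 2 χ_j²
V_j`, so the equations of the `η_j` become a closed system of scalar differential inequalities with
damping `a_j μ^{β_j}`. Bootstrapping the decay rate gives `η_j, s_j² = O(μ^{-2β_l})` with `l = i -
1` (`Supervised.exists_decay`); no information on the signs of the gains enters here.

These bounds make the drift of `s_i` at most `|f_i(0)| + C μ^{β_i/2} ∑_{j≤i} μ^{β_j/2} |s_j|`, with
`C` independent of `Θ_i` (`Confined.exists_drift_le`); differentiating the virtual control costs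
powers of `μ`, which `β_i ≥ 3 β_{i-1}` pays for. By Young's inequality the contributions of the
other channels and of `f_n(0)` are absorbed by the source terms of `η_i`, up to multiples of
`μ^{β_i} r²`, where `r = s_i / (χ_i² - s_i²)`. The virtual control contributes `-h_i Θ_i U_i μ^{β_i}
r²`, so a large gain of the right sign gives `(V_i - η_i)' ≤ -a_i μ^{β_i} (V_i - η_i)`
(`exists_gain_dissipation`). After every update `V_i < η_i`; such a gain keeps this strict
inequality, so channel `i` does not trigger again. Since `(-1)^σ θ(σ)` takes good values arbitrarily
far and `σ_i` moves by at most one, such a value cannot be skipped.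

There is therefore a last phase, lasting until `T`, and the decay estimate applies there with all
channels included: `s_j = O(μ^{-β_n})`. This bounds every signal and makes the states `O(1/μ)`. For
existence, nonpositive supervisory functions confine a frozen flow to a compact subset of its domain
on each `[a, c]` with `c < T`, so it continues until one of them becomes positive; the same
finiteness theorem then rules out accumulation of switchings. -/

theorem Plant.h_ne_zero {n : ℕ} (P : Plant n) (i : Fin (n + 1)) (z : Fin (i.val + 1) → ℝ) :
    P.h i z ≠ 0 := abs_pos.1 (P.h_abs_pos i z)

/-- A gain that never vanishes has a constant sign. -/
theorem Plant.h_sign {n : ℕ} (P : Plant n) (i : Fin (n + 1)) :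
    (∀ z, 0 < P.h i z) ∨ ∀ z, P.h i z < 0 := by
  by_contra! hcon
  obtain ⟨⟨z₁, h₁⟩, z₂, h₂⟩ := hcon
  have hc : Continuous (P.h i) := (P.h_contDiff i).continuous
  obtain ⟨z, hz⟩ := mem_range_of_exists_le_of_exists_ge hc ⟨z₁, h₁⟩ ⟨z₂, h₂⟩
  exact P.h_ne_zero i z hz

namespace Design

variable {n : ℕ} (D : Design n)

theorem μ_pos {t : ℝ} (ht : t < D.T) : 0 < D.μ t := div_pos D.T_pos (sub_pos.2 ht)

theorem one_le_μ {t : ℝ} (h0 : 0 ≤ t) (ht : t < D.T) : 1 ≤ D.μ t := by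
  unfold μ
  rw [one_le_div (sub_pos.2 ht)]
  linarith

theorem hasDerivAt_μ {t : ℝ} (ht : t < D.T) : HasDerivAt D.μ (D.μ t ^ 2 / D.T) t := by
  have h1 : D.T - t ≠ 0 := (sub_pos.2 ht).ne'
  have hT := D.T_pos.ne'
  have := (((hasDerivAt_id t).const_sub D.T).inv h1).const_mul D.T
  refine (this.congr_deriv ?_).congr_of_eventuallyEq (Eventually.of_forall fun s => ?_)
  · simp only [μ, id]
    field_simp
  · simp [μ, div_eq_mul_inv]

theorem hasDerivAt_μ_rpow {t : ℝ} (ht : t < D.T) (p : ℝ) :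
    HasDerivAt (fun τ => D.μ τ ^ p) (p / D.T * D.μ t ^ (p + 1)) t := by
  have hμ := D.μ_pos ht
  refine ((D.hasDerivAt_μ ht).rpow_const (p := p) (Or.inl hμ.ne')).congr_deriv ?_
  have : D.μ t ^ (p + 1) = D.μ t ^ 2 * D.μ t ^ (p - 1) := by
    rw [← Real.rpow_natCast, ← Real.rpow_add hμ]; norm_num; congr 1; ring
  rw [this]; ring

theorem contDiffAt_μ {t : ℝ} (ht : t < D.T) : ContDiffAt ℝ 1 D.μ t := by
  unfold μ
  exact contDiffAt_const.div (contDiffAt_const.sub contDiffAt_id) (sub_pos.2 ht).ne'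

theorem rpow_le_rpow_μ {t : ℝ} (h0 : 0 ≤ t) (ht : t < D.T) {p q : ℝ} (h : p ≤ q) :
    D.μ t ^ p ≤ D.μ t ^ q := Real.rpow_le_rpow_of_exponent_le (D.one_le_μ h0 ht) h

theorem tendsto_μ : Tendsto D.μ (𝓝[<] D.T) atTop := by
  have h : Tendsto (fun t => D.T - t) (𝓝[<] D.T) (𝓝[>] 0) := by
    refine tendsto_nhdsWithin_iff.2 ⟨?_, ?_⟩
    · have : Tendsto (fun t => D.T - t) (𝓝 D.T) (𝓝 (D.T - D.T)) :=
        (continuous_const.sub continuous_id).tendsto _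
      rw [sub_self] at this
      exact this.mono_left nhdsWithin_le_nhds
    · filter_upwards [self_mem_nhdsWithin] with t ht using sub_pos.2 (mem_Iio.1 ht)
  have := (tendsto_inv_nhdsGT_zero.comp h).const_mul_atTop D.T_pos
  exact this.congr fun t => by simp [μ, div_eq_mul_inv]

theorem three_mul_β_le {i j : Fin (n + 1)} (h : j < i) : 3 * D.β j ≤ D.β i := by
  induction i using Fin.induction with
  | zero => exact absurd h (Fin.not_lt_zero j)
  | succ i ih =>
    have h1 := D.β_growth i
    rcases (Fin.le_castSucc_iff.2 h).lt_or_eq with h2 | h2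
    · have := ih h2
      have := D.one_lt_β i.castSucc
      linarith
    · rw [h2]; exact h1

theorem β_mono {i j : Fin (n + 1)} (h : j ≤ i) : D.β j ≤ D.β i := by
  rcases h.lt_or_eq with h | h
  · have := D.three_mul_β_le h
    have := D.one_lt_β j
    linarith
  · rw [h]

@[simp] theorem err_zero (t : ℝ) (σ : Fin (n + 1) → ℕ) (χ x : Fin (n + 1) → ℝ) :
    D.err t σ χ x 0 = x 0 := rfl

theorem err_succ (t : ℝ) (σ : Fin (n + 1) → ℕ) (χ x : Fin (n + 1) → ℝ) (j : Fin n) :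
    D.err t σ χ x j.succ = x j.succ - D.virt t σ χ x j.castSucc := by
  simp only [err, virt, Fin.induction_succ]

/-- The `i`-th error depends only on the parameters of the preceding channels. -/
theorem err_congr {t : ℝ} {σ σ' : Fin (n + 1) → ℕ} {χ χ' x : Fin (n + 1) → ℝ} {i : Fin (n + 1)}
    (hσ : ∀ j < i, σ j = σ' j) (hχ : ∀ j < i, χ j = χ' j) :
    D.err t σ χ x i = D.err t σ' χ' x i := by
  induction i using Fin.induction with
  | zero => rfl
  | succ i ih =>
    have h1 := ih (fun j hj => hσ j (hj.trans (Fin.castSucc_lt_succ)))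
      (fun j hj => hχ j (hj.trans (Fin.castSucc_lt_succ)))
    rw [err_succ, err_succ, virt, virt, h1]
    simp only [law, Θ, hσ _ (Fin.castSucc_lt_succ (i := i)), hχ _ (Fin.castSucc_lt_succ (i := i))]

/-- Inside the barrier the denominator of the feedback law is positive. -/
theorem sub_sq_pos {c s : ℝ} (h : |s| < c) : 0 < c ^ 2 - s ^ 2 := by
  have := (abs_nonneg s).trans_lt h
  have := sq_lt_sq.2 (h.trans_le (le_abs_self c))
  linarith

/-- The derivative of the feedback law of one channel along a motion with `ṡ = d`. -/
def lawDeriv (t : ℝ) (σ : Fin (n + 1) → ℕ) (χ : Fin (n + 1) → ℝ) (i : Fin (n + 1)) (s d : ℝ) : ℝ :=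
  D.Θ σ i * (-(D.K i) * d - D.U i * (D.β i / D.T * D.μ t ^ (D.β i + 1) * (s / (χ i ^ 2 - s ^ 2))
    + D.μ t ^ D.β i * ((χ i ^ 2 + s ^ 2) / (χ i ^ 2 - s ^ 2) ^ 2 * d)))

theorem hasDerivWithinAt_law {t : ℝ} (ht : t < D.T) {σ : Fin (n + 1) → ℕ} {χ : Fin (n + 1) → ℝ}
    {i : Fin (n + 1)} {s : ℝ → ℝ} {d : ℝ} {S : Set ℝ} (hs : HasDerivWithinAt s d S t)
    (hb : |s t| < χ i) :
    HasDerivWithinAt (fun τ => D.law τ σ χ i (s τ)) (D.lawDeriv t σ χ i (s t) d) S t := by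
  have h0 : χ i ^ 2 - s t ^ 2 ≠ 0 := (sub_sq_pos hb).ne'
  have hμ := (D.hasDerivAt_μ_rpow ht (D.β i)).hasDerivWithinAt (s := S)
  have h1 := ((hμ.mul_const (D.U i)).mul hs).div ((hs.pow 2).const_sub (χ i ^ 2)) h0
  have h2 := ((hs.const_mul (-(D.K i))).sub h1).const_mul (D.Θ σ i)
  refine (h2.congr_deriv ?_)
  simp only [lawDeriv]
  congr 2
  have hT := D.T_pos.ne'
  simp only [Pi.mul_apply, Pi.pow_apply]
  generalize D.μ t ^ (D.β i + 1) = m at *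
  field_simp
  push_cast
  ring

/-- The derivative of the `i`-th error along the plant. -/
def errDeriv (P : Plant n) (t : ℝ) (σ : Fin (n + 1) → ℕ) (χ x : Fin (n + 1) → ℝ)
    (i : Fin (n + 1)) : ℝ :=
  Fin.induction (motive := fun _ => ℝ) (P.rhs x (D.input t σ χ x) 0)
    (fun j dj => P.rhs x (D.input t σ χ x) j.succ
      - D.lawDeriv t σ χ j.castSucc (D.err t σ χ x j.castSucc) dj) i

theorem errDeriv_zero (P : Plant n) (t : ℝ) (σ : Fin (n + 1) → ℕ) (χ x : Fin (n + 1) → ℝ) :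
    D.errDeriv P t σ χ x 0 = P.rhs x (D.input t σ χ x) 0 := rfl

theorem errDeriv_succ (P : Plant n) (t : ℝ) (σ : Fin (n + 1) → ℕ) (χ x : Fin (n + 1) → ℝ)
    (j : Fin n) :
    D.errDeriv P t σ χ x j.succ = P.rhs x (D.input t σ χ x) j.succ
      - D.lawDeriv t σ χ j.castSucc (D.err t σ χ x j.castSucc)
        (D.errDeriv P t σ χ x j.castSucc) := by
  simp only [errDeriv, Fin.induction_succ]

theorem hasDerivWithinAt_err {P : Plant n} {t : ℝ} (ht : t < D.T) {σ : Fin (n + 1) → ℕ}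
    {χ : Fin (n + 1) → ℝ} {x : ℝ → Fin (n + 1) → ℝ} {S : Set ℝ} {i : Fin (n + 1)}
    (hx : ∀ i, HasDerivWithinAt (fun τ => x τ i) (P.rhs (x t) (D.input t σ χ (x t)) i) S t)
    (hb : ∀ j < i, |D.err t σ χ (x t) j| < χ j) :
    HasDerivWithinAt (fun τ => D.err τ σ χ (x τ) i) (D.errDeriv P t σ χ (x t) i) S t := by
  induction i using Fin.induction with
  | zero => exact hx 0
  | succ i ih =>
    have h1 := ih fun j hj => hb j (hj.trans Fin.castSucc_lt_succ)
    simp only [err_succ, virt, errDeriv_succ]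
    exact (hx i.succ).sub (D.hasDerivWithinAt_law ht h1 (hb _ Fin.castSucc_lt_succ))

/-- The feedback law is continuously differentiable inside the barrier. -/
theorem contDiffAt_law {E : Type*} [NormedAddCommGroup E] [NormedSpace ℝ E]
    {σ : Fin (n + 1) → ℕ} {χ : Fin (n + 1) → ℝ}
    {i : Fin (n + 1)} {τ s : E → ℝ} {p : E} (hτ : ContDiffAt ℝ 1 τ p) (hs : ContDiffAt ℝ 1 s p)
    (ht : τ p < D.T) (hb : |s p| < χ i) :
    ContDiffAt ℝ 1 (fun q => D.law (τ q) σ χ i (s q)) p := by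
  have h0 : χ i ^ 2 - s p ^ 2 ≠ 0 := (sub_sq_pos hb).ne'
  have hμ : ContDiffAt ℝ 1 (fun q => D.μ (τ q) ^ D.β i) p :=
    ((D.contDiffAt_μ ht).comp p hτ).rpow_const_of_ne (D.μ_pos ht).ne'
  unfold law
  exact contDiffAt_const.mul ((contDiffAt_const.mul hs).sub
    (((hμ.mul contDiffAt_const).mul hs).div (contDiffAt_const.sub (hs.pow 2)) h0))

theorem contDiffAt_err {σ : Fin (n + 1) → ℕ} {χ : Fin (n + 1) → ℝ} {i : Fin (n + 1)}
    {E : Type*} [NormedAddCommGroup E] [NormedSpace ℝ E] {τ : E → ℝ} {x : E → Fin (n + 1) → ℝ}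
    {p : E} (hτ : ContDiffAt ℝ 1 τ p) (hx : ContDiffAt ℝ 1 x p)
    (ht : τ p < D.T) (hb : ∀ j < i, |D.err (τ p) σ χ (x p) j| < χ j) :
    ContDiffAt ℝ 1 (fun q => D.err (τ q) σ χ (x q) i) p := by
  have hxi := contDiffAt_pi.1 hx
  induction i using Fin.induction with
  | zero => exact hxi 0
  | succ i ih =>
    have h1 := ih fun j hj => hb j (hj.trans Fin.castSucc_lt_succ)
    simp only [err_succ, virt]
    exact (hxi i.succ).sub (D.contDiffAt_law hτ h1 ht (hb _ Fin.castSucc_lt_succ))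

theorem contDiffAt_virt {σ : Fin (n + 1) → ℕ} {χ : Fin (n + 1) → ℝ} {i : Fin (n + 1)}
    {E : Type*} [NormedAddCommGroup E] [NormedSpace ℝ E] {τ : E → ℝ} {x : E → Fin (n + 1) → ℝ}
    {p : E} (hτ : ContDiffAt ℝ 1 τ p) (hx : ContDiffAt ℝ 1 x p)
    (ht : τ p < D.T) (hb : ∀ j ≤ i, |D.err (τ p) σ χ (x p) j| < χ j) :
    ContDiffAt ℝ 1 (fun q => D.virt (τ q) σ χ (x q) i) p :=
  D.contDiffAt_law hτ (D.contDiffAt_err hτ hx ht fun j hj => hb j hj.le) ht (hb i le_rfl)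

theorem contDiffAt_rhs (P : Plant n) {σ : Fin (n + 1) → ℕ} {χ : Fin (n + 1) → ℝ} {i : Fin (n + 1)}
    {E : Type*} [NormedAddCommGroup E] [NormedSpace ℝ E] {τ : E → ℝ} {x : E → Fin (n + 1) → ℝ}
    {p : E} (hτ : ContDiffAt ℝ 1 τ p) (hx : ContDiffAt ℝ 1 x p)
    (ht : τ p < D.T) (hb : ∀ j, |D.err (τ p) σ χ (x p) j| < χ j) :
    ContDiffAt ℝ 1 (fun q => P.rhs (x q) (D.input (τ q) σ χ (x q)) i) p := by
  have hxi := contDiffAt_pi.1 hx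
  have htr : ContDiffAt ℝ 1 (fun q => trunc (x q) i) p := contDiffAt_pi.2 fun j => hxi _
  unfold Plant.rhs
  refine ((P.h_contDiff i).contDiffAt.comp p htr |>.mul ?_).add ((P.f_contDiff i).contDiffAt.comp p htr)
  induction i using Fin.lastCases with
  | last =>
    rw [Fin.succ_last]
    simp only [Fin.snoc_last]
    exact D.contDiffAt_virt hτ hx ht fun j _ => hb j
  | cast i =>
    rw [Fin.succ_castSucc]
    simp only [Fin.snoc_castSucc]
    exact hxi _

theorem contDiffAt_etaRhs {σ : Fin (n + 1) → ℕ} {χ : Fin (n + 1) → ℝ} {i : Fin (n + 1)}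
    {E : Type*} [NormedAddCommGroup E] [NormedSpace ℝ E] {τ : E → ℝ} {x η : E → Fin (n + 1) → ℝ}
    {p : E} (hτ : ContDiffAt ℝ 1 τ p) (hx : ContDiffAt ℝ 1 x p) (hη : ContDiffAt ℝ 1 η p)
    (ht : τ p < D.T) (hb : ∀ j, |D.err (τ p) σ χ (x p) j| < χ j) :
    ContDiffAt ℝ 1 (fun q => D.etaRhs (τ q) σ χ (x q) (η q) i) p := by
  have hμ : ∀ r : ℝ, ContDiffAt ℝ 1 (fun q => D.μ (τ q) ^ r) p := fun r =>
    ((D.contDiffAt_μ ht).comp p hτ).rpow_const_of_ne (D.μ_pos ht).ne'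
  have hμ0 : ∀ r : ℝ, D.μ (τ p) ^ r ≠ 0 := fun r => (Real.rpow_pos_of_pos (D.μ_pos ht) r).ne'
  have he : ∀ j, ContDiffAt ℝ 1 (fun q => D.err (τ q) σ χ (x q) j) p := fun j =>
    D.contDiffAt_err hτ hx ht fun k _ => hb k
  unfold etaRhs
  refine ((((contDiffAt_const.mul (hμ _)).mul (contDiffAt_pi.1 hη i)).sub
    ((contDiffAt_const.mul (hμ _)).mul ((he i).pow 2))).add
    (ContDiffAt.sum fun j _ => (contDiffAt_const.mul (hμ _)).mul ((he j).pow 2))).add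
    (ContDiffAt.sum fun j _ => (contDiffAt_const.mul ((he j).pow 2)).div (hμ _) (hμ0 _)) |>.add ?_
  split_ifs
  · exact contDiffAt_const.div (hμ _) (hμ0 _)
  · exact contDiffAt_const

end Design

/-! ### Young's inequality and bounds of smooth functions on balls -/

/-- The weight `c` will be a coefficient of the auxiliary equation, so that the first summand is
already supplied there and only the second is left for the gain to dominate. -/
theorem mul_le_young {a b c : ℝ} (hc : 0 < c) : a * b ≤ c * a ^ 2 + b ^ 2 / (4 * c) := by
  have h : c * a ^ 2 + b ^ 2 / (4 * c) - a * b = (2 * c * a - b) ^ 2 / (4 * c) := by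
    field_simp
    ring
  have : 0 ≤ (2 * c * a - b) ^ 2 / (4 * c) := by positivity
  linarith

/-- A continuous real function is bounded on balls. -/
theorem exists_abs_le_of_norm_le {E : Type*} [NormedAddCommGroup E] [ProperSpace E] {g : E → ℝ}
    (hg : Continuous g) (R : ℝ) : ∃ C, 0 ≤ C ∧ ∀ z, ‖z‖ ≤ R → |g z| ≤ C := by
  obtain ⟨C, hC⟩ := (isCompact_closedBall (0 : E) R).exists_bound_of_continuousOn hg.continuousOn
  exact ⟨max C 0, le_max_right _ _, fun z hz =>
    (hC z (by simpa using hz)).trans (le_max_left _ _)⟩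

/-- A continuously differentiable function is Lipschitz at the origin, uniformly on balls. -/
theorem exists_abs_sub_le_of_norm_le {E : Type*} [NormedAddCommGroup E] [NormedSpace ℝ E]
    [ProperSpace E] {g : E → ℝ} (hg : ContDiff ℝ 1 g) (R : ℝ) :
    ∃ C, 0 ≤ C ∧ ∀ z, ‖z‖ ≤ R → |g z - g 0| ≤ C * ‖z‖ := by
  have hc : Continuous (fderiv ℝ g) := hg.continuous_fderiv one_ne_zero
  obtain ⟨C, hC⟩ := (isCompact_closedBall (0 : E) R).exists_bound_of_continuousOn hc.continuousOn
  refine ⟨max C 0, le_max_right _ _, fun z hz => ?_⟩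
  have h := (convex_closedBall (0 : E) R).norm_image_sub_le_of_norm_fderiv_le (𝕜 := ℝ) (f := g)
    (fun x _ => (hg.differentiable one_ne_zero) x)
    (fun x hx => (hC x hx).trans (le_max_left C 0))
    (x := 0) (y := z) (by simpa using (norm_nonneg z).trans hz) (by simpa using hz)
  simpa using h

/-! ### Bounds in channel `i` when the preceding channels are under control -/

namespace Design

variable {n : ℕ} (D : Design n)

/-- The first `i` channels are under control at time `t`, with margins measured by `B`. -/
structure Confined (B : ℝ) (i : Fin (n + 1)) (t : ℝ) (σ : Fin (n + 1) → ℕ)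
    (χ x : Fin (n + 1) → ℝ) : Prop where
  nonneg : 0 ≤ t
  lt_T : t < D.T
  gain : ∀ j < i, |D.Θ σ j| ≤ B
  margin : ∀ j < i, 1 ≤ B * (χ j ^ 2 - D.err t σ χ x j ^ 2)
  radius : ∀ j < i, |χ j| ≤ B
  scaled : ∀ j < i, D.μ t ^ D.β j * |D.err t σ χ x j| ≤ B
  err_le : |D.err t σ χ x i| ≤ B

/-- The weighted error `μ^{β_j/2} |s_j|`. -/
def werr (t : ℝ) (σ : Fin (n + 1) → ℕ) (χ x : Fin (n + 1) → ℝ) (j : Fin (n + 1)) : ℝ :=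
  D.μ t ^ (D.β j / 2) * |D.err t σ χ x j|

/-- The sum of the weighted errors of the first channels. -/
def wsum (t : ℝ) (σ : Fin (n + 1) → ℕ) (χ x : Fin (n + 1) → ℝ) (i : Fin (n + 1)) : ℝ :=
  ∑ j with j ≤ i, D.werr t σ χ x j

variable {D} {B t : ℝ} {σ : Fin (n + 1) → ℕ} {χ x : Fin (n + 1) → ℝ} {i j : Fin (n + 1)}

theorem one_le_μ_rpow (h0 : 0 ≤ t) (ht : t < D.T) {p : ℝ} (hp : 0 ≤ p) : 1 ≤ D.μ t ^ p :=
  Real.one_le_rpow (D.one_le_μ h0 ht) hp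

theorem werr_nonneg (ht : t < D.T) : 0 ≤ D.werr t σ χ x j :=
  mul_nonneg (Real.rpow_pos_of_pos (D.μ_pos ht) _).le (abs_nonneg _)

theorem β_pos (D : Design n) (i : Fin (n + 1)) : 0 < D.β i := zero_lt_one.trans (D.one_lt_β i)

theorem abs_err_le_werr (h0 : 0 ≤ t) (ht : t < D.T) : |D.err t σ χ x j| ≤ D.werr t σ χ x j :=
  le_mul_of_one_le_left (abs_nonneg _) (one_le_μ_rpow h0 ht (by have := D.β_pos j; linarith))

theorem werr_le_wsum (ht : t < D.T) (h : j ≤ i) : D.werr t σ χ x j ≤ D.wsum t σ χ x i :=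
  Finset.single_le_sum (f := fun j => D.werr t σ χ x j) (fun _ _ => werr_nonneg ht)
    (by simpa using h)

theorem wsum_mono (ht : t < D.T) (h : j ≤ i) : D.wsum t σ χ x j ≤ D.wsum t σ χ x i := by
  refine Finset.sum_le_sum_of_subset_of_nonneg ?_ fun _ _ _ => werr_nonneg ht
  intro k hk
  simp only [Finset.mem_filter, Finset.mem_univ, true_and] at hk ⊢
  exact hk.trans h

theorem wsum_nonneg (ht : t < D.T) : 0 ≤ D.wsum t σ χ x i :=
  Finset.sum_nonneg fun _ _ => werr_nonneg ht

theorem Confined.one_le_rpow (h : D.Confined B i t σ χ x) (j : Fin (n + 1)) :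
    1 ≤ D.μ t ^ D.β j := one_le_μ_rpow h.nonneg h.lt_T (D.β_pos j).le

theorem Confined.abs_err_le (h : D.Confined B i t σ χ x) (hj : j ≤ i) :
    |D.err t σ χ x j| ≤ B := by
  rcases hj.lt_or_eq with hj | rfl
  · exact (le_mul_of_one_le_left (abs_nonneg _) (h.one_le_rpow j)).trans (h.scaled j hj)
  · exact h.err_le

theorem Confined.mono (h : D.Confined B i t σ χ x) (hj : j ≤ i) : D.Confined B j t σ χ x where
  nonneg := h.nonneg
  lt_T := h.lt_T
  gain k hk := h.gain k (hk.trans_le hj)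
  margin k hk := h.margin k (hk.trans_le hj)
  radius k hk := h.radius k (hk.trans_le hj)
  scaled k hk := h.scaled k (hk.trans_le hj)
  err_le := h.abs_err_le hj

theorem Confined.nonneg_bound (h : D.Confined B i t σ χ x) : 0 ≤ B :=
  (abs_nonneg _).trans h.err_le

theorem inv_le_of_margin {B y : ℝ} (hB : 0 ≤ B) (h : 1 ≤ B * y) : 0 < y ∧ y⁻¹ ≤ B := by
  have hy : 0 < y := by
    by_contra hy
    have := mul_nonpos_of_nonneg_of_nonpos hB (not_lt.1 hy)
    linarith
  refine ⟨hy, ?_⟩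
  rw [inv_eq_one_div, div_le_iff₀ hy]
  exact h

/-- The margin bounds `1 / (χ² - s²)` by `B`, and `1 ≤ μ^β` lets the linear term of the law be
counted with the same power of `μ` as the barrier term. -/
theorem abs_virt_le (hB : 0 ≤ B) (h0 : 0 ≤ t) (ht : t < D.T) (hΘ : |D.Θ σ j| ≤ B)
    (hmar : 1 ≤ B * (χ j ^ 2 - D.err t σ χ x j ^ 2)) :
    |D.virt t σ χ x j| ≤ B * (D.K j + D.U j * B) * (D.μ t ^ D.β j * |D.err t σ χ x j|) := by
  obtain ⟨hy, hyi⟩ := inv_le_of_margin hB hmar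
  have hm : 1 ≤ D.μ t ^ D.β j := one_le_μ_rpow h0 ht (D.β_pos j).le
  have hK := D.K_pos j
  have hU := D.U_pos j
  set s := D.err t σ χ x j with hs
  set m := D.μ t ^ D.β j with hmdef
  have e : D.virt t σ χ x j = D.Θ σ j * (-(D.K j * s + D.U j * (χ j ^ 2 - s ^ 2)⁻¹ * (m * s))) := by
    simp only [virt, law, ← hs, ← hmdef, div_eq_mul_inv]
    ring
  rw [e, abs_mul, abs_neg, mul_assoc B]
  refine mul_le_mul (hΘ) ?_ (abs_nonneg _) hB
  refine (abs_add_le _ _).trans ?_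
  rw [abs_mul, abs_mul, abs_mul, abs_mul m, abs_of_pos hK, abs_of_pos hU,
    abs_of_pos (inv_pos.2 hy), abs_of_pos (by linarith : 0 < m), add_mul (D.K j)]
  gcongr
  exact le_mul_of_one_le_left (abs_nonneg _) hm

theorem Confined.abs_virt_le (h : D.Confined B i t σ χ x) (hj : j < i) :
    |D.virt t σ χ x j| ≤ B * (D.K j + D.U j * B) * (D.μ t ^ D.β j * |D.err t σ χ x j|) :=
  Design.abs_virt_le h.nonneg_bound h.nonneg h.lt_T (h.gain j hj) (h.margin j hj)

/-- Differentiating `μ^β` costs one power of `μ`, and `β + 1 ≤ 2β` because `β > 1`. The derivative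
`(χ² + s²) / (χ² - s²)²` of the barrier quotient is at most `2 B² B²` by radius and margin. -/
theorem Confined.abs_lawDeriv_le (h : D.Confined B i t σ χ x) (hj : j < i) (d : ℝ) :
    |D.lawDeriv t σ χ j (D.err t σ χ x j) d| ≤
      B * (D.K j + D.U j * (D.β j / D.T * B + 2 * B ^ 2 * B ^ 2)) *
        (D.μ t ^ (2 * D.β j) * |D.err t σ χ x j| + D.μ t ^ D.β j * |d|) := by
  have hB := h.nonneg_bound
  obtain ⟨hy, hyi⟩ := inv_le_of_margin hB (h.margin j hj)
  have hm := h.one_le_rpow j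
  have hK := D.K_pos j
  have hU := D.U_pos j
  have hβ := D.β_pos j
  have hT := D.T_pos
  have hm2 : D.μ t ^ (D.β j + 1) ≤ D.μ t ^ (2 * D.β j) :=
    D.rpow_le_rpow_μ h.nonneg h.lt_T (by linarith [D.one_lt_β j])
  have hm1 : 0 < D.μ t ^ (D.β j + 1) := Real.rpow_pos_of_pos (D.μ_pos h.lt_T) _
  have hχ : χ j ^ 2 ≤ B ^ 2 := by
    rw [← sq_abs]; exact pow_le_pow_left₀ (abs_nonneg _) (h.radius j hj) 2
  set s := D.err t σ χ x j with hs
  set m := D.μ t ^ D.β j with hmdef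
  set M := D.μ t ^ (2 * D.β j)
  set N := D.μ t ^ (D.β j + 1)
  have hM0 : 0 < M := hm1.trans_le hm2
  have hm0 : 0 < m := by linarith
  set y := χ j ^ 2 - s ^ 2 with hydef
  have hsum : χ j ^ 2 + s ^ 2 ≤ 2 * B ^ 2 := by linarith
  have e : D.lawDeriv t σ χ j s d = D.Θ σ j * (-(D.K j * d + D.U j * (D.β j / D.T * y⁻¹ * (N * s)
      + (χ j ^ 2 + s ^ 2) * (y⁻¹) ^ 2 * (m * d)))) := by
    simp only [lawDeriv, ← hydef, ← hmdef, div_eq_mul_inv, inv_pow]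
    ring
  rw [e, abs_mul, abs_neg, mul_assoc B]
  refine mul_le_mul (h.gain j hj) ?_ (abs_nonneg _) hB
  have h1 : |D.K j * d| ≤ D.K j * (M * |s| + m * |d|) := by
    rw [abs_mul, abs_of_pos hK]
    gcongr
    have := le_mul_of_one_le_left (abs_nonneg d) hm
    have : 0 ≤ M * |s| := by positivity
    linarith
  have h2 : |D.β j / D.T * y⁻¹ * (N * s)| ≤ D.β j / D.T * B * (M * |s| + m * |d|) := by
    rw [abs_mul, abs_mul N, abs_of_pos hm1, abs_of_pos (by positivity : 0 < D.β j / D.T * y⁻¹)]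
    gcongr
    have : 0 ≤ m * |d| := by positivity
    have : N * |s| ≤ M * |s| := by gcongr
    linarith
  have h3 : |(χ j ^ 2 + s ^ 2) * (y⁻¹) ^ 2 * (m * d)| ≤ 2 * B ^ 2 * B ^ 2 * (M * |s| + m * |d|) := by
    rw [abs_mul, abs_mul m, abs_of_pos (by linarith : 0 < m),
      abs_of_nonneg (by positivity : 0 ≤ (χ j ^ 2 + s ^ 2) * (y⁻¹) ^ 2)]
    gcongr
    have : 0 ≤ M * |s| := by positivity
    linarith
  refine (abs_add_le _ _).trans ?_
  rw [abs_mul (D.U j), abs_of_pos hU, add_mul (D.K j), mul_assoc (D.U j)]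
  refine add_le_add h1 (mul_le_mul_of_nonneg_left ?_ hU.le)
  rw [add_mul (D.β j / D.T * B)]
  exact (abs_add_le _ _).trans (add_le_add h2 h3)

/-- The state variable following channel `i`; for the last channel this is the input. -/
def next (D : Design n) (t : ℝ) (σ : Fin (n + 1) → ℕ) (χ x : Fin (n + 1) → ℝ) (i : Fin (n + 1)) : ℝ :=
  (Fin.snoc (α := fun _ => ℝ) x (D.input t σ χ x) : Fin (n + 2) → ℝ) i.succ

theorem next_castSucc (k : Fin n) :
    D.next t σ χ x k.castSucc = D.virt t σ χ x k.castSucc + D.err t σ χ x k.succ := by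
  rw [next, Fin.succ_castSucc, err_succ, Fin.snoc_castSucc]
  ring

theorem next_last : D.next t σ χ x (Fin.last n) = D.virt t σ χ x (Fin.last n) := by
  rw [next, Fin.succ_last]
  simp only [Fin.snoc_last, input]

theorem rhs_eq (P : Plant n) :
    P.rhs x (D.input t σ χ x) i = P.h i (trunc x i) * D.next t σ χ x i + P.f i (trunc x i) := rfl

theorem norm_trunc_le {C : ℝ} (hC : 0 ≤ C) (h : ∀ j ≤ i, |x j| ≤ C) : ‖trunc x i‖ ≤ C := by
  refine (pi_norm_le_iff_of_nonneg hC).2 fun j => h _ ?_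
  rw [Fin.le_def]
  simpa using Nat.lt_succ_iff.1 j.isLt

/-- A state is its error plus the virtual control of the preceding channel, which `abs_virt_le`
controls. The first bound confines the state to a ball, where the nonlinearities have uniform
constants; the second is linear in the errors, as needed to apply a Lipschitz estimate. -/
theorem Confined.exists_state_le (D : Design n) (B : ℝ) (i : Fin (n + 1)) :
    ∃ C, 0 ≤ C ∧ ∀ t σ χ x, D.Confined B i t σ χ x → |x i| ≤ C ∧
      |x i| ≤ C * (D.μ t ^ (D.β i / 2) * D.wsum t σ χ x i) := by
  induction i using Fin.cases with
  | zero =>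
    refine ⟨max B 1, le_max_of_le_right zero_le_one, fun t σ χ x h => ⟨h.err_le.trans (le_max_left _ _), ?_⟩⟩
    have h1 : |x 0| ≤ D.wsum t σ χ x 0 :=
      (abs_err_le_werr (σ := σ) (χ := χ) (j := 0) h.nonneg h.lt_T).trans (werr_le_wsum h.lt_T le_rfl)
    have h2 : 1 ≤ D.μ t ^ (D.β 0 / 2) := one_le_μ_rpow h.nonneg h.lt_T (by linarith [D.β_pos 0])
    have h3 := wsum_nonneg (σ := σ) (χ := χ) (x := x) (i := 0) h.lt_T
    calc |x 0| ≤ 1 * (1 * D.wsum t σ χ x 0) := by linarith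
      _ ≤ _ := by gcongr; exact le_max_right _ _
  | succ k =>
    by_cases hB : 0 ≤ B
    swap
    · exact ⟨0, le_rfl, fun t σ χ x h => absurd h.nonneg_bound hB⟩
    have hK := D.K_pos k.castSucc
    have hU := D.U_pos k.castSucc
    set A := B * (D.K k.castSucc + D.U k.castSucc * B) with hA
    have hA0 : 0 ≤ A := by positivity
    have hlt : k.castSucc < k.succ := Fin.castSucc_lt_succ
    refine ⟨A * B + B + A + 1, by positivity, fun t σ χ x h => ?_⟩
    have h1 := h.abs_virt_le hlt
    rw [← hA] at h1
    have h2 := h.scaled _ hlt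
    have h3 := h.err_le
    have hx : |x k.succ| ≤ |D.virt t σ χ x k.castSucc| + |D.err t σ χ x k.succ| := by
      have : x k.succ = D.virt t σ χ x k.castSucc + D.err t σ χ x k.succ := by rw [err_succ]; ring
      rw [this]; exact abs_add_le _ _
    constructor
    · have := mul_le_mul_of_nonneg_left h2 hA0
      linarith
    · have hμ := D.μ_pos h.lt_T
      have hw := werr_le_wsum (σ := σ) (χ := χ) (x := x) h.lt_T hlt.le
      have hw' := werr_le_wsum (σ := σ) (χ := χ) (x := x) h.lt_T (le_refl k.succ)
      have h5 := abs_err_le_werr (σ := σ) (χ := χ) (x := x) (j := k.succ) h.nonneg h.lt_T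
      have h4 : 1 ≤ D.μ t ^ (D.β k.succ / 2) :=
        one_le_μ_rpow h.nonneg h.lt_T (by linarith [D.β_pos k.succ])
      have h6 : D.μ t ^ D.β k.castSucc * |D.err t σ χ x k.castSucc| ≤
          D.μ t ^ (D.β k.succ / 2) * D.wsum t σ χ x k.succ := by
        have : D.μ t ^ D.β k.castSucc =
            D.μ t ^ (D.β k.castSucc / 2) * D.μ t ^ (D.β k.castSucc / 2) := by
          rw [← Real.rpow_add hμ]; congr 1; ring
        rw [this, mul_assoc]
        refine mul_le_mul (D.rpow_le_rpow_μ h.nonneg h.lt_T (by linarith [D.β_mono hlt.le])) hw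
          (werr_nonneg h.lt_T) (by positivity)
      have h7 : |D.err t σ χ x k.succ| ≤ D.μ t ^ (D.β k.succ / 2) * D.wsum t σ χ x k.succ :=
        (h5.trans hw').trans (le_mul_of_one_le_left (wsum_nonneg h.lt_T) h4)
      have h8 := mul_le_mul_of_nonneg_left h6 hA0
      have h9 : 0 ≤ (A * B + B) * (D.μ t ^ (D.β k.succ / 2) * D.wsum t σ χ x k.succ) :=
        mul_nonneg (by positivity) (mul_nonneg (by positivity) (wsum_nonneg h.lt_T))
      linarith

theorem Confined.exists_states_le (D : Design n) (B : ℝ) (i : Fin (n + 1)) :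
    ∃ C, 0 ≤ C ∧ ∀ t σ χ x, D.Confined B i t σ χ x → ‖trunc x i‖ ≤ C ∧
      ‖trunc x i‖ ≤ C * (D.μ t ^ (D.β i / 2) * D.wsum t σ χ x i) := by
  choose C hC0 hC using fun j => Confined.exists_state_le D B j
  have hsum : ∀ j, C j ≤ ∑ j, C j := fun j =>
    Finset.single_le_sum (f := C) (fun j _ => hC0 j) (Finset.mem_univ j)
  have h0 : 0 ≤ ∑ j, C j := Finset.sum_nonneg fun j _ => hC0 j
  refine ⟨∑ j, C j, h0, fun t σ χ x h => ⟨norm_trunc_le h0 fun j hj => ?_, ?_⟩⟩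
  · exact (hC j t σ χ x (h.mono hj)).1.trans (hsum j)
  · have hμ := D.μ_pos h.lt_T
    refine norm_trunc_le (mul_nonneg h0 (mul_nonneg (by positivity) (wsum_nonneg h.lt_T)))
      fun j hj => (hC j t σ χ x (h.mono hj)).2.trans ?_
    refine mul_le_mul (hsum j) (mul_le_mul ?_ (wsum_mono h.lt_T hj) (wsum_nonneg h.lt_T)
      (by positivity)) (mul_nonneg (by positivity) (wsum_nonneg h.lt_T)) h0
    exact D.rpow_le_rpow_μ h.nonneg h.lt_T (by linarith [D.β_mono hj])

/-- On the ball containing the states, `f_i` is Lipschitz at the origin; only the value `f_i(0)` is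
not controlled by the errors. -/
theorem Confined.exists_f_le (D : Design n) (P : Plant n) (B : ℝ) (i : Fin (n + 1)) :
    ∃ C, 0 ≤ C ∧ ∀ t σ χ x, D.Confined B i t σ χ x →
      |P.f i (trunc x i)| ≤ |P.f i 0| + C * (D.μ t ^ (D.β i / 2) * D.wsum t σ χ x i) := by
  obtain ⟨R, hR0, hR⟩ := Confined.exists_states_le D B i
  obtain ⟨L, hL0, hL⟩ := exists_abs_sub_le_of_norm_le (P.f_contDiff i) R
  refine ⟨L * R, by positivity, fun t σ χ x h => ?_⟩
  obtain ⟨h1, h2⟩ := hR t σ χ x h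
  have h3 := hL _ h1
  have h4 := mul_le_mul_of_nonneg_left h2 hL0
  have h5 := abs_add_le (P.f i 0) (P.f i (trunc x i) - P.f i 0)
  rw [add_sub_cancel] at h5
  linarith

/-- A continuous nowhere vanishing function is bounded and bounded away from zero on a ball. The
lower bound turns a large `|Θ_i|` into a large `|h_i Θ_i|`. -/
theorem Confined.exists_h_le (D : Design n) (P : Plant n) (B : ℝ) (i : Fin (n + 1)) :
    ∃ C, 0 < C ∧ ∀ t σ χ x, D.Confined B i t σ χ x →
      |P.h i (trunc x i)| ≤ C ∧ C⁻¹ ≤ |P.h i (trunc x i)| := by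
  obtain ⟨R, hR0, hR⟩ := Confined.exists_states_le D B i
  have hc := (P.h_contDiff i).continuous
  obtain ⟨C₁, hC₁0, hC₁⟩ := exists_abs_le_of_norm_le hc R
  obtain ⟨C₂, hC₂0, hC₂⟩ := exists_abs_le_of_norm_le (hc.inv₀ (P.h_ne_zero i)) R
  refine ⟨C₁ + C₂ + 1, by positivity, fun t σ χ x h => ?_⟩
  have h1 := hC₁ _ (hR t σ χ x h).1
  have h2 := hC₂ _ (hR t σ χ x h).1
  refine ⟨by linarith, ?_⟩
  rw [Pi.inv_apply, abs_inv] at h2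
  exact inv_le_of_inv_le₀ (P.h_abs_pos i _) (by linarith)

/-- The part of `ṡ_i` that is not driven by the next variable is dominated by the weighted errors. -/
theorem Confined.exists_drift_le (D : Design n) (P : Plant n)
    (hf : ∀ i : Fin n, P.f i.castSucc 0 = 0) (B : ℝ) (i : Fin (n + 1)) :
    ∃ C, 0 ≤ C ∧ ∀ t σ χ x, D.Confined B i t σ χ x →
      |D.errDeriv P t σ χ x i - P.h i (trunc x i) * D.next t σ χ x i| ≤
        |P.f i 0| + C * (D.μ t ^ (D.β i / 2) * D.wsum t σ χ x i) := by
  induction i using Fin.induction with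
  | zero =>
    obtain ⟨C, hC0, hC⟩ := Confined.exists_f_le D P B 0
    refine ⟨C, hC0, fun t σ χ x h => ?_⟩
    have := hC t σ χ x h
    rwa [errDeriv_zero, rhs_eq, add_sub_cancel_left]
  | succ k ih =>
    by_cases hB : 0 ≤ B
    swap
    · exact ⟨0, le_rfl, fun t σ χ x h => absurd h.nonneg_bound hB⟩
    obtain ⟨C, hC0, hC⟩ := ih
    obtain ⟨F, hF0, hF⟩ := Confined.exists_f_le D P B k.succ
    obtain ⟨H, hH0, hH⟩ := Confined.exists_h_le D P B k.castSucc
    have hlt : k.castSucc < k.succ := Fin.castSucc_lt_succ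
    have hK := D.K_pos k.castSucc
    have hU := D.U_pos k.castSucc
    have hβ := D.β_pos k.castSucc
    have hT := D.T_pos
    set A := B * (D.K k.castSucc + D.U k.castSucc * B) with hA
    set A' := B * (D.K k.castSucc + D.U k.castSucc *
      (D.β k.castSucc / D.T * B + 2 * B ^ 2 * B ^ 2)) with hA'
    have hA0 : 0 ≤ A := by positivity
    have hA'0 : 0 ≤ A' := by positivity
    refine ⟨F + A' * (1 + H * (A + 1) + C), by positivity, fun t σ χ x h => ?_⟩
    have hμ := D.μ_pos h.lt_T
    have hlaw := h.abs_lawDeriv_le hlt (D.errDeriv P t σ χ x k.castSucc)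
    have hvirt := h.abs_virt_le hlt
    have hdrift := hC t σ χ x (h.mono hlt.le)
    have hff := hF t σ χ x h
    have hhh := (hH t σ χ x (h.mono hlt.le)).1
    -- Channel `k` is not the last one, so its drift has no constant term. This matters: below, the
    -- drift gets multiplied by `μ^{β_k}`.
    rw [hf k, abs_zero, zero_add] at hdrift
    rw [next_castSucc] at hdrift
    rw [← hA] at hvirt
    rw [← hA'] at hlaw
    have hsplit : D.errDeriv P t σ χ x k.succ - P.h k.succ (trunc x k.succ) * D.next t σ χ x k.succ
        = P.f k.succ (trunc x k.succ) - D.lawDeriv t σ χ k.castSucc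
          (D.err t σ χ x k.castSucc) (D.errDeriv P t σ χ x k.castSucc) := by
      rw [errDeriv_succ, rhs_eq]; ring
    rw [hsplit]
    -- comparison of the powers of `μ`
    set Y := D.μ t ^ (D.β k.succ / 2) * D.wsum t σ χ x k.succ with hY
    have hW0 := wsum_nonneg (σ := σ) (χ := χ) (x := x) (i := k.succ) h.lt_T
    have hW0' := wsum_nonneg (σ := σ) (χ := χ) (x := x) (i := k.castSucc) h.lt_T
    have hWle := wsum_mono (σ := σ) (χ := χ) (x := x) h.lt_T hlt.le
    have hw := werr_le_wsum (σ := σ) (χ := χ) (x := x) h.lt_T (le_refl k.castSucc)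
    have hw0 := werr_nonneg (σ := σ) (χ := χ) (x := x) (j := k.castSucc) h.lt_T
    have hw' := werr_le_wsum (σ := σ) (χ := χ) (x := x) h.lt_T (le_refl k.succ)
    have h3β := D.three_mul_β_le hlt
    have hβ' := D.β_mono hlt.le
    have hpow : ∀ {p : ℝ}, p ≤ D.β k.succ / 2 → D.μ t ^ p ≤ D.μ t ^ (D.β k.succ / 2) :=
      fun hp => D.rpow_le_rpow_μ h.nonneg h.lt_T hp
    set s := D.err t σ χ x k.castSucc with hs
    set s' := D.err t σ χ x k.succ with hs'
    set b := D.β k.castSucc with hb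
    -- The decisive comparison: one factor `μ^{b/2}` goes into the weighted error, and the remaining
    -- `μ^{3b/2}` is at most `μ^{β_{k+1}/2}` by the growth condition `3 β_k ≤ β_{k+1}`.
    have e1 : D.μ t ^ (2 * b) * |s| ≤ Y := by
      have : D.μ t ^ (2 * b) * |s| = D.μ t ^ (3 * b / 2) * D.werr t σ χ x k.castSucc := by
        rw [werr, ← mul_assoc, ← Real.rpow_add hμ, ← hb, ← hs]; congr 2; ring
      rw [this]
      exact mul_le_mul (hpow (by linarith)) (hw.trans hWle) hw0 (by positivity)
    have e2 : D.μ t ^ b * (D.μ t ^ b * |s|) ≤ Y := by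
      rw [← mul_assoc, ← Real.rpow_add hμ, ← two_mul]; exact e1
    have e3 : D.μ t ^ b * (D.μ t ^ (b / 2) * D.wsum t σ χ x k.castSucc) ≤ Y := by
      rw [← mul_assoc, ← Real.rpow_add hμ]
      exact mul_le_mul (hpow (by linarith)) hWle hW0' (by positivity)
    have e4 : D.μ t ^ b * |s'| ≤ Y := by
      have : D.μ t ^ b * |s'| ≤ D.μ t ^ (D.β k.succ / 2) * D.werr t σ χ x k.succ := by
        rw [werr, ← mul_assoc, ← Real.rpow_add hμ, ← hs']
        exact mul_le_mul_of_nonneg_right (D.rpow_le_rpow_μ h.nonneg h.lt_T (by linarith))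
          (abs_nonneg _)
      exact this.trans (mul_le_mul_of_nonneg_left hw' (by positivity))
    set d := D.errDeriv P t σ χ x k.castSucc with hd
    set g := P.h k.castSucc (trunc x k.castSucc) with hg
    have hm0 : 0 ≤ D.μ t ^ b := by positivity
    have hd_le : |d| ≤ H * (A * (D.μ t ^ b * |s|) + |s'|)
        + C * (D.μ t ^ (b / 2) * D.wsum t σ χ x k.castSucc) := by
      have h1 : |d| ≤ |g * (D.virt t σ χ x k.castSucc + s')|
          + |d - g * (D.virt t σ χ x k.castSucc + s')| := by
        have := abs_add_le (g * (D.virt t σ χ x k.castSucc + s'))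
          (d - g * (D.virt t σ χ x k.castSucc + s'))
        rwa [add_sub_cancel] at this
      have h2 : |g * (D.virt t σ χ x k.castSucc + s')| ≤ H * (A * (D.μ t ^ b * |s|) + |s'|) := by
        rw [abs_mul]
        exact mul_le_mul hhh ((abs_add_le _ _).trans (by linarith)) (abs_nonneg _) hH0.le
      linarith
    have e5 : D.μ t ^ b * |d| ≤ (H * (A + 1) + C) * Y := by
      have h1 := mul_le_mul_of_nonneg_left hd_le hm0
      have h2 : D.μ t ^ b * (H * (A * (D.μ t ^ b * |s|) + |s'|)
          + C * (D.μ t ^ (b / 2) * D.wsum t σ χ x k.castSucc)) =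
          H * (A * (D.μ t ^ b * (D.μ t ^ b * |s|)) + D.μ t ^ b * |s'|)
          + C * (D.μ t ^ b * (D.μ t ^ (b / 2) * D.wsum t σ χ x k.castSucc)) := by ring
      rw [h2] at h1
      have h3 : H * (A * (D.μ t ^ b * (D.μ t ^ b * |s|)) + D.μ t ^ b * |s'|)
          + C * (D.μ t ^ b * (D.μ t ^ (b / 2) * D.wsum t σ χ x k.castSucc)) ≤
          H * (A * Y + Y) + C * Y := by gcongr
      linarith
    have e6 : |D.lawDeriv t σ χ k.castSucc s d| ≤ A' * (Y + (H * (A + 1) + C) * Y) :=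
      hlaw.trans (mul_le_mul_of_nonneg_left (add_le_add e1 e5) hA'0)
    have e7 := abs_sub (P.f k.succ (trunc x k.succ)) (D.lawDeriv t σ χ k.castSucc s d)
    linarith

theorem V_nonneg (hb : |D.err t σ χ x i| < χ i) : 0 ≤ D.V t σ χ x i := by
  have h := sub_sq_pos hb
  refine mul_nonneg (by norm_num) (Real.log_nonneg ((one_le_div h).2 ?_))
  linarith [sq_nonneg (D.err t σ χ x i)]

/-- This is `log y ≤ y - 1`. It lets the damping term `a_i μ^{β_i} V_i` be dominated by a multiple
of `μ^{β_i} r²`. -/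
theorem V_le (hb : |D.err t σ χ x i| < χ i) :
    D.V t σ χ x i ≤ 1 / 2 * (D.err t σ χ x i ^ 2 / (χ i ^ 2 - D.err t σ χ x i ^ 2)) := by
  have h := sub_sq_pos hb
  have hχ : 0 < χ i := (abs_nonneg _).trans_lt hb
  have := Real.log_le_sub_one_of_pos (div_pos (by positivity : 0 < χ i ^ 2) h)
  unfold V
  refine mul_le_mul_of_nonneg_left (this.trans (le_of_eq ?_)) (by norm_num)
  rw [div_sub_one h.ne']
  ring

/-- This is `1 - 1/y ≤ log y`. It turns decay of `V_i` into decay of `s_i²`. -/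
theorem sq_err_le_V (hb : |D.err t σ χ x i| < χ i) :
    D.err t σ χ x i ^ 2 ≤ 2 * χ i ^ 2 * D.V t σ χ x i := by
  have h := sub_sq_pos hb
  have hχ : 0 < χ i := (abs_nonneg _).trans_lt hb
  have := Real.one_sub_inv_le_log_of_pos (div_pos (by positivity : 0 < χ i ^ 2) h)
  have h2 : D.err t σ χ x i ^ 2 = χ i ^ 2 * (1 - (χ i ^ 2 / (χ i ^ 2 - D.err t σ χ x i ^ 2))⁻¹) := by
    rw [inv_div]; field_simp; ring
  have h3 := mul_le_mul_of_nonneg_left this (by positivity : 0 ≤ χ i ^ 2)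
  unfold V
  linarith

/-- The logarithm inverted: an upper bound for `V_i` is the same as a lower bound for the distance
to the barrier. -/
theorem margin_of_V (hb : |D.err t σ χ x i| < χ i) :
    χ i ^ 2 * Real.exp (-(2 * D.V t σ χ x i)) = χ i ^ 2 - D.err t σ χ x i ^ 2 := by
  have h := sub_sq_pos hb
  have hχ : 0 < χ i := (abs_nonneg _).trans_lt hb
  have : -(2 * D.V t σ χ x i) = Real.log ((χ i ^ 2 - D.err t σ χ x i ^ 2) / χ i ^ 2) := by
    rw [← inv_div, Real.log_inv]; unfold V; ring
  rw [this, Real.exp_log (by positivity)]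
  field_simp

/-- The derivative of the barrier Lyapunov function along a motion. -/
theorem hasDerivWithinAt_V {P : Plant n} (ht : t < D.T)
    {x : ℝ → Fin (n + 1) → ℝ} {S : Set ℝ}
    (hx : ∀ i, HasDerivWithinAt (fun τ => x τ i) (P.rhs (x t) (D.input t σ χ (x t)) i) S t)
    (hb : ∀ j ≤ i, |D.err t σ χ (x t) j| < χ j) :
    HasDerivWithinAt (fun τ => D.V τ σ χ (x τ) i)
      (D.err t σ χ (x t) i / (χ i ^ 2 - D.err t σ χ (x t) i ^ 2) * D.errDeriv P t σ χ (x t) i) S t := by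
  have h := sub_sq_pos (hb i le_rfl)
  have hχ : 0 < χ i := (abs_nonneg _).trans_lt (hb i le_rfl)
  have hd := D.hasDerivWithinAt_err ht hx fun j hj => hb j (le_of_lt hj)
  have h1 := ((hasDerivWithinAt_const t S (χ i ^ 2)).fun_div ((hd.pow 2).const_sub (χ i ^ 2)) h.ne').log
    (div_pos (by positivity) h).ne'
  refine (h1.const_mul (1 / 2 : ℝ)).congr_deriv ?_
  simp only [Pi.pow_apply]
  field_simp
  push_cast
  ring

end Design

/-! ### The dissipation inequality for a sufficiently large gain -/

namespace Design

variable {n : ℕ} {D : Design n} {B t : ℝ} {σ : Fin (n + 1) → ℕ} {χ x : Fin (n + 1) → ℝ}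
  {i j : Fin (n + 1)}

/-- The error of the next channel enters with the weight provided by the auxiliary equation. -/
theorem exists_next_le (D : Design n) (i : Fin (n + 1)) (H : ℝ) :
    ∃ C, 0 ≤ C ∧ ∀ t σ χ x (g r : ℝ), t < D.T → |g| ≤ H →
      r * (g * (D.next t σ χ x i - D.virt t σ χ x i)) ≤
        ∑ j with j.val = i.val + 1, D.c i j * D.err t σ χ x j ^ 2 / D.μ t ^ D.β i
          + C * (D.μ t ^ D.β i * r ^ 2) := by
  induction i using Fin.lastCases with
  | last =>
    refine ⟨0, le_rfl, fun t σ χ x g r ht _ => ?_⟩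
    rw [next_last, sub_self]
    have : ∀ j : Fin (n + 1), j.val ≠ (Fin.last n).val + 1 := fun j hj => by
      have := j.isLt
      simp at hj
      omega
    rw [Finset.sum_eq_zero fun j hj => absurd (Finset.mem_filter.1 hj).2 (this j)]
    simp
  | cast k =>
    have hc : 0 < D.c k.castSucc k.succ := D.c_pos _ _ (Or.inr (by simp))
    refine ⟨H ^ 2 / (4 * D.c k.castSucc k.succ), by positivity, fun t σ χ x g r ht hg => ?_⟩
    have hM : 0 < D.μ t ^ D.β k.castSucc := Real.rpow_pos_of_pos (D.μ_pos ht) _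
    have hfil : (Finset.univ.filter fun j : Fin (n + 1) => j.val = k.castSucc.val + 1)
        = {k.succ} := by
      ext j
      simp [Fin.ext_iff]
    rw [hfil, Finset.sum_singleton, next_castSucc, add_sub_cancel_left]
    set s := D.err t σ χ x k.succ
    set M := D.μ t ^ D.β k.castSucc
    set c := D.c k.castSucc k.succ
    have hm : 0 < √M := Real.sqrt_pos.2 hM
    have hmm : √M ^ 2 = M := Real.sq_sqrt hM.le
    -- The split by `√M`, with `M = μ^{β_i}`, produces exactly the source term `c s_{i+1}² /
    -- μ^{β_i}` of the auxiliary equation.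
    have h1 := mul_le_young (a := s / √M) (b := √M * (r * g)) hc
    have h2 : s / √M * (√M * (r * g)) = r * (g * s) := by field_simp
    have h3 : c * (s / √M) ^ 2 = c * s ^ 2 / M := by rw [div_pow, hmm]; ring
    have h4 : (√M * (r * g)) ^ 2 / (4 * c) = g ^ 2 / (4 * c) * (M * r ^ 2) := by
      rw [mul_pow, hmm]; ring
    rw [h2, h3, h4] at h1
    have h5 : g ^ 2 ≤ H ^ 2 := by rw [← sq_abs g]; exact pow_le_pow_left₀ (abs_nonneg _) hg 2
    have h6 : g ^ 2 / (4 * c) * (M * r ^ 2) ≤ H ^ 2 / (4 * c) * (M * r ^ 2) := by gcongr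
    linarith

/-- The value of the last nonlinearity at the origin is absorbed by the last auxiliary equation. -/
theorem exists_offset_le (D : Design n) (P : Plant n) (hf : ∀ i : Fin n, P.f i.castSucc 0 = 0)
    (i : Fin (n + 1)) :
    ∃ C, 0 ≤ C ∧ ∀ t (r : ℝ), t < D.T →
      |r| * |P.f i 0| ≤ (if i = Fin.last n then D.ζ / D.μ t ^ D.β i else 0)
        + C * (D.μ t ^ D.β i * r ^ 2) := by
  induction i using Fin.lastCases with
  | cast k =>
    refine ⟨0, le_rfl, fun t r _ => ?_⟩
    rw [hf k, if_neg (Fin.castSucc_lt_last k).ne]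
    simp
  | last =>
    have hζ := D.ζ_pos
    refine ⟨|P.f (Fin.last n) 0| ^ 2 / (4 * D.ζ), by positivity, fun t r ht => ?_⟩
    have hM : 0 < D.μ t ^ D.β (Fin.last n) := Real.rpow_pos_of_pos (D.μ_pos ht) _
    rw [if_pos rfl]
    set M := D.μ t ^ D.β (Fin.last n)
    have hm : 0 < √M := Real.sqrt_pos.2 hM
    have hmm : √M ^ 2 = M := Real.sq_sqrt hM.le
    have h1 := mul_le_young (a := 1 / √M) (b := √M * (|r| * |P.f (Fin.last n) 0|)) hζ
    have h2 : 1 / √M * (√M * (|r| * |P.f (Fin.last n) 0|)) = |r| * |P.f (Fin.last n) 0| := by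
      field_simp
    have h3 : D.ζ * (1 / √M) ^ 2 = D.ζ / M := by rw [div_pow, hmm]; ring
    have h4 : (√M * (|r| * |P.f (Fin.last n) 0|)) ^ 2 / (4 * D.ζ)
        = |P.f (Fin.last n) 0| ^ 2 / (4 * D.ζ) * (M * r ^ 2) := by
      rw [mul_pow, hmm, mul_pow, sq_abs r]; ring
    rw [h2, h3, h4] at h1
    exact h1

theorem wsum_eq : D.wsum t σ χ x i = ∑ j with j < i, D.werr t σ χ x j + D.werr t σ χ x i := by
  unfold wsum
  have : (Finset.univ.filter fun j : Fin (n + 1) => j ≤ i)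
      = insert i (Finset.univ.filter fun j : Fin (n + 1) => j < i) := by
    ext j
    simp [le_iff_eq_or_lt]
  rw [this, Finset.sum_insert (by simp), add_comm]

theorem werr_sq (ht : t < D.T) :
    D.werr t σ χ x j ^ 2 = D.μ t ^ D.β j * D.err t σ χ x j ^ 2 := by
  rw [werr, mul_pow, sq_abs, ← Real.rpow_natCast, ← Real.rpow_mul (D.μ_pos ht).le]
  congr 2
  push_cast
  ring

/-- The cross terms with the preceding channels are absorbed by the auxiliary equation. -/
theorem exists_cross_le (D : Design n) (i : Fin (n + 1)) {C B : ℝ} (hC : 0 ≤ C) :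
    ∃ C', 0 ≤ C' ∧ ∀ t σ χ x, 0 ≤ t → t < D.T → |D.err t σ χ x i| < χ i → χ i ≤ B →
      ∀ r, r = D.err t σ χ x i / (χ i ^ 2 - D.err t σ χ x i ^ 2) →
      |r| * (C * (D.μ t ^ (D.β i / 2) * D.wsum t σ χ x i)) ≤
        ∑ j with j < i, D.c i j * D.μ t ^ D.β j * D.err t σ χ x j ^ 2
          + C' * (D.μ t ^ D.β i * r ^ 2) := by
  have hc : ∀ j ∈ (Finset.univ.filter fun j : Fin (n + 1) => j < i), 0 < D.c i j := fun j hj =>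
    D.c_pos _ _ (Or.inl (Finset.mem_filter.1 hj).2)
  refine ⟨∑ j with j < i, C ^ 2 / (4 * D.c i j) + C * B ^ 2,
    add_nonneg (Finset.sum_nonneg fun j hj => by have := hc j hj; positivity) (by positivity),
    fun t σ χ x h0 ht hb hB r hr => ?_⟩
  have hμ := D.μ_pos ht
  have hy := sub_sq_pos hb
  set s := D.err t σ χ x i with hs
  set m := D.μ t ^ (D.β i / 2) with hm
  have hmm : D.μ t ^ D.β i = m ^ 2 := by
    rw [hm, ← Real.rpow_natCast, ← Real.rpow_mul hμ.le]; congr 1; push_cast; ring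
  have hm0 : 0 < m := Real.rpow_pos_of_pos hμ _
  have hχ0 : 0 < χ i := (abs_nonneg _).trans_lt hb
  -- The auxiliary equation has no source term for the channel's own error; that error is bounded by
  -- `r` instead.
  have hsr : |s| ≤ B ^ 2 * |r| := by
    have : |s| = (χ i ^ 2 - s ^ 2) * |r| := by
      rw [hr, abs_div, abs_of_pos hy]; field_simp
    rw [this]
    have : χ i ^ 2 ≤ B ^ 2 := pow_le_pow_left₀ hχ0.le hB 2
    gcongr
    linarith [sq_nonneg s]
  have hself : |r| * (C * (m * D.werr t σ χ x i)) ≤ C * B ^ 2 * (m ^ 2 * r ^ 2) := by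
    rw [werr, ← hm, ← hs]
    calc |r| * (C * (m * (m * |s|))) = C * m ^ 2 * |r| * |s| := by ring
      _ ≤ C * m ^ 2 * |r| * (B ^ 2 * |r|) := by gcongr
      _ = C * B ^ 2 * (m ^ 2 * |r| ^ 2) := by ring
      _ = _ := by rw [sq_abs]
  have hoth : |r| * (C * (m * ∑ j with j < i, D.werr t σ χ x j)) ≤
      ∑ j with j < i, (D.c i j * D.μ t ^ D.β j * D.err t σ χ x j ^ 2
        + C ^ 2 / (4 * D.c i j) * (m ^ 2 * r ^ 2)) := by
    rw [Finset.mul_sum, Finset.mul_sum, Finset.mul_sum]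
    refine Finset.sum_le_sum fun j hj => ?_
    have h1 := mul_le_young (a := D.werr t σ χ x j) (b := C * m * |r|) (hc j hj)
    rw [werr_sq ht] at h1
    have h2 : (C * m * |r|) ^ 2 / (4 * D.c i j) = C ^ 2 / (4 * D.c i j) * (m ^ 2 * r ^ 2) := by
      rw [mul_pow, mul_pow, sq_abs]; ring
    rw [h2] at h1
    linarith
  rw [Finset.sum_add_distrib, ← Finset.sum_mul] at hoth
  rw [wsum_eq, hmm]
  linarith

/-- With a sufficiently large gain of the right sign the auxiliary equation dominates the
derivative of the barrier Lyapunov function. -/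
theorem exists_gain_dissipation (D : Design n) (P : Plant n)
    (hf : ∀ i : Fin n, P.f i.castSucc 0 = 0) (B : ℝ) (i : Fin (n + 1)) :
    ∃ G, ∀ t σ χ x η, D.Confined B i t σ χ x → |D.err t σ χ x i| < χ i → χ i ≤ B →
      G ≤ P.h i (trunc x i) * D.Θ σ i →
      D.err t σ χ x i / (χ i ^ 2 - D.err t σ χ x i ^ 2) * D.errDeriv P t σ χ x i ≤
        D.etaRhs t σ χ x η i - D.a i * D.μ t ^ D.β i * (D.V t σ χ x i - η i) := by
  -- None of these constants involves `Θ_i`, since `Confined` bounds only the gains of the channels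
  -- before `i`. So `G` is fixed before the gain of channel `i` is chosen.
  obtain ⟨C₁, hC₁0, hC₁⟩ := Confined.exists_drift_le D P hf B i
  obtain ⟨H, hH0, hH⟩ := Confined.exists_h_le D P B i
  obtain ⟨C₂, hC₂0, hC₂⟩ := exists_next_le D i H
  obtain ⟨C₃, hC₃0, hC₃⟩ := exists_offset_le D P hf i
  obtain ⟨C₄, hC₄0, hC₄⟩ := exists_cross_le D i (B := B) hC₁0
  have hK := D.K_pos i
  have hU := D.U_pos i
  have ha := D.a_pos i
  have hQ := D.Q_pos i
  -- The numerator adds up the coefficients of `μ^{β_i} r²` left by the next error, the offset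
  -- `f_i(0)`, the cross terms, the damping `a_i V_i` and the term `Q_i s_i²`; the virtual control
  -- provides `-h_i Θ_i U_i` against them.
  refine ⟨(C₂ + C₃ + C₄ + D.a i * B ^ 2 + D.Q i * (B ^ 2) ^ 2) / D.U i,
    fun t σ χ x η h hb hB hG => ?_⟩
  have hdrift := hC₁ t σ χ x h
  have hg := (hH t σ χ x h).1
  have hy := sub_sq_pos hb
  have hχ0 : 0 < χ i := (abs_nonneg _).trans_lt hb
  have hμ := D.μ_pos h.lt_T
  have hVle := V_le hb
  have hM1 := h.one_le_rpow i
  set s := D.err t σ χ x i with hs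
  set r := s / (χ i ^ 2 - s ^ 2) with hr
  set g := P.h i (trunc x i) with hgdef
  set M := D.μ t ^ D.β i with hM
  have hnext := hC₂ t σ χ x g r h.lt_T hg
  have hoff := hC₃ t r h.lt_T
  have hcross := hC₄ t σ χ x h.nonneg h.lt_T hb hB r hr
  have hχB : χ i ^ 2 ≤ B ^ 2 := pow_le_pow_left₀ hχ0.le hB 2
  have hyB : χ i ^ 2 - s ^ 2 ≤ B ^ 2 := by linarith [sq_nonneg s]
  have hM0 : 0 < M := by linarith
  have hsr : s = (χ i ^ 2 - s ^ 2) * r := by rw [hr]; field_simp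
  have hs2 : s ^ 2 ≤ (B ^ 2) ^ 2 * r ^ 2 := by
    have : s ^ 2 = (χ i ^ 2 - s ^ 2) ^ 2 * r ^ 2 := by rw [← mul_pow, ← hsr]
    rw [this]
    gcongr
  have hVB : D.V t σ χ x i ≤ B ^ 2 * r ^ 2 := by
    have : s ^ 2 / (χ i ^ 2 - s ^ 2) = (χ i ^ 2 - s ^ 2) * r ^ 2 := by rw [hr]; field_simp
    rw [this] at hVle
    have : (χ i ^ 2 - s ^ 2) * r ^ 2 ≤ B ^ 2 * r ^ 2 := by gcongr
    have : 0 ≤ (χ i ^ 2 - s ^ 2) * r ^ 2 := by positivity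
    linarith
  -- Here `κ ≤ β_n` is needed: the term in `Q_n` must not outgrow `μ^{β_n}`.
  have hκ : D.μ t ^ (if i = Fin.last n then D.κ else D.β i) ≤ M := by
    refine D.rpow_le_rpow_μ h.nonneg h.lt_T ?_
    split_ifs with hi
    · rw [hi]; exact D.κ_le
    · exact le_rfl
  have hG0 : 0 ≤ g * D.Θ σ i := le_trans (by positivity) hG
  -- the term driven by the virtual control
  have hvirt : r * (g * D.virt t σ χ x i) =
      -(g * D.Θ σ i * D.K i * ((χ i ^ 2 - s ^ 2) * r ^ 2)) - g * D.Θ σ i * D.U i * (M * r ^ 2) := by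
    have : D.virt t σ χ x i = D.Θ σ i * (-(D.K i * s) - D.U i * (M * r)) := by
      simp only [virt, law, ← hs, ← hM, hr]; ring
    rw [this]
    calc r * (g * (D.Θ σ i * (-(D.K i * s) - D.U i * (M * r))))
        = -(g * D.Θ σ i * D.K i * (s * r)) - g * D.Θ σ i * D.U i * (M * r ^ 2) := by ring
      _ = _ := by
        have : s * r = (χ i ^ 2 - s ^ 2) * r ^ 2 := by
          rw [pow_two r, ← mul_assoc, ← hsr]
        rw [this]
  have hvirt1 : 0 ≤ g * D.Θ σ i * D.K i * ((χ i ^ 2 - s ^ 2) * r ^ 2) := by positivity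
  have hvirt2 : (C₂ + C₃ + C₄ + D.a i * B ^ 2 + D.Q i * (B ^ 2) ^ 2) * (M * r ^ 2) ≤
      g * D.Θ σ i * D.U i * (M * r ^ 2) := by
    rw [div_le_iff₀ hU] at hG
    gcongr
  have hsplit : r * D.errDeriv P t σ χ x i = r * (g * D.virt t σ χ x i)
      + r * (g * (D.next t σ χ x i - D.virt t σ χ x i))
      + r * (D.errDeriv P t σ χ x i - g * D.next t σ χ x i) := by ring
  have hdr : r * (D.errDeriv P t σ χ x i - g * D.next t σ χ x i) ≤
      |r| * |P.f i 0| + |r| * (C₁ * (D.μ t ^ (D.β i / 2) * D.wsum t σ χ x i)) := by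
    rw [← mul_add]
    refine (le_abs_self _).trans ?_
    rw [abs_mul]
    gcongr
  have hQs : D.Q i * D.μ t ^ (if i = Fin.last n then D.κ else D.β i) * s ^ 2 ≤
      D.Q i * (B ^ 2) ^ 2 * (M * r ^ 2) := by
    calc D.Q i * D.μ t ^ (if i = Fin.last n then D.κ else D.β i) * s ^ 2
        ≤ D.Q i * M * ((B ^ 2) ^ 2 * r ^ 2) := by gcongr
      _ = _ := by ring
  have haV : D.a i * M * D.V t σ χ x i ≤ D.a i * B ^ 2 * (M * r ^ 2) := by
    calc D.a i * M * D.V t σ χ x i ≤ D.a i * M * (B ^ 2 * r ^ 2) := by gcongr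
      _ = _ := by ring
  have heta : D.etaRhs t σ χ x η i - D.a i * M * (D.V t σ χ x i - η i) =
      -(D.a i * M * D.V t σ χ x i)
        - D.Q i * D.μ t ^ (if i = Fin.last n then D.κ else D.β i) * s ^ 2
        + ∑ j with j < i, D.c i j * D.μ t ^ D.β j * D.err t σ χ x j ^ 2
        + ∑ j with j.val = i.val + 1, D.c i j * D.err t σ χ x j ^ 2 / M
        + (if i = Fin.last n then D.ζ / M else 0) := by
    simp only [etaRhs, ← hM, ← hs]
    ring
  rw [hsplit, heta, hvirt]
  linarith

end Design

/-! ### Decay of supervised channels -/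

namespace Design

variable {n : ℕ} {D : Design n}

/-- For large `m` the power `m^β` beats `m` because `β > 1`; on the remaining bounded range a large
shift `c` in the denominator does it. With `κ = q/T`, the left side is the logarithmic decay rate of
`(μ + c)^{-q}`. -/
theorem exists_shift_le {α β κ : ℝ} (hα : 0 < α) (hβ : 1 < β) (hκ : 0 ≤ κ) :
    ∃ c, 0 ≤ c ∧ ∀ m, 1 ≤ m → κ * m ^ 2 / (m + c) ≤ α * m ^ β := by
  obtain ⟨M, hM⟩ := (eventually_atTop.1 ((tendsto_rpow_atTop (sub_pos.2 hβ)).eventually_ge_atTop (κ / α)))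
  refine ⟨κ * max M 1 / α, by positivity, fun m hm => ?_⟩
  have hm0 : 0 < m := by linarith
  have hc : 0 ≤ κ * max M 1 / α := by positivity
  rcases le_total M m with h | h
  · have h1 := hM m h
    rw [div_le_iff₀ hα] at h1
    have h2 : m ^ β = m ^ (β - 1) * m := by
      rw [← Real.rpow_add_one hm0.ne']; congr 1; ring
    calc κ * m ^ 2 / (m + κ * max M 1 / α) ≤ κ * m ^ 2 / m := by gcongr; linarith
      _ = κ * m := by field_simp
      _ ≤ m ^ (β - 1) * α * m := by gcongr
      _ = α * m ^ β := by rw [h2]; ring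
  · have h1 : m ≤ m ^ β := by
      conv_lhs => rw [← Real.rpow_one m]
      exact Real.rpow_le_rpow_of_exponent_le hm hβ.le
    rw [div_le_iff₀ (by linarith)]
    have h2 : α * m ≤ α * m ^ β := by gcongr
    have h3 : m ≤ max M 1 := h.trans (le_max_left _ _)
    calc κ * m ^ 2 ≤ κ * (m * max M 1) := by rw [pow_two]; gcongr
      _ = α * m * (κ * max M 1 / α) := by field_simp
      _ ≤ α * m ^ β * (m + κ * max M 1 / α) := by
        refine mul_le_mul h2 (by linarith) hc (by positivity)

/-- Comparison principle: a damped scalar quantity inherits the decay rate of its forcing. -/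
theorem exists_le_rpow_of_deriv_le {α β F q a e : ℝ} (hα : 0 < α) (hβ : 1 < β) (hq : 0 ≤ q)
    (ha : 0 ≤ a) (he : e ≤ D.T) {z z' : ℝ → ℝ} (hz : ContinuousOn z (Ico a e))
    (hd : ∀ t ∈ Ico a e, HasDerivWithinAt z (z' t) (Ici t) t)
    (hle : ∀ t ∈ Ico a e, z' t ≤ -α * D.μ t ^ β * z t + F * D.μ t ^ (β - q)) :
    ∃ C, 0 ≤ C ∧ ∀ t ∈ Ico a e, z t ≤ C * D.μ t ^ (-q) := by
  have hT := D.T_pos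
  obtain ⟨c, hc0, hc⟩ := exists_shift_le (κ := q / D.T) (half_pos hα) hβ (by positivity)
  -- The entries ensure nonnegativity, domination at the initial time, and domination of the
  -- forcing. The factor `(1 + c)^q` comes from `μ + c ≤ (1 + c) μ`, and the final `+ 1` makes the
  -- comparison of slopes strict.
  set C := max 0 (max (z a * (D.μ a + c) ^ q) (2 * F * (1 + c) ^ q / α + 1)) with hC
  have hC0 : 0 ≤ C := le_max_left _ _
  refine ⟨C, hC0, fun t ht => ?_⟩
  have hμ1 : ∀ s ∈ Ico a e, 1 ≤ D.μ s := fun s hs => D.one_le_μ (ha.trans hs.1) (hs.2.trans_le he)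
  have hsub : Icc a t ⊆ Ico a e := fun s hs => ⟨hs.1, hs.2.trans_lt ht.2⟩
  have hφd : ∀ s ∈ Ico a e, HasDerivAt (fun τ => C * (D.μ τ + c) ^ (-q))
      (-(C * (D.μ s + c) ^ (-q) * (q / D.T * D.μ s ^ 2 / (D.μ s + c)))) s := by
    intro s hs
    have h1 := hμ1 s hs
    have hp : 0 < D.μ s + c := by linarith
    have := (((D.hasDerivAt_μ (hs.2.trans_le he)).add_const c).rpow_const (p := -q)
      (Or.inl hp.ne')).const_mul C
    refine this.congr_deriv ?_
    rw [Real.rpow_sub_one hp.ne']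
    field_simp
  have key : z t ≤ C * (D.μ t + c) ^ (-q) := by
    -- Slopes need to be compared only where `z` touches the bound; there half of the damping covers
    -- the decline of the bound and the other half strictly exceeds the forcing.
    refine image_le_of_deriv_right_lt_deriv_boundary' (a := a) (b := t) (hz.mono hsub)
      (fun s hs => hd s (hsub ⟨hs.1, hs.2.le⟩)) ?_
      (fun s hs => (hφd s (hsub hs)).continuousAt.continuousWithinAt)
      (fun s hs => (hφd s (hsub ⟨hs.1, hs.2.le⟩)).hasDerivWithinAt) ?_ ⟨ht.1, le_rfl⟩
    · have h1 := hμ1 a ⟨le_rfl, ht.1.trans_lt ht.2⟩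
      have hp : 0 < (D.μ a + c) ^ q := Real.rpow_pos_of_pos (by linarith) _
      rw [Real.rpow_neg (by linarith), ← div_eq_mul_inv, le_div_iff₀ hp]
      exact (le_max_left _ _).trans (le_max_right _ _)
    · intro s hs heq
      have hs' := hsub ⟨hs.1, hs.2.le⟩
      have h1 := hμ1 s hs'
      have hm0 : 0 < D.μ s := by linarith
      have hp : 0 < D.μ s + c := by linarith
      set φ := C * (D.μ s + c) ^ (-q) with hφ
      have hφ0 : 0 ≤ φ := by positivity
      have h2 := hle s hs'
      have h3 := mul_le_mul_of_nonneg_left (hc _ h1) hφ0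
      rw [heq] at h2
      have h4 : C * (1 + c) ^ (-q) * D.μ s ^ (-q) ≤ φ := by
        rw [mul_assoc, ← Real.mul_rpow (by linarith) hm0.le]
        refine mul_le_mul_of_nonneg_left ?_ hC0
        refine Real.rpow_le_rpow_of_nonpos hp ?_ (by linarith)
        nlinarith
      have h5 : F < C * (1 + c) ^ (-q) * (α / 2) := by
        have hc1 : 0 < (1 + c) ^ q := Real.rpow_pos_of_pos (by linarith) _
        have : 2 * F * (1 + c) ^ q / α < C := lt_of_lt_of_le (lt_add_one _)
          ((le_max_right _ _).trans (le_max_right _ _))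
        rw [div_lt_iff₀ hα] at this
        rw [Real.rpow_neg (by linarith), ← div_eq_mul_inv, div_mul_eq_mul_div, lt_div_iff₀ hc1]
        linarith
      have h6 : D.μ s ^ (β - q) = D.μ s ^ β * D.μ s ^ (-q) := by
        rw [← Real.rpow_add hm0]; rfl
      have hmq : 0 < D.μ s ^ (-q) := Real.rpow_pos_of_pos hm0 _
      have hmb : 0 < D.μ s ^ β := Real.rpow_pos_of_pos hm0 _
      have h7 : F * D.μ s ^ (β - q) < φ * (α / 2 * D.μ s ^ β) := by
        rw [h6]
        calc F * (D.μ s ^ β * D.μ s ^ (-q))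
            < C * (1 + c) ^ (-q) * (α / 2) * (D.μ s ^ β * D.μ s ^ (-q)) := by gcongr
          _ = C * (1 + c) ^ (-q) * D.μ s ^ (-q) * (α / 2 * D.μ s ^ β) := by ring
          _ ≤ _ := by gcongr
      linarith
  refine key.trans (mul_le_mul_of_nonneg_left ?_ hC0)
  exact Real.rpow_le_rpow_of_nonpos (by linarith [hμ1 t ht]) (by linarith) (by linarith)

/-- On `[a, e)` the channels up to `l` move with frozen parameters, inside their barriers and
with nonpositive supervisory functions, and the next channel stays inside its barrier. -/
structure Supervised (D : Design n) (l : Fin (n + 1)) (σ : Fin (n + 1) → ℕ) (χ : Fin (n + 1) → ℝ)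
    (a e : ℝ) (x η : ℝ → Fin (n + 1) → ℝ) : Prop where
  nonneg : 0 ≤ a
  le_T : e ≤ D.T
  barrier : ∀ t ∈ Ico a e, ∀ j : Fin (n + 1), j.val ≤ l.val + 1 → |D.err t σ χ (x t) j| < χ j
  cont : ∀ j ≤ l, ContinuousOn (fun t => η t j) (Ico a e)
  aux : ∀ t ∈ Ico a e, ∀ j ≤ l,
    HasDerivWithinAt (fun τ => η τ j) (D.etaRhs t σ χ (x t) (η t) j) (Ici t) t
  V_le : ∀ t ∈ Ico a e, ∀ j ≤ l, D.V t σ χ (x t) j ≤ η t j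

variable {l : Fin (n + 1)} {σ : Fin (n + 1) → ℕ} {χ : Fin (n + 1) → ℝ} {a e : ℝ}
  {x η : ℝ → Fin (n + 1) → ℝ}

/-- A bootstrap. If all `s_j²` decay at rate `p`, the source terms of `η_j` are `O(μ^{β_j - q})`:
for preceding channels because `β_j ≥ 3 β_k > β_k + 2`, for the next channel because of the division
by `μ^{β_j}`. The comparison principle then gives rate `q` for `η_j`, and `s_j² ≤ 2 χ_j² V_j ≤ 2
χ_j² η_j` returns it to the errors. Each pass gains up to `2`. -/
theorem Supervised.decay_step (h : D.Supervised l σ χ a e x η) {p q A : ℝ} (hA : 0 ≤ A)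
    (hp : ∀ t ∈ Ico a e, ∀ j ≤ l, D.err t σ χ (x t) j ^ 2 ≤ A * D.μ t ^ (-p))
    (hq0 : 0 ≤ q) (hqp : q ≤ p + 2) (hql : q ≤ 2 * D.β l) :
    ∃ C, 0 ≤ C ∧ ∀ t ∈ Ico a e, ∀ j ≤ l, η t j ≤ C * D.μ t ^ (-q) ∧
      D.err t σ χ (x t) j ^ 2 ≤ C * D.μ t ^ (-q) := by
  have hμ1 : ∀ s ∈ Ico a e, 1 ≤ D.μ s := fun s hs =>
    D.one_le_μ (h.nonneg.trans hs.1) (hs.2.trans_le h.le_T)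
  have hpow : ∀ s ∈ Ico a e, ∀ {u v : ℝ}, u ≤ v → D.μ s ^ u ≤ D.μ s ^ v := fun s hs u v huv =>
    Real.rpow_le_rpow_of_exponent_le (hμ1 s hs) huv
  have main : ∀ j, j ≤ l → ∃ C, 0 ≤ C ∧ ∀ t ∈ Ico a e, η t j ≤ C * D.μ t ^ (-q) := by
    intro j hj
    refine exists_le_rpow_of_deriv_le (D.a_pos j) (D.one_lt_β j) hq0 h.nonneg h.le_T (h.cont j hj)
      (fun t ht => h.aux t ht j hj)
      (F := ∑ k with k < j, D.c j k * A
        + ∑ k with k.val = j.val + 1, D.c j k * (A + χ k ^ 2) + D.ζ) fun t ht => ?_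
    have hm := hμ1 t ht
    have hm0 : 0 < D.μ t := by linarith
    have hβj := D.one_lt_β j
    have hX : 0 < D.μ t ^ (D.β j - q) := Real.rpow_pos_of_pos hm0 _
    have t1 : 0 ≤ D.Q j * D.μ t ^ (if j = Fin.last n then D.κ else D.β j)
        * D.err t σ χ (x t) j ^ 2 := by
      have := D.Q_pos j
      positivity
    have t2 : ∑ k with k < j, D.c j k * D.μ t ^ D.β k * D.err t σ χ (x t) k ^ 2 ≤
        (∑ k with k < j, D.c j k * A) * D.μ t ^ (D.β j - q) := by
      rw [Finset.sum_mul]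
      refine Finset.sum_le_sum fun k hk => ?_
      have hkj : k < j := (Finset.mem_filter.1 hk).2
      have hc := D.c_pos j k (Or.inl hkj)
      have h1 := hp t ht k (hkj.le.trans hj)
      have h2 := D.three_mul_β_le hkj
      have h3 := D.one_lt_β k
      calc D.c j k * D.μ t ^ D.β k * D.err t σ χ (x t) k ^ 2
          ≤ D.c j k * D.μ t ^ D.β k * (A * D.μ t ^ (-p)) := by gcongr
        _ = D.c j k * A * D.μ t ^ (D.β k + -p) := by rw [Real.rpow_add hm0]; ring
        _ ≤ _ := mul_le_mul_of_nonneg_left (hpow t ht (by linarith)) (by positivity)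
    have t3 : ∑ k with k.val = j.val + 1, D.c j k * D.err t σ χ (x t) k ^ 2 / D.μ t ^ D.β j ≤
        (∑ k with k.val = j.val + 1, D.c j k * (A + χ k ^ 2)) * D.μ t ^ (D.β j - q) := by
      rw [Finset.sum_mul]
      refine Finset.sum_le_sum fun k hk => ?_
      have hkj : k.val = j.val + 1 := (Finset.mem_filter.1 hk).2
      have hc := D.c_pos j k (Or.inr hkj)
      rw [div_eq_mul_inv, ← Real.rpow_neg hm0.le, mul_assoc, mul_assoc]
      refine mul_le_mul_of_nonneg_left ?_ hc.le
      have hb := h.barrier t ht k (by rw [hkj]; exact Nat.succ_le_succ (Fin.le_def.1 hj))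
      rcases hj.lt_or_eq with hjl | hjl
      · have h1 := hp t ht k (by rw [Fin.le_def, hkj]; exact Fin.lt_def.1 hjl)
        calc D.err t σ χ (x t) k ^ 2 * D.μ t ^ (-D.β j)
            ≤ A * D.μ t ^ (-p) * D.μ t ^ (-D.β j) := by gcongr
          _ = A * D.μ t ^ (-p + -D.β j) := by rw [Real.rpow_add hm0]; ring
          _ ≤ A * D.μ t ^ (D.β j - q) :=
            mul_le_mul_of_nonneg_left (hpow t ht (by linarith)) (by positivity)
          _ ≤ _ := by gcongr; linarith [sq_nonneg (χ k)]
      -- For `j = l` the next error is known only to lie inside its barrier, so its source term is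
      -- merely `O(μ^{-β_l})`. This, like the term with `ζ` in the last channel, caps the rate at `2
      -- β_l`.
      · subst hjl
        have h1 : D.err t σ χ (x t) k ^ 2 ≤ χ k ^ 2 := by linarith [sub_sq_pos hb]
        calc D.err t σ χ (x t) k ^ 2 * D.μ t ^ (-D.β j)
            ≤ χ k ^ 2 * D.μ t ^ (D.β j - q) :=
              mul_le_mul h1 (hpow t ht (by linarith)) (by positivity) (by positivity)
          _ ≤ _ := by gcongr; linarith
    have t4 : (if j = Fin.last n then D.ζ / D.μ t ^ D.β j else 0) ≤ D.ζ * D.μ t ^ (D.β j - q) := by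
      have hζ := D.ζ_pos
      split_ifs with hjn
      · have : j = l := le_antisymm hj (hjn ▸ Fin.le_last l)
        subst this
        rw [div_eq_mul_inv, ← Real.rpow_neg hm0.le]
        exact mul_le_mul_of_nonneg_left (hpow t ht (by linarith)) hζ.le
      · positivity
    unfold etaRhs
    linarith
  have : ∀ j, ∃ C, 0 ≤ C ∧ (j ≤ l → ∀ t ∈ Ico a e, η t j ≤ C * D.μ t ^ (-q)) := fun j => by
    by_cases hj : j ≤ l
    · obtain ⟨C, hC0, hC⟩ := main j hj
      exact ⟨C, hC0, fun _ => hC⟩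
    · exact ⟨0, le_rfl, fun hj' => absurd hj' hj⟩
  choose C hC0 hC using this
  have hS0 : 0 ≤ ∑ j, (1 + 2 * χ j ^ 2) * C j :=
    Finset.sum_nonneg fun j _ => by have := hC0 j; positivity
  have hS : ∀ j, (1 + 2 * χ j ^ 2) * C j ≤ ∑ j, (1 + 2 * χ j ^ 2) * C j := fun j =>
    Finset.single_le_sum (f := fun j => (1 + 2 * χ j ^ 2) * C j)
      (fun j _ => by have := hC0 j; positivity) (Finset.mem_univ j)
  refine ⟨_, hS0, fun t ht j hj => ?_⟩
  have hm := hμ1 t ht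
  have hm0 : 0 < D.μ t ^ (-q) := Real.rpow_pos_of_pos (by linarith) _
  have h1 := hC j hj t ht
  have h2 := sq_err_le_V (h.barrier t ht j ((Fin.le_def.1 hj).trans (Nat.le_succ _)))
  have h3 := h.V_le t ht j hj
  have h4 := mul_le_mul_of_nonneg_right (hS j) hm0.le
  have h5 := mul_nonneg (hC0 j) hm0.le
  have h6 : 0 ≤ 2 * χ j ^ 2 := by positivity
  have h7 := mul_le_mul_of_nonneg_left (h3.trans h1) h6
  have h8 := mul_nonneg h6 h5
  constructor <;> linarith

/-- All errors and auxiliary variables up to channel `l` decay at the rate set by channel `l`. -/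
theorem Supervised.exists_decay (h : D.Supervised l σ χ a e x η) :
    ∃ C, 0 ≤ C ∧ ∀ t ∈ Ico a e, ∀ j ≤ l, η t j ≤ C * D.μ t ^ (-(2 * D.β l)) ∧
      D.err t σ χ (x t) j ^ 2 ≤ C * D.μ t ^ (-(2 * D.β l)) := by
  have hβ := D.β_pos l
  -- The iteration starts at rate `0`, which is the barrier bound.
  have iter : ∀ m : ℕ, ∃ A, 0 ≤ A ∧ ∀ t ∈ Ico a e, ∀ j ≤ l,
      D.err t σ χ (x t) j ^ 2 ≤ A * D.μ t ^ (-(min (2 * (m : ℝ)) (2 * D.β l))) := by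
    intro m
    induction m with
    | zero =>
      refine ⟨∑ j, χ j ^ 2, Finset.sum_nonneg fun j _ => sq_nonneg _, fun t ht j hj => ?_⟩
      have h1 := sub_sq_pos (h.barrier t ht j ((Fin.le_def.1 hj).trans (Nat.le_succ _)))
      have h2 := Finset.single_le_sum (f := fun j => χ j ^ 2) (fun j _ => sq_nonneg _)
        (Finset.mem_univ j)
      have h3 : min (2 * ((0 : ℕ) : ℝ)) (2 * D.β l) = 0 := by
        rw [Nat.cast_zero, mul_zero]; exact min_eq_left (by linarith)
      rw [h3, neg_zero, Real.rpow_zero, mul_one]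
      linarith
    | succ m ih =>
      obtain ⟨A, hA, hp⟩ := ih
      have hstep : min (2 * ((m + 1 : ℕ) : ℝ)) (2 * D.β l) ≤ min (2 * (m : ℝ)) (2 * D.β l) + 2 := by
        push_cast
        rw [← min_add_add_right]
        exact le_min ((min_le_left _ _).trans (by linarith))
          ((min_le_right _ _).trans (by linarith))
      obtain ⟨C, hC0, hC⟩ := h.decay_step hA hp (le_min (by positivity) (by linarith)) hstep
        (min_le_right _ _)
      exact ⟨C, hC0, fun t ht j hj => (hC t ht j hj).2⟩
  obtain ⟨m, hm⟩ := exists_nat_ge (D.β l)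
  obtain ⟨A, hA, hp⟩ := iter m
  rw [min_eq_right (by linarith)] at hp
  exact h.decay_step hA hp (by linarith) (by linarith) le_rfl

/-- Uniform margins of all channels up to `l`. -/
theorem Supervised.exists_margin (h : D.Supervised l σ χ a e x η) :
    ∃ B, 0 ≤ B ∧ ∀ t ∈ Ico a e, ∀ j ≤ l, |D.Θ σ j| ≤ B ∧
      1 ≤ B * (χ j ^ 2 - D.err t σ χ (x t) j ^ 2) ∧ |χ j| ≤ B ∧
      D.μ t ^ D.β l * |D.err t σ χ (x t) j| ≤ B ∧ η t j ≤ B := by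
  obtain ⟨C, hC0, hC⟩ := h.exists_decay
  set G := ∑ j, |D.Θ σ j|
  set X := ∑ j, |χ j|
  set Y := ∑ j, (χ j ^ 2)⁻¹ * Real.exp (2 * C)
  have hG : ∀ j, |D.Θ σ j| ≤ G := fun j =>
    Finset.single_le_sum (f := fun j => |D.Θ σ j|) (fun j _ => abs_nonneg _) (Finset.mem_univ j)
  have hX : ∀ j, |χ j| ≤ X := fun j =>
    Finset.single_le_sum (f := fun j => |χ j|) (fun j _ => abs_nonneg _) (Finset.mem_univ j)
  have hY : ∀ j, (χ j ^ 2)⁻¹ * Real.exp (2 * C) ≤ Y := fun j =>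
    Finset.single_le_sum (f := fun j => (χ j ^ 2)⁻¹ * Real.exp (2 * C)) (fun j _ => by positivity)
      (Finset.mem_univ j)
  have hG0 : 0 ≤ G := (abs_nonneg _).trans (hG l)
  have hX0 : 0 ≤ X := (abs_nonneg _).trans (hX l)
  have hY0 : 0 ≤ Y := le_trans (by positivity) (hY l)
  -- `Y` gives the margin: `V_j ≤ η_j ≤ C` means `χ_j² - s_j² ≥ χ_j² exp(-2C)`. The term `√C` bounds
  -- `μ^{β_l} |s_j|`.
  refine ⟨G + X + Y + √C + C, by positivity, fun t ht j hj => ?_⟩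
  obtain ⟨h1, h2⟩ := hC t ht j hj
  have hb := h.barrier t ht j ((Fin.le_def.1 hj).trans (Nat.le_succ _))
  have hχ0 : 0 < χ j := (abs_nonneg _).trans_lt hb
  have hm1 := D.one_le_μ (h.nonneg.trans ht.1) (ht.2.trans_le h.le_T)
  have hm0 : 0 < D.μ t := by linarith
  have hβ := D.β_pos l
  have hC' : 0 ≤ √C := Real.sqrt_nonneg _
  have hpow : D.μ t ^ (-(2 * D.β l)) ≤ 1 := Real.rpow_le_one_of_one_le_of_nonpos hm1 (by linarith)
  have hηC : η t j ≤ C := h1.trans (mul_le_of_le_one_right hC0 hpow)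
  refine ⟨by linarith [hG j], ?_, by linarith [hX j], ?_, by linarith⟩
  · have hVC := (h.V_le t ht j hj).trans hηC
    have h3 := margin_of_V hb
    have h4 : Real.exp (-(2 * C)) ≤ Real.exp (-(2 * D.V t σ χ (x t) j)) :=
      Real.exp_le_exp.2 (by linarith)
    have h5 : χ j ^ 2 * Real.exp (-(2 * C)) ≤ χ j ^ 2 - D.err t σ χ (x t) j ^ 2 := by
      rw [← h3]; gcongr
    have h6 : 1 = (χ j ^ 2)⁻¹ * Real.exp (2 * C) * (χ j ^ 2 * Real.exp (-(2 * C))) := by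
      rw [Real.exp_neg]; field_simp
    rw [h6]
    refine mul_le_mul ?_ h5 (by positivity) (by positivity)
    linarith [hY j]
  · have h3 : (D.μ t ^ D.β l * |D.err t σ χ (x t) j|) ^ 2 ≤ C := by
      rw [mul_pow, sq_abs, ← Real.rpow_natCast, ← Real.rpow_mul hm0.le]
      have h4 : 0 < D.μ t ^ (D.β l * ((2 : ℕ) : ℝ)) := Real.rpow_pos_of_pos hm0 _
      have h5 := mul_le_mul_of_nonneg_left h2 h4.le
      have h6 : D.μ t ^ (D.β l * ((2 : ℕ) : ℝ)) * (C * D.μ t ^ (-(2 * D.β l))) = C := by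
        rw [mul_left_comm, ← Real.rpow_add hm0]
        have : D.β l * ((2 : ℕ) : ℝ) + -(2 * D.β l) = 0 := by push_cast; ring
        rw [this, Real.rpow_zero, mul_one]
      rwa [h6] at h5
    have := Real.le_sqrt_of_sq_le h3
    linarith

end Design

/-! ### Flows with frozen parameters and the update at a switching -/

namespace Design

variable {n : ℕ} {D : Design n} {P : Plant n}

section flow

variable {σ : Fin (n + 1) → ℕ} {χ : Fin (n + 1) → ℝ} {a b e t : ℝ}
  {y w : ℝ → Fin (n + 1) → ℝ}

theorem IsFlow.hasDerivWithinAt_supervisor (h : D.IsFlow P σ χ a e y w) (he : e ≤ D.T)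
    (ht : t ∈ Ico a e) (i : Fin (n + 1)) :
    HasDerivWithinAt (fun τ => D.supervisor τ σ χ (y τ) (w τ) i)
      (D.err t σ χ (y t) i / (χ i ^ 2 - D.err t σ χ (y t) i ^ 2) * D.errDeriv P t σ χ (y t) i
        - D.etaRhs t σ χ (y t) (w t) i) (Ico a e) t :=
  (hasDerivWithinAt_V (ht.2.trans_le he) (h.plant t ht) fun j _ => h.barrier t ht j).sub
    (h.aux t ht i)

theorem IsFlow.continuousOn_supervisor (h : D.IsFlow P σ χ a e y w) (he : e ≤ D.T)
    (i : Fin (n + 1)) : ContinuousOn (fun τ => D.supervisor τ σ χ (y τ) (w τ) i) (Ico a e) :=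
  fun _ ht => (h.hasDerivWithinAt_supervisor he ht i).continuousWithinAt

theorem IsFlow.continuousOn_state (h : D.IsFlow P σ χ a e y w) : ContinuousOn y (Ico a e) :=
  fun t ht => continuousWithinAt_pi.2 fun i => (h.plant t ht i).continuousWithinAt

theorem IsFlow.continuousOn_aux (h : D.IsFlow P σ χ a e y w) : ContinuousOn w (Ico a e) :=
  fun t ht => continuousWithinAt_pi.2 fun i => (h.aux t ht i).continuousWithinAt

/-- Under the dissipation inequality a negative supervisory function stays negative. -/
theorem IsFlow.supervisor_neg (h : D.IsFlow P σ χ a e y w) (he : e ≤ D.T) (hb : b < e)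
    {i : Fin (n + 1)} (h0 : D.supervisor a σ χ (y a) (w a) i < 0)
    (hd : ∀ t ∈ Icc a b,
      D.err t σ χ (y t) i / (χ i ^ 2 - D.err t σ χ (y t) i ^ 2) * D.errDeriv P t σ χ (y t) i ≤
        D.etaRhs t σ χ (y t) (w t) i - D.a i * D.μ t ^ D.β i * (D.V t σ χ (y t) i - w t i)) :
    ∀ t ∈ Icc a b, D.supervisor t σ χ (y t) (w t) i < 0 := by
  have hT := D.T_pos
  have hβ := D.one_lt_β i
  have hsub : Icc a b ⊆ Ico a e := fun t ht => ⟨ht.1, ht.2.trans_lt hb⟩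
  -- With this constant `exp(κ μ^{β-1})` is an integrating factor for the damping `a μ^β`, since
  -- `(μ^{β-1})' = (β - 1)/T · μ^β`.
  set κ := D.a i * D.T / (D.β i - 1) with hκ
  have hA : ∀ t ∈ Ico a e, HasDerivAt (fun τ => Real.exp (κ * D.μ τ ^ (D.β i - 1)))
      (Real.exp (κ * D.μ t ^ (D.β i - 1)) * (D.a i * D.μ t ^ D.β i)) t := by
    intro t ht
    refine (((D.hasDerivAt_μ_rpow (ht.2.trans_le he) (D.β i - 1)).const_mul κ).exp).congr_deriv ?_
    have : D.β i - 1 ≠ 0 := by linarith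
    rw [sub_add_cancel, hκ]
    field_simp
  have hanti : AntitoneOn (fun t => D.supervisor t σ χ (y t) (w t) i
      * Real.exp (κ * D.μ t ^ (D.β i - 1))) (Icc a b) := by
    have hder : ∀ t ∈ Ico a e, HasDerivWithinAt (fun t => D.supervisor t σ χ (y t) (w t) i
      * Real.exp (κ * D.μ t ^ (D.β i - 1))) _ (Ico a e) t := fun t ht =>
        (h.hasDerivWithinAt_supervisor he ht i).fun_mul (hA t ht).hasDerivWithinAt
    refine antitoneOn_of_hasDerivWithinAt_nonpos (convex_Icc a b)
      (fun t ht => ((hder t (hsub ht)).continuousWithinAt).mono hsub)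
      (fun t ht => (hder t (hsub (interior_subset ht))).mono (interior_subset.trans hsub)) ?_
    intro t ht
    have h1 := hd t (interior_subset ht)
    have h2 := Real.exp_pos (κ * D.μ t ^ (D.β i - 1))
    have h3 : ∀ r E p q S : ℝ, (r - p) * E + S * (E * q) = (r - p + q * S) * E := by intros; ring
    rw [h3]
    refine mul_nonpos_of_nonpos_of_nonneg ?_ h2.le
    unfold supervisor
    linarith
  intro t ht
  have h1 := hanti ⟨le_rfl, ht.1.trans ht.2⟩ ht ht.1
  have h2 : D.supervisor a σ χ (y a) (w a) i * Real.exp (κ * D.μ a ^ (D.β i - 1)) < 0 :=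
    mul_neg_of_neg_of_pos h0 (Real.exp_pos _)
  exact neg_of_mul_neg_left (h1.trans_lt h2) (Real.exp_pos _).le

/-- Facts about the infimum of the times at which a supervisory function is positive. -/
theorem IsFlow.first_positive (h : D.IsFlow P σ χ a e y w) (he : e ≤ D.T) (hb : b < e)
    (h0 : ∀ i, D.supervisor a σ χ (y a) (w a) i < 0)
    (hglb : IsGLB {t | t ∈ Ico a e ∧ ∃ i, 0 < D.supervisor t σ χ (y t) (w t) i} b) :
    a < b ∧ (∀ t ∈ Icc a b, ∀ i, D.supervisor t σ χ (y t) (w t) i ≤ 0) ∧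
      ∃ i, 0 ≤ D.supervisor b σ χ (y b) (w b) i := by
  have hab : a ≤ b := hglb.2 fun t ht => ht.1.1
  have hmem : b ∈ Ico a e := ⟨hab, hb⟩
  have hcont := h.continuousOn_supervisor he
  -- Otherwise all supervisory functions stay negative slightly beyond `b`, and `b` is not the
  -- greatest lower bound.
  have hex : ∃ i, 0 ≤ D.supervisor b σ χ (y b) (w b) i := by
    by_contra! hneg
    have hev : ∀ᶠ t in 𝓝[Ico a e] b, ∀ i, D.supervisor t σ χ (y t) (w t) i < 0 :=
      eventually_all.2 fun i => (hcont i b hmem).eventually_lt_const (hneg i)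
    have hge : 𝓝[Ico b e] b = 𝓝[≥] b := nhdsWithin_Ico_eq_nhdsGE hb
    have hev' := hge ▸ nhdsWithin_mono b (Ico_subset_Ico_left hab) hev
    obtain ⟨u, hu, hsub⟩ := mem_nhdsGE_iff_exists_Ico_subset.1 hev'
    have hlow : u ∈ lowerBounds {t | t ∈ Ico a e ∧ ∃ i, 0 < D.supervisor t σ χ (y t) (w t) i} := by
      intro t ht
      by_contra! htu
      obtain ⟨i, hi⟩ := ht.2
      exact lt_asymm hi (hsub ⟨hglb.1 ht, htu⟩ i)
    exact absurd (hglb.2 hlow) (not_le.2 hu)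
  have hlt : a < b := by
    refine hab.lt_of_ne fun hab' => ?_
    obtain ⟨i, hi⟩ := hex
    rw [← hab'] at hi
    exact absurd (h0 i) (not_lt.2 hi)
  refine ⟨hlt, fun t ht i => ?_, hex⟩
  have hico : ∀ s ∈ Ico a b, D.supervisor s σ χ (y s) (w s) i ≤ 0 := fun s hs => by
    by_contra! hpos
    exact absurd (hglb.1 ⟨⟨hs.1, hs.2.trans hb⟩, i, hpos⟩) (not_le.2 hs.2)
  rcases ht.2.lt_or_eq with htb | rfl
  · exact hico t ⟨ht.1, htb⟩
  · refine ContinuousWithinAt.closure_le (s := Ico a t) (x := t)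
      (f := fun τ => D.supervisor τ σ χ (y τ) (w τ) i) (g := fun _ => 0) ?_
      ((hcont i t hmem).mono (Ico_subset_Ico_right hb.le)) continuousWithinAt_const hico
    rw [closure_Ico hlt.ne]
    exact ⟨ht.1, le_rfl⟩

end flow

section update

variable {b : ℝ} {σ σ' : Fin (n + 1) → ℕ} {χ x η χ' x' η' : Fin (n + 1) → ℝ} {i : Fin (n + 1)}

/-- By induction on the channel: with unchanged gains and barriers below `j`, the recomputed `s_j`
is the old one and still lies inside its barrier. Only gains strictly below `i` must stay fixed, so
`χ_i` survives a change of `σ_i`. -/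
theorem IsUpdate.barrier_eq (h : D.IsUpdate b σ χ x η σ' χ' x' η')
    (hb : ∀ j, |D.err b σ χ x j| < χ j) (hσ : ∀ j < i, σ' j = σ j) : ∀ j ≤ i, χ' j = χ j := by
  intro j
  induction j using WellFoundedLT.induction with
  | ind j ih =>
    intro hj
    refine (h.barrier j).2 ?_
    rw [D.err_congr (fun l hl => hσ l (hl.trans_le hj)) (fun l hl => ih l hl (hl.le.trans hj))]
    exact hb j

theorem V_congr {t : ℝ} (hσ : ∀ j < i, σ j = σ' j) (hχ : ∀ j ≤ i, χ j = χ' j) :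
    D.V t σ χ x i = D.V t σ' χ' x i := by
  rw [V, V, D.err_congr hσ fun j hj => hχ j hj.le, hχ i le_rfl]

/-- The equation of channel `i` reaches up to `s_{i+1}`, which is determined by the parameters of
the channels up to `i`. -/
theorem etaRhs_congr {t : ℝ} (hσ : ∀ j ≤ i, σ j = σ' j) (hχ : ∀ j ≤ i, χ j = χ' j)
    (hη : η i = η' i) :
    D.etaRhs t σ χ x η i = D.etaRhs t σ' χ' x η' i := by
  have he : ∀ j : Fin (n + 1), j.val ≤ i.val + 1 → D.err t σ χ x j = D.err t σ' χ' x j := by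
    intro j hj
    refine D.err_congr (fun l hl => hσ l ?_) (fun l hl => hχ l ?_) <;>
    · rw [Fin.lt_def] at hl
      rw [Fin.le_def]
      omega
  unfold etaRhs
  rw [he i (Nat.le_succ _), hη]
  congr 2
  · congr 1
    refine Finset.sum_congr rfl fun j hj => ?_
    rw [he j ((Fin.lt_def.1 (Finset.mem_filter.1 hj).2).le.trans (Nat.le_succ _))]
  · refine Finset.sum_congr rfl fun j hj => ?_
    rw [he j (Finset.mem_filter.1 hj).2.le]

/-- With unchanged errors a reset would require `V_i ≥ η_i` already before the switching, and then
`σ_i` would have increased. -/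
theorem IsUpdate.reset_eq (h : D.IsUpdate b σ χ x η σ' χ' x' η')
    (hb : ∀ j, |D.err b σ χ x j| < χ j) (hσ : ∀ j ≤ i, σ' j = σ j) : η' i = η i := by
  refine (h.reset i).2 ?_
  rw [V_congr (fun j hj => hσ j hj.le) (h.barrier_eq hb fun j hj => hσ j hj.le)]
  by_contra! hle
  have h1 := (h.gain i).1 (sub_nonneg.2 hle)
  rw [hσ i le_rfl] at h1
  omega

/-- The reset margin `ε` makes every supervisory function strictly negative at the beginning of the
next phase; phases therefore have positive length, and `IsFlow.supervisor_neg` can be applied from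
their start. -/
theorem IsUpdate.V_lt (h : D.IsUpdate b σ χ x η σ' χ' x' η') (i : Fin (n + 1)) :
    D.V b σ' χ' x' i < η' i := by
  rw [h.state]
  rcases le_or_gt (η i) (D.V b σ' χ' x i) with hle | hlt
  · rw [(h.reset i).1 hle]; linarith [D.ε_pos]
  · rw [(h.reset i).2 hlt]; exact hlt

theorem IsUpdate.gain_cases (h : D.IsUpdate b σ χ x η σ' χ' x' η') (i : Fin (n + 1)) :
    σ' i = σ i ∨ σ' i = σ i + 1 := by
  rcases le_or_gt 0 (D.supervisor b σ χ x η i) with hle | hlt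
  · exact Or.inr ((h.gain i).1 hle)
  · exact Or.inl ((h.gain i).2 hlt)

theorem Confined.congr {B t : ℝ} (h : D.Confined B i t σ χ x) (hσ : ∀ j < i, σ j = σ' j)
    (hχ : ∀ j < i, χ j = χ' j) : D.Confined B i t σ' χ' x := by
  have he : ∀ j ≤ i, D.err t σ χ x j = D.err t σ' χ' x j := fun j hj =>
    D.err_congr (fun l hl => hσ l (hl.trans_le hj)) (fun l hl => hχ l (hl.trans_le hj))
  refine ⟨h.nonneg, h.lt_T, fun j hj => ?_, fun j hj => ?_, fun j hj => ?_, fun j hj => ?_, ?_⟩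
  · have := h.gain j hj
    simpa only [Θ, hσ j hj] using this
  · rw [← he j hj.le, ← hχ j hj]; exact h.margin j hj
  · rw [← hχ j hj]; exact h.radius j hj
  · rw [← he j hj.le]; exact h.scaled j hj
  · rw [← he i le_rfl]; exact h.err_le

end update

/-! ### Runs and phases ending with a switching -/

/-- A sequence of phases, possibly accumulating before the prescribed time. -/
structure IsRun (D : Design n) (P : Plant n) (ts : ℕ → ℝ) (σ : ℝ → Fin (n + 1) → ℕ)
    (χ x η : ℝ → Fin (n + 1) → ℝ) : Prop where
  start : ts 0 = 0
  V_init : ∀ i, D.V 0 (σ 0) (χ 0) (x 0) i < η 0 i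
  phase : ∀ m, ts m < D.T → D.IsPhase P σ χ x η (ts m) (ts (m + 1))

/-- A phase that ends with a switching. -/
structure IsSwitch (D : Design n) (P : Plant n) (σ : ℝ → Fin (n + 1) → ℕ)
    (χ x η : ℝ → Fin (n + 1) → ℝ) (a b e : ℝ) (y w : ℝ → Fin (n + 1) → ℝ) : Prop where
  lt : a < b
  lt_end : b < e
  end_le : e ≤ D.T
  flow : D.IsFlow P (σ a) (χ a) a e y w
  state_start : y a = x a
  aux_start : w a = η a
  signals : ∀ t ∈ Ico a b, σ t = σ a ∧ χ t = χ a ∧ x t = y t ∧ η t = w t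
  supervisor_start : ∀ i, D.supervisor a (σ a) (χ a) (y a) (w a) i < 0
  supervisor_le : ∀ t ∈ Icc a b, ∀ i, D.supervisor t (σ a) (χ a) (y t) (w t) i ≤ 0
  trigger : ∃ i, 0 ≤ D.supervisor b (σ a) (χ a) (y b) (w b) i
  update : D.IsUpdate b (σ a) (χ a) (y b) (w b) (σ b) (χ b) (x b) (η b)

theorem IsPhase.exists_switch {σ : ℝ → Fin (n + 1) → ℕ} {χ x η : ℝ → Fin (n + 1) → ℝ} {a b : ℝ}
    (h : D.IsPhase P σ χ x η a b) (hb : b < D.T) (hV : ∀ i, D.V a (σ a) (χ a) (x a) i < η a i) :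
    ∃ e y w, D.IsSwitch P σ χ x η a b e y w := by
  obtain ⟨e, -, heT, y, w, hflow, hy, hw, hsig, hend⟩ := h
  rcases hend with ⟨hbT, -⟩ | ⟨hbe, hglb, hup⟩
  · exact absurd hbT hb.ne
  · have h0 : ∀ i, D.supervisor a (σ a) (χ a) (y a) (w a) i < 0 := fun i => by
      rw [hy, hw]; exact sub_neg.2 (hV i)
    obtain ⟨h1, h2, h3⟩ := hflow.first_positive heT hbe h0 hglb
    exact ⟨e, y, w, h1, hbe, heT, hflow, hy, hw, hsig, h0, h2, h3, hup⟩

section run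

variable {ts : ℕ → ℝ} {σ : ℝ → Fin (n + 1) → ℕ} {χ x η : ℝ → Fin (n + 1) → ℝ}

theorem IsRun.V_lt (h : D.IsRun P ts σ χ x η) {m : ℕ} (hm : ∀ k ≤ m, ts k < D.T)
    (i : Fin (n + 1)) :
    D.V (ts m) (σ (ts m)) (χ (ts m)) (x (ts m)) i < η (ts m) i := by
  induction m generalizing i with
  | zero => rw [h.start]; exact h.V_init i
  | succ m ih =>
    obtain ⟨e, y, w, hs⟩ := (h.phase m (hm m (Nat.le_succ m))).exists_switch (hm _ le_rfl)
      fun i => ih (fun k hk => hm k (hk.trans (Nat.le_succ m))) i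
    exact hs.update.V_lt i

theorem IsRun.exists_switch (h : D.IsRun P ts σ χ x η) {m : ℕ} (hm : ∀ k ≤ m + 1, ts k < D.T) :
    ∃ e y w, D.IsSwitch P σ χ x η (ts m) (ts (m + 1)) e y w :=
  (h.phase m (hm m (Nat.le_succ m))).exists_switch (hm _ le_rfl)
    fun i => h.V_lt (fun k hk => hm k (hk.trans (Nat.le_succ m))) i

end run

end Design

/-! ### Finiteness of the number of switchings -/

namespace Design

variable {n : ℕ} {D : Design n} {P : Plant n}

/-- A sequence of natural numbers with increments at most one that stops whenever it reaches
suitable values, which exist arbitrarily far, is eventually constant. -/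
theorem eventually_const_of_stops {g : ℕ → ℕ} (hg : ∀ m, g (m + 1) = g m ∨ g (m + 1) = g m + 1)
    {v M : ℕ} (hv : g M ≤ v) (hfix : ∀ m ≥ M, g m = v → g (m + 1) = v) :
    ∃ N, ∀ m ≥ N, g m = g N := by
  have hmono : Monotone g := monotone_nat_of_le_succ fun m => by rcases hg m with h | h <;> omega
  -- With increments at most one the sequence cannot jump over `v`, and it cannot leave `v`.
  have hle : ∀ m, M ≤ m → g m ≤ v := by
    intro m hm
    induction m, hm using Nat.le_induction with
    | base => exact hv
    | succ m hm ih =>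
      rcases ih.lt_or_eq with h | h
      · rcases hg m with h' | h' <;> omega
      · exact (hfix m hm h).le
  have hbdd : ∃ N, ∀ m, g m ≤ g N := by
    have hfin : (range g).Finite := (finite_Iic v).subset (by
      rintro _ ⟨m, rfl⟩
      exact (hmono (le_max_left m M)).trans (hle _ (le_max_right m M)))
    obtain ⟨_, ⟨N, rfl⟩, hN⟩ := hfin.exists_maximal (range_nonempty g)
    refine ⟨N, fun m => ?_⟩
    by_contra! hlt
    exact absurd (hN ⟨m, rfl⟩ hlt.le) (not_le.2 hlt)
  obtain ⟨N, hN⟩ := hbdd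
  exact ⟨N, fun m hm => le_antisymm (hN m) (hmono hm)⟩

section infinite

variable {ts : ℕ → ℝ} {σ : ℝ → Fin (n + 1) → ℕ} {χ x η : ℝ → Fin (n + 1) → ℝ}
  {e : ℕ → ℝ} {y w : ℕ → ℝ → Fin (n + 1) → ℝ} {M : ℕ} {i l : Fin (n + 1)} {t : ℝ}

theorem strictMono_of_switch
    (hs : ∀ m, D.IsSwitch P σ χ x η (ts m) (ts (m + 1)) (e m) (y m) (w m)) : StrictMono ts :=
  strictMono_nat_of_lt_succ fun m => (hs m).lt

theorem bddAbove_of_switch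
    (hs : ∀ m, D.IsSwitch P σ χ x η (ts m) (ts (m + 1)) (e m) (y m) (w m)) :
    BddAbove (range ts) := by
  refine ⟨D.T, ?_⟩
  rintro _ ⟨m, rfl⟩
  exact ((hs m).lt.trans (hs m).lt_end).le.trans (hs m).end_le

theorem lt_iSup_of_switch
    (hs : ∀ m, D.IsSwitch P σ χ x η (ts m) (ts (m + 1)) (e m) (y m) (w m)) (m : ℕ) :
    ts m < ⨆ m, ts m :=
  (hs m).lt.trans_le (le_ciSup (bddAbove_of_switch hs) (m + 1))

theorem exists_mem_phase
    (hs : ∀ m, D.IsSwitch P σ χ x η (ts m) (ts (m + 1)) (e m) (y m) (w m))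
    (ht : t ∈ Ico (ts M) (⨆ m, ts m)) : ∃ m ≥ M, t ∈ Ico (ts m) (ts (m + 1)) := by
  have hex : ∃ k, t < ts k := exists_lt_of_lt_ciSup ht.2
  classical
  have h1 := Nat.find_spec hex
  have hpos : M < Nat.find hex := by
    by_contra! hle
    exact absurd (ht.1.trans_lt h1) (not_lt.2 ((strictMono_of_switch hs).monotone hle))
  obtain ⟨k, hk⟩ := Nat.exists_eq_succ_of_ne_zero (Nat.ne_zero_of_lt hpos)
  refine ⟨k, by omega, ?_, ?_⟩
  · exact not_lt.1 (Nat.find_min hex (by omega))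
  · rw [hk] at h1; exact h1

/-- The barrier of channel `i` itself settles together with the gains of the channels before it,
although `σ_i` may still change. This is what makes the bounds for channel `i` available before its
gain has settled. -/
theorem χ_eq_of_switch
    (hs : ∀ m, D.IsSwitch P σ χ x η (ts m) (ts (m + 1)) (e m) (y m) (w m))
    (hσ : ∀ m ≥ M, ∀ j < i, σ (ts m) j = σ (ts M) j) :
    ∀ m ≥ M, ∀ j ≤ i, χ (ts m) j = χ (ts M) j := by
  intro m hm
  induction m, hm using Nat.le_induction with
  | base => exact fun _ _ => rfl
  | succ m hm ih =>
    intro j hj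
    rw [← ih j hj]
    refine (hs m).update.barrier_eq (i := i)
      ((hs m).flow.barrier _ ⟨(hs m).lt.le, (hs m).lt_end⟩) (fun k hk => ?_) j hj
    rw [hσ m hm k hk, hσ (m + 1) (Nat.le_succ_of_le hm) k hk]

variable {a b e₀ : ℝ} {y₀ w₀ : ℝ → Fin (n + 1) → ℝ}

theorem IsSwitch.state_eq (h : D.IsSwitch P σ χ x η a b e₀ y₀ w₀) (ht : t ∈ Icc a b) :
    x t = y₀ t := by
  rcases ht.2.lt_or_eq with htb | rfl
  · exact (h.signals t ⟨ht.1, htb⟩).2.2.1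
  · exact h.update.state

/-- At the right end point `η` carries the value after the update; the absence of a reset makes it
continuous across the switching. -/
theorem IsSwitch.aux_eq (h : D.IsSwitch P σ χ x η a b e₀ y₀ w₀) (hσ : ∀ j ≤ i, σ b j = σ a j)
    (ht : t ∈ Icc a b) : η t i = w₀ t i := by
  rcases ht.2.lt_or_eq with htb | rfl
  · rw [(h.signals t ⟨ht.1, htb⟩).2.2.2]
  · exact h.update.reset_eq (h.flow.barrier _ ⟨h.lt.le, h.lt_end⟩) hσ

/-- If a function is continuous on all phases, it is continuous up to the accumulation point. -/
theorem continuousOn_of_phases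
    (hs : ∀ m, D.IsSwitch P σ χ x η (ts m) (ts (m + 1)) (e m) (y m) (w m)) {g : ℝ → ℝ}
    (hg : ∀ m ≥ M, ContinuousOn g (Icc (ts m) (ts (m + 1)))) :
    ContinuousOn g (Ico (ts M) (⨆ m, ts m)) := by
  have hmono := (strictMono_of_switch hs).monotone
  have hIcc : ∀ m ≥ M, ContinuousOn g (Icc (ts M) (ts m)) := by
    intro m hm
    induction m, hm using Nat.le_induction with
    | base => rw [Icc_self]; exact continuousOn_singleton g _
    | succ m hm ih =>
      rw [← Icc_union_Icc_eq_Icc (hmono hm) (hmono (Nat.le_succ m))]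
      exact ih.union_of_isClosed (hg m hm) isClosed_Icc isClosed_Icc
  intro t ht
  obtain ⟨m, hm, htm⟩ := exists_mem_phase hs ht
  have h1 := hIcc (m + 1) (Nat.le_succ_of_le hm) t ⟨ht.1, htm.2.le⟩
  refine h1.mono_of_mem_nhdsWithin ?_
  refine mem_of_superset (inter_mem self_mem_nhdsWithin
    (mem_nhdsWithin_of_mem_nhds (Iio_mem_nhds htm.2))) fun s hs => ⟨hs.1.1, ?_⟩
  exact (mem_Iio.1 hs.2).le

/-- Channels with settled gains do not notice the switchings of later channels: their parameters are
constant and `x`, `η_j` have no jumps, so the phases join into one motion up to the accumulation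
point. At switching times only right derivatives are available, which suffices for the comparison
principle. -/
theorem supervised_of_switch (h0 : ts 0 = 0)
    (hs : ∀ m, D.IsSwitch P σ χ x η (ts m) (ts (m + 1)) (e m) (y m) (w m))
    (hσ : ∀ m ≥ M, ∀ j ≤ l, σ (ts m) j = σ (ts M) j) :
    D.Supervised l (σ (ts M)) (χ (ts M)) (ts M) (⨆ m, ts m) x η := by
  have hmono := (strictMono_of_switch hs).monotone
  have hlow : ∀ {j k : Fin (n + 1)}, j.val ≤ l.val + 1 → k < j → k ≤ l := fun hj hk => by
    rw [Fin.lt_def] at hk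
    rw [Fin.le_def]
    omega
  have hχ : ∀ m ≥ M, ∀ j : Fin (n + 1), j.val ≤ l.val + 1 → χ (ts m) j = χ (ts M) j :=
    fun m hm j hj => χ_eq_of_switch hs (i := j)
      (fun m hm k hk => hσ m hm k (hlow hj hk)) m hm j le_rfl
  have hχl : ∀ m ≥ M, ∀ j ≤ l, χ (ts m) j = χ (ts M) j := fun m hm j hj =>
    hχ m hm j ((Fin.le_def.1 hj).trans (Nat.le_succ _))
  have hstay : ∀ m ≥ M, ∀ j ≤ l, σ (ts (m + 1)) j = σ (ts m) j := fun m hm j hj => by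
    rw [hσ m hm j hj, hσ (m + 1) (Nat.le_succ_of_le hm) j hj]
  refine ⟨h0 ▸ hmono (Nat.zero_le M), ciSup_le fun m => ?_, ?_, ?_, ?_, ?_⟩
  · exact ((hs m).lt.trans (hs m).lt_end).le.trans (hs m).end_le
  · intro t ht j hj
    obtain ⟨m, hm, htm⟩ := exists_mem_phase hs ht
    have hk : ∀ k < j, k ≤ l := fun k hk => hlow hj hk
    rw [← hχ m hm j hj, D.err_congr (σ' := σ (ts m)) (χ' := χ (ts m))
      (fun k hk' => (hσ m hm k (hk k hk')).symm) (fun k hk' => (hχl m hm k (hk k hk')).symm),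
      (hs m).state_eq ⟨htm.1, htm.2.le⟩]
    exact (hs m).flow.barrier t ⟨htm.1, htm.2.trans (hs m).lt_end⟩ j
  · intro j hj
    refine continuousOn_of_phases hs fun m hm => ?_
    refine ((continuousOn_pi.1 (hs m).flow.continuousOn_aux j).mono
      (fun t ht => ⟨ht.1, ht.2.trans_lt (hs m).lt_end⟩)).congr fun t ht => ?_
    exact (hs m).aux_eq (fun k hk => hstay m hm k (hk.trans hj)) ht
  · intro t ht j hj
    obtain ⟨m, hm, htm⟩ := exists_mem_phase hs ht
    have hte : t ∈ Ico (ts m) (e m) := ⟨htm.1, htm.2.trans (hs m).lt_end⟩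
    have h1 := ((hs m).flow.aux t hte j).mono_of_mem_nhdsWithin (s := Ici t)
      (mem_of_superset (Ico_mem_nhdsGE hte.2) (Ico_subset_Ico_left hte.1))
    rw [etaRhs_congr (σ' := σ (ts m)) (χ' := χ (ts m)) (η' := w m t)
      (fun k hk => (hσ m hm k (hk.trans hj)).symm) (fun k hk => (hχl m hm k (hk.trans hj)).symm)
      ((hs m).aux_eq (fun k hk => hstay m hm k (hk.trans hj)) ⟨htm.1, htm.2.le⟩),
      (hs m).state_eq ⟨htm.1, htm.2.le⟩]
    refine h1.congr_of_eventuallyEq ?_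
      ((hs m).aux_eq (fun k hk => hstay m hm k (hk.trans hj)) ⟨htm.1, htm.2.le⟩)
    filter_upwards [Ico_mem_nhdsGE htm.2] with s hs'
    exact (hs m).aux_eq (fun k hk => hstay m hm k (hk.trans hj)) ⟨htm.1.trans hs'.1, hs'.2.le⟩
  · intro t ht j hj
    obtain ⟨m, hm, htm⟩ := exists_mem_phase hs ht
    rw [V_congr (σ' := σ (ts m)) (χ' := χ (ts m))
      (fun k hk => (hσ m hm k (hk.le.trans hj)).symm)
      (fun k hk => (hχl m hm k (hk.trans hj)).symm), (hs m).state_eq ⟨htm.1, htm.2.le⟩,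
      (hs m).aux_eq (fun k hk => hstay m hm k (hk.trans hj)) ⟨htm.1, htm.2.le⟩]
    exact sub_nonpos.1 ((hs m).supervisor_le t ⟨htm.1, htm.2.le⟩ j)

/-- The decay estimate for the channels up to `i - 1` supplies all margins; for channel `i` itself
only the fixed barrier is used. For the first channel nothing precedes, and its barrier is the
bound. -/
theorem exists_confined_of_switch (h0 : ts 0 = 0)
    (hs : ∀ m, D.IsSwitch P σ χ x η (ts m) (ts (m + 1)) (e m) (y m) (w m))
    (hσ : ∀ m ≥ M, ∀ j < i, σ (ts m) j = σ (ts M) j) :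
    ∃ B, χ (ts M) i ≤ B ∧ ∀ t ∈ Ico (ts M) (⨆ m, ts m),
      D.Confined B i t (σ (ts M)) (χ (ts M)) (x t) := by
  have hmono := (strictMono_of_switch hs).monotone
  have hχ := χ_eq_of_switch hs hσ
  have herr : ∀ t ∈ Ico (ts M) (⨆ m, ts m),
      |D.err t (σ (ts M)) (χ (ts M)) (x t) i| < χ (ts M) i := by
    intro t ht
    obtain ⟨m, hm, htm⟩ := exists_mem_phase hs ht
    rw [← hχ m hm i le_rfl, D.err_congr (σ' := σ (ts m)) (χ' := χ (ts m))
      (fun k hk => (hσ m hm k hk).symm) (fun k hk => (hχ m hm k hk.le).symm),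
      (hs m).state_eq ⟨htm.1, htm.2.le⟩]
    exact (hs m).flow.barrier t ⟨htm.1, htm.2.trans (hs m).lt_end⟩ i
  have hT : ∀ t ∈ Ico (ts M) (⨆ m, ts m), 0 ≤ t ∧ t < D.T := fun t ht =>
    ⟨(h0 ▸ hmono (Nat.zero_le M)).trans ht.1, ht.2.trans_le (ciSup_le fun m =>
      ((hs m).lt.trans (hs m).lt_end).le.trans (hs m).end_le)⟩
  induction i using Fin.cases with
  | zero =>
    refine ⟨χ (ts M) 0, le_rfl, fun t ht => ⟨(hT t ht).1, (hT t ht).2, ?_, ?_, ?_, ?_,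
      (herr t ht).le⟩⟩ <;> exact fun j hj => absurd hj (Fin.not_lt_zero j)
  | succ k =>
    have hlow : ∀ j < k.succ, j ≤ k.castSucc := fun j hj => Fin.le_castSucc_iff.2 hj
    obtain ⟨B, hB0, hB⟩ := (supervised_of_switch (l := k.castSucc) h0 hs
      fun m hm j hj => hσ m hm j (Fin.le_castSucc_iff.1 hj)).exists_margin
    refine ⟨max B (χ (ts M) k.succ), le_max_right _ _, fun t ht => ?_⟩
    have hle : B ≤ max B (χ (ts M) k.succ) := le_max_left _ _
    refine ⟨(hT t ht).1, (hT t ht).2, fun j hj => ?_, fun j hj => ?_, fun j hj => ?_,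
      fun j hj => ?_, (herr t ht).le.trans (le_max_right _ _)⟩ <;>
      obtain ⟨h1, h2, h3, h4, -⟩ := hB t ht j (hlow j hj)
    · exact h1.trans hle
    · refine h2.trans (mul_le_mul_of_nonneg_right hle ?_)
      by_contra! hneg
      have := mul_nonpos_of_nonneg_of_nonpos hB0 hneg.le
      linarith
    · exact h3.trans hle
    · refine (le_trans ?_ h4).trans hle
      exact mul_le_mul_of_nonneg_right
        (D.rpow_le_rpow_μ (hT t ht).1 (hT t ht).2 (D.β_mono (hlow j hj))) (abs_nonneg _)

/-- A gain of the right sign and of sufficient magnitude is reached by the switching rule. -/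
theorem exists_good_gain (D : Design n) (P : Plant n) (i : Fin (n + 1)) (G C : ℝ) (v₀ : ℕ) :
    ∃ v ≥ v₀, ∀ (z : Fin (i.val + 1) → ℝ) (τ : Fin (n + 1) → ℕ), τ i = v → 0 < C →
      C⁻¹ ≤ |P.h i z| → G ≤ P.h i z * D.Θ τ i := by
  obtain ⟨N, hN⟩ := eventually_atTop.1 ((D.θ_tendsto i).eventually_ge_atTop (C * |G|))
  have key : ∀ v ≥ N, ∀ z : Fin (i.val + 1) → ℝ, 0 < C → C⁻¹ ≤ |P.h i z| →
      G ≤ |P.h i z| * D.θ i v := by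
    intro v hv z hC hz
    have h1 := mul_le_mul hz (hN v hv) (by positivity) (abs_nonneg _)
    rw [inv_mul_cancel_left₀ hC.ne'] at h1
    exact (le_abs_self G).trans h1
  rcases P.h_sign i with hpos | hneg
  · refine ⟨2 * (v₀ + N), by omega, fun z τ hτ hC hz => ?_⟩
    have h1 := key (2 * (v₀ + N)) (by omega) z hC hz
    rw [abs_of_pos (hpos z)] at h1
    rw [Θ, hτ, (even_two_mul _).neg_one_pow, one_mul]
    exact h1
  · refine ⟨2 * (v₀ + N) + 1, by omega, fun z τ hτ hC hz => ?_⟩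
    have h1 := key (2 * (v₀ + N) + 1) (by omega) z hC hz
    rw [abs_of_neg (hneg z)] at h1
    rw [Θ, hτ, (odd_two_mul_add_one _).neg_one_pow]
    linarith

/-- Strong induction on the channel: once the lower gains are settled, channel `i` is uniformly
confined, a good gain value exists at or above the current one, and while `σ_i` has this value the
dissipation inequality keeps the supervisory function negative through the whole phase, so that
`σ_i` does not change. -/
theorem eventually_σ_const (hf : ∀ i : Fin n, P.f i.castSucc 0 = 0) (h0 : ts 0 = 0)
    (hs : ∀ m, D.IsSwitch P σ χ x η (ts m) (ts (m + 1)) (e m) (y m) (w m)) (i : Fin (n + 1)) :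
    ∃ N, ∀ m ≥ N, σ (ts m) i = σ (ts N) i := by
  induction i using WellFoundedLT.induction with
  | ind i ih =>
    have hN : ∀ j, ∃ N, j < i → ∀ m ≥ N, σ (ts m) j = σ (ts N) j := fun j => by
      by_cases hj : j < i
      · obtain ⟨N, hN⟩ := ih j hj
        exact ⟨N, fun _ => hN⟩
      · exact ⟨0, fun h => absurd h hj⟩
    choose N hN using hN
    set M := Finset.univ.sup N with hM
    have hNM : ∀ j, N j ≤ M := fun j => Finset.le_sup (Finset.mem_univ j)
    have hσ : ∀ m ≥ M, ∀ j < i, σ (ts m) j = σ (ts M) j := fun m hm j hj => by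
      rw [hN j hj m ((hNM j).trans hm), hN j hj M (hNM j)]
    obtain ⟨B, hχB, hconf⟩ := exists_confined_of_switch h0 hs hσ
    have hχ := χ_eq_of_switch hs hσ
    obtain ⟨C, hC0, hC⟩ := Confined.exists_h_le D P B i
    obtain ⟨G, hG⟩ := exists_gain_dissipation D P hf B i
    obtain ⟨v, hv, hgood⟩ := exists_good_gain D P i G C (σ (ts M) i)
    refine eventually_const_of_stops (g := fun m => σ (ts m) i)
      (fun m => (hs m).update.gain_cases i) hv fun m hm hmv => ?_
    have hsm := hs m
    have hneg := hsm.flow.supervisor_neg hsm.end_le hsm.lt_end (hsm.supervisor_start i)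
      fun t ht => ?_
    · have := (hsm.update.gain i).2 (hneg _ ⟨hsm.lt.le, le_rfl⟩)
      exact this.trans hmv
    · have htE : t ∈ Ico (ts M) (⨆ m, ts m) :=
        ⟨((strictMono_of_switch hs).monotone hm).trans ht.1,
          ht.2.trans_lt (lt_iSup_of_switch hs (m + 1))⟩
      have hc := (hconf t htE).congr (σ' := σ (ts m)) (χ' := χ (ts m))
        (fun j hj => (hσ m hm j hj).symm) (fun j hj => (hχ m hm j hj.le).symm)
      rw [hsm.state_eq ht] at hc
      refine hG t _ _ _ (w m t) hc (hsm.flow.barrier t ⟨ht.1, ht.2.trans_lt hsm.lt_end⟩ i) ?_ ?_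
      · rw [hχ m hm i le_rfl]; exact hχB
      · exact hgood _ _ hmv hC0 (hC t _ _ _ hc).2

end infinite

/-- Only finitely many switchings occur. -/
theorem IsRun.exists_eq_T (hf : ∀ i : Fin n, P.f i.castSucc 0 = 0) {ts : ℕ → ℝ}
    {σ : ℝ → Fin (n + 1) → ℕ} {χ x η : ℝ → Fin (n + 1) → ℝ} (h : D.IsRun P ts σ χ x η) :
    ∃ m, D.T ≤ ts m := by
  by_contra! hlt
  have hex : ∀ m, ∃ e y w, D.IsSwitch P σ χ x η (ts m) (ts (m + 1)) e y w := fun m =>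
    h.exists_switch fun k _ => hlt k
  choose e y w hs using hex
  choose N hN using eventually_σ_const hf h.start hs
  set M := Finset.univ.sup N
  have hNM : ∀ j, N j ≤ M := fun j => Finset.le_sup (Finset.mem_univ j)
  -- After all gains have settled there is still a switching, and it increases the gain index of a
  -- triggering channel.
  obtain ⟨i, hi⟩ := (hs M).trigger
  have h1 := ((hs M).update.gain i).1 hi
  rw [hN i M (hNM i), hN i (M + 1) ((hNM i).trans (Nat.le_succ M))] at h1
  omega

end Design

/-! ### Ordinary differential equations in an open domain -/

open scoped Manifold ContDiff

section ode

/-- Cutting off a continuously differentiable map outside a compact set. -/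
theorem exists_contDiff_cutoff {E F : Type*} [NormedAddCommGroup E] [NormedSpace ℝ E]
    [FiniteDimensional ℝ E] [NormedAddCommGroup F] [NormedSpace ℝ F] {Ω K : Set E} (hΩ : IsOpen Ω)
    (hK : IsCompact K) (hKΩ : K ⊆ Ω) {f : E → F} (hf : ∀ p ∈ Ω, ContDiffAt ℝ 1 f p) :
    ∃ (N : Set E) (g : E → F), IsOpen N ∧ K ⊆ N ∧ N ⊆ Ω ∧ EqOn g f N ∧ ContDiff ℝ 1 g ∧
      HasCompactSupport g := by
  obtain ⟨K₁, hK₁, hKK₁, hK₁Ω⟩ := exists_compact_between hK hΩ hKΩ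
  obtain ⟨ρ, hρ1, hρ0, -⟩ := exists_contMDiffMap_one_nhds_of_subset_interior (n := 1) 𝓘(ℝ, E)
    hK.isClosed hKK₁
  obtain ⟨N, hNo, hKN, hN⟩ := eventually_nhdsSet_iff_exists.1 hρ1
  have hρ : ContDiff ℝ 1 ρ := ρ.contMDiff.contDiff
  refine ⟨N ∩ Ω, fun p => ρ p • f p, hNo.inter hΩ, subset_inter hKN hKΩ, inter_subset_right,
    fun p hp => ?_, contDiff_iff_contDiffAt.2 fun p => ?_, ?_⟩
  · simp [hN p hp.1]
  · by_cases hp : p ∈ Ω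
    · exact hρ.contDiffAt.smul (hf p hp)
    · have : (fun p => ρ p • f p) =ᶠ[𝓝 p] fun _ => 0 := by
        filter_upwards [hK₁.isClosed.isOpen_compl.mem_nhds fun h => hp (hK₁Ω h)] with q hq
        rw [hρ0 q hq, zero_smul]
      exact contDiffAt_const.congr_of_eventuallyEq this
  · exact HasCompactSupport.intro hK₁ fun p hp => by rw [hρ0 p hp, zero_smul]

variable {E : Type*} [NormedAddCommGroup E] [NormedSpace ℝ E] [FiniteDimensional ℝ E]

/-- The field is bounded and globally Lipschitz, so Picard–Lindelöf applies on all of `[a, b]`, on a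
ball of radius sup bound times `b - a`. -/
theorem exists_solution_of_compactSupport {g : ℝ × E → E} (hg : ContDiff ℝ 1 g)
    (hs : HasCompactSupport g) {a b : ℝ} (hab : a ≤ b) (z₀ : E) :
    ∃ z : ℝ → E, z a = z₀ ∧ ∀ t ∈ Icc a b, HasDerivWithinAt z (g (t, z t)) (Icc a b) t := by
  obtain ⟨L, hL⟩ := ContDiff.lipschitzWith_of_hasCompactSupport hs hg one_ne_zero
  obtain ⟨B, hB⟩ := hs.exists_bound_of_continuous hg.continuous
  have : CompleteSpace E := FiniteDimensional.complete ℝ E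
  have hpl : IsPicardLindelof (fun t z => g (t, z)) (⟨a, le_rfl, hab⟩ : Icc a b) z₀
      (B.toNNReal * (b - a).toNNReal) 0 B.toNNReal L := by
    refine ⟨fun t _ => ?_, fun x _ => ?_, fun t _ x _ => ?_, ?_⟩
    · have := hL.comp (LipschitzWith.prodMk_left t)
      rw [mul_one] at this
      exact this.lipschitzOnWith
    · exact (hg.continuous.comp (continuous_id.prodMk continuous_const)).continuousOn
    · exact (hB _).trans (Real.le_coe_toNNReal B)
    · simp [hab]
  exact hpl.exists_eq_forall_mem_Icc_hasDerivWithinAt₀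

/-- A solution either exists up to a given time or leaves a given compact set before. -/
theorem exists_solution_or_exit {Ω K : Set (ℝ × E)} (hΩ : IsOpen Ω) (hK : IsCompact K)
    (hKΩ : K ⊆ Ω) {f : ℝ × E → E} (hf : ∀ p ∈ Ω, ContDiffAt ℝ 1 f p) {a b : ℝ} (hab : a < b)
    {z₀ : E} (h0 : (a, z₀) ∈ K) :
    ∃ (c : ℝ) (z : ℝ → E), a < c ∧ c ≤ b ∧ z a = z₀ ∧ (∀ t ∈ Ico a c, (t, z t) ∈ Ω) ∧
      (∀ t ∈ Ico a c, HasDerivWithinAt z (f (t, z t)) (Ico a c) t) ∧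
      (c = b ∨ ∃ t ∈ Ico a c, (t, z t) ∉ K) := by
  obtain ⟨N, g, hNo, hKN, hNΩ, hgf, hg, hgs⟩ := exists_contDiff_cutoff hΩ hK hKΩ hf
  obtain ⟨z, hz0, hz⟩ := exists_solution_of_compactSupport hg hgs hab.le z₀
  have hzc : ContinuousOn (fun t => (t, z t)) (Icc a b) :=
    continuousOn_id.prodMk fun t ht => (hz t ht).continuousWithinAt
  have hder : ∀ c ≤ b, (∀ t ∈ Ico a c, (t, z t) ∈ N) →
      ∀ t ∈ Ico a c, HasDerivWithinAt z (f (t, z t)) (Ico a c) t := by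
    intro c hc hN t ht
    rw [← hgf (hN t ht)]
    exact (hz t ⟨ht.1, ht.2.le.trans hc⟩).mono fun s hs => ⟨hs.1, hs.2.le.trans hc⟩
  by_cases hall : ∀ t ∈ Ico a b, (t, z t) ∈ N
  · exact ⟨b, z, hab, le_rfl, hz0, fun t ht => hNΩ (hall t ht), hder b le_rfl hall, Or.inl rfl⟩
  · push Not at hall
    obtain ⟨t₁, ht₁, ht₁N⟩ := hall
    -- The times at which the solution of the cut-off equation is outside `N`; before the first of
    -- them it solves the original equation.
    set A : Set ℝ := Icc a b ∩ (fun t => (t, z t)) ⁻¹' Nᶜ with hA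
    have hAc : IsClosed A := hzc.preimage_isClosed_of_isClosed isClosed_Icc hNo.isClosed_compl
    have hAne : A.Nonempty := ⟨t₁, ⟨ht₁.1, ht₁.2.le⟩, ht₁N⟩
    have hAb : BddBelow A := ⟨a, fun t ht => ht.1.1⟩
    have hcA : sInf A ∈ A := hAc.csInf_mem hAne hAb
    have hac : a < sInf A := by
      refine lt_of_le_of_ne hcA.1.1 fun h => hcA.2 ?_
      show (sInf A, z (sInf A)) ∈ N
      rw [← h, hz0]
      exact hKN h0
    have hN : ∀ t ∈ Ico a (sInf A), (t, z t) ∈ N := fun t ht => by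
      by_contra hn
      exact absurd (csInf_le hAb ⟨⟨ht.1, ht.2.le.trans hcA.1.2⟩, hn⟩) (not_le.2 ht.2)
    refine ⟨sInf A, z, hac, hcA.1.2, hz0, fun t ht => hNΩ (hN t ht), hder _ hcA.1.2 hN, Or.inr ?_⟩
    -- If the solution stayed in `K` before this time, closedness of `K` would put it in `K ⊆ N` at
    -- this time as well.
    by_contra! hK'
    have hcl : sInf A ∈ closure (Ico a (sInf A)) := by
      rw [closure_Ico hac.ne]
      exact ⟨hac.le, le_rfl⟩
    have hcont := (hzc (sInf A) hcA.1).mono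
      (fun s (hs : s ∈ Ico a (sInf A)) => ⟨hs.1, hs.2.le.trans hcA.1.2⟩)
    have hmem := hcont.mem_closure hcl (t := K) hK'
    rw [hK.isClosed.closure_eq] at hmem
    exact hcA.2 (hKN hmem)

/-- Uniqueness of solutions inside an open set in which the vector field is continuously
differentiable. -/
theorem solution_unique {Ω : Set (ℝ × E)} (hΩ : IsOpen Ω) {f : ℝ × E → E}
    (hf : ∀ p ∈ Ω, ContDiffAt ℝ 1 f p) {a b : ℝ} {z z' : ℝ → E}
    (hz : ∀ t ∈ Ico a b, HasDerivWithinAt z (f (t, z t)) (Ico a b) t)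
    (hz' : ∀ t ∈ Ico a b, HasDerivWithinAt z' (f (t, z' t)) (Ico a b) t)
    (hzΩ : ∀ t ∈ Ico a b, (t, z t) ∈ Ω) (hzΩ' : ∀ t ∈ Ico a b, (t, z' t) ∈ Ω)
    (h0 : z a = z' a) : EqOn z z' (Ico a b) := by
  intro t ht
  have hsub : Icc a t ⊆ Ico a b := fun s hs => ⟨hs.1, hs.2.trans_lt ht.2⟩
  have hc : ContinuousOn z (Icc a t) := fun s hs => (hz s (hsub hs)).continuousWithinAt.mono hsub
  have hc' : ContinuousOn z' (Icc a t) := fun s hs => (hz' s (hsub hs)).continuousWithinAt.mono hsub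
  -- Both graphs over `[a, t]` form a compact set; cutting off around it gives a globally Lipschitz
  -- field that both functions solve.
  set K := (fun s => (s, z s)) '' Icc a t ∪ (fun s => (s, z' s)) '' Icc a t
  have hK : IsCompact K := (isCompact_Icc.image_of_continuousOn (continuousOn_id.prodMk hc)).union
    (isCompact_Icc.image_of_continuousOn (continuousOn_id.prodMk hc'))
  have hKΩ : K ⊆ Ω := by
    rintro _ (⟨s, hs, rfl⟩ | ⟨s, hs, rfl⟩)
    · exact hzΩ s (hsub hs)
    · exact hzΩ' s (hsub hs)
  obtain ⟨N, g, -, hKN, -, hgf, hg, hgs⟩ := exists_contDiff_cutoff hΩ hK hKΩ hf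
  obtain ⟨L, hL⟩ := ContDiff.lipschitzWith_of_hasCompactSupport hgs hg one_ne_zero
  have hright : ∀ s ∈ Ico a t, Ico a b ∈ 𝓝[Ici s] s := fun s hs =>
    mem_of_superset (Ico_mem_nhdsGE (hs.2.trans ht.2)) (Ico_subset_Ico_left hs.1)
  refine ODE_solution_unique_of_mem_Icc_right (v := fun s u => g (s, u)) (s := fun _ => univ) (K := L)
    (fun s _ => ?_) hc (fun s hs => ?_) (fun _ _ => mem_univ _) hc' (fun s hs => ?_)
    (fun _ _ => mem_univ _) h0 ⟨ht.1, le_rfl⟩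
  · have := hL.comp (LipschitzWith.prodMk_left (β := E) s)
    rw [mul_one] at this
    exact this.lipschitzOnWith
  · have hs' : s ∈ Icc a t := ⟨hs.1, hs.2.le⟩
    show HasDerivWithinAt z (g (s, z s)) _ _
    rw [hgf (hKN (Or.inl ⟨s, hs', rfl⟩))]
    exact (hz s (hsub hs')).mono_of_mem_nhdsWithin (hright s hs)
  · have hs' : s ∈ Icc a t := ⟨hs.1, hs.2.le⟩
    show HasDerivWithinAt z' (g (s, z' s)) _ _
    rw [hgf (hKN (Or.inr ⟨s, hs', rfl⟩))]
    exact (hz' s (hsub hs')).mono_of_mem_nhdsWithin (hright s hs)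

/-- Solutions on all shorter intervals can be glued. -/
theorem exists_solution_of_forall_lt {Ω : Set (ℝ × E)} (hΩ : IsOpen Ω) {f : ℝ × E → E}
    (hf : ∀ p ∈ Ω, ContDiffAt ℝ 1 f p) {a b : ℝ} (hab : a < b) {z₀ : E} {Q : ℝ → E → Prop}
    (h : ∀ c, a < c → c < b → ∃ z : ℝ → E, z a = z₀ ∧ (∀ t ∈ Ico a c, (t, z t) ∈ Ω) ∧
      (∀ t ∈ Ico a c, HasDerivWithinAt z (f (t, z t)) (Ico a c) t) ∧ ∀ t ∈ Ico a c, Q t (z t)) :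
    ∃ z : ℝ → E, z a = z₀ ∧ (∀ t ∈ Ico a b, (t, z t) ∈ Ω) ∧
      (∀ t ∈ Ico a b, HasDerivWithinAt z (f (t, z t)) (Ico a b) t) ∧ ∀ t ∈ Ico a b, Q t (z t) := by
  have hex : ∀ c, ∃ z : ℝ → E, a < c → c < b → z a = z₀ ∧ (∀ t ∈ Ico a c, (t, z t) ∈ Ω) ∧
      (∀ t ∈ Ico a c, HasDerivWithinAt z (f (t, z t)) (Ico a c) t) ∧ ∀ t ∈ Ico a c, Q t (z t) := by
    intro c
    by_cases hc : a < c ∧ c < b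
    · obtain ⟨z, hz⟩ := h c hc.1 hc.2
      exact ⟨z, fun _ _ => hz⟩
    · exact ⟨0, fun h1 h2 => absurd ⟨h1, h2⟩ hc⟩
  choose Z hZ using hex
  have hagree : ∀ c c', a < c → c ≤ c' → c' < b → EqOn (Z c) (Z c') (Ico a c) := by
    intro c c' hc hcc hc'
    obtain ⟨h1, h2, h3, -⟩ := hZ c hc (hcc.trans_lt hc')
    obtain ⟨h1', h2', h3', -⟩ := hZ c' (hc.trans_le hcc) hc'
    have hsub : Ico a c ⊆ Ico a c' := Ico_subset_Ico_right hcc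
    exact solution_unique hΩ hf h3 (fun t ht => (h3' t (hsub ht)).mono hsub) h2
      (fun t ht => h2' t (hsub ht)) (h1.trans h1'.symm)
  -- At time `t` any solution living beyond `t` may be read off; the midpoint between `t` and `b` is
  -- one choice, and uniqueness makes it immaterial.
  set z : ℝ → E := fun t => Z ((t + b) / 2) t with hz
  have hzc : ∀ c, a < c → c < b → EqOn z (Z c) (Ico a c) := by
    intro c hc hcb t ht
    have h1 : a < (t + b) / 2 := by linarith [ht.1]
    have h2 : (t + b) / 2 < b := by linarith [ht.2]
    rcases le_total c ((t + b) / 2) with h | h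
    · exact (hagree c _ hc h h2 ht).symm
    · exact hagree _ c h1 h hcb ⟨ht.1, by linarith [ht.2]⟩
  have hmid : ∀ t ∈ Ico a b, a < (t + b) / 2 ∧ (t + b) / 2 < b ∧ t ∈ Ico a ((t + b) / 2) :=
    fun t ht => ⟨by linarith [ht.1, ht.2], by linarith [ht.2], ht.1, by linarith [ht.2]⟩
  refine ⟨z, ?_, fun t ht => ?_, fun t ht => ?_, fun t ht => ?_⟩
  · obtain ⟨h1, h2, h3⟩ := hmid a ⟨le_rfl, hab⟩
    exact (hZ _ h1 h2).1
  · obtain ⟨h1, h2, h3⟩ := hmid t ht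
    exact (hZ _ h1 h2).2.1 t h3
  · obtain ⟨h1, h2, h3⟩ := hmid t ht
    have h4 := ((hZ _ h1 h2).2.2.1 t h3).congr (fun s hs => hzc _ h1 h2 hs) (hzc _ h1 h2 h3)
    refine h4.mono_of_mem_nhdsWithin ?_
    refine mem_of_superset (inter_mem self_mem_nhdsWithin
      (mem_nhdsWithin_of_mem_nhds (Iio_mem_nhds h3.2))) fun s hs => ⟨hs.1.1, hs.2⟩
  · obtain ⟨h1, h2, h3⟩ := hmid t ht
    exact (hZ _ h1 h2).2.2.2 t h3

end ode

/-! ### Existence of solutions of the hybrid system -/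

namespace Design

variable {n : ℕ} {D : Design n} {P : Plant n}

section existence

variable {σ : Fin (n + 1) → ℕ} {χ : Fin (n + 1) → ℝ}

/-- The set on which the closed loop with frozen parameters is defined. -/
def domain (D : Design n) (σ : Fin (n + 1) → ℕ) (χ : Fin (n + 1) → ℝ) :
    Set (ℝ × (Fin (n + 1) → ℝ) × (Fin (n + 1) → ℝ)) :=
  {p | p.1 < D.T ∧ ∀ i, |D.err p.1 σ χ p.2.1 i| < χ i}

/-- The vector field of the closed loop with frozen parameters. -/
def field (D : Design n) (P : Plant n) (σ : Fin (n + 1) → ℕ) (χ : Fin (n + 1) → ℝ)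
    (p : ℝ × (Fin (n + 1) → ℝ) × (Fin (n + 1) → ℝ)) :
    (Fin (n + 1) → ℝ) × (Fin (n + 1) → ℝ) :=
  (P.rhs p.2.1 (D.input p.1 σ χ p.2.1), D.etaRhs p.1 σ χ p.2.1 p.2.2)

theorem isOpen_domain (D : Design n) (σ : Fin (n + 1) → ℕ) (χ : Fin (n + 1) → ℝ) :
    IsOpen (D.domain σ χ) := by
  refine isOpen_iff_mem_nhds.2 fun p hp => ?_
  have h1 : ∀ᶠ q : ℝ × (Fin (n + 1) → ℝ) × (Fin (n + 1) → ℝ) in 𝓝 p, q.1 < D.T :=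
    continuous_fst.continuousAt.eventually_lt_const hp.1
  have h2 : ∀ᶠ q : ℝ × (Fin (n + 1) → ℝ) × (Fin (n + 1) → ℝ) in 𝓝 p,
      ∀ i, |D.err q.1 σ χ q.2.1 i| < χ i := eventually_all.2 fun i => by
    have h : ContDiffAt ℝ 1 (fun q : ℝ × (Fin (n + 1) → ℝ) × (Fin (n + 1) → ℝ) =>
        D.err q.1 σ χ q.2.1 i) p :=
      D.contDiffAt_err contDiffAt_fst contDiffAt_snd.fst hp.1 fun j _ => hp.2 j
    exact h.continuousAt.abs.eventually_lt_const (hp.2 i)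
  filter_upwards [h1, h2] with q hq1 hq2 using ⟨hq1, hq2⟩

theorem contDiffAt_field (D : Design n) (P : Plant n)
    {p : ℝ × (Fin (n + 1) → ℝ) × (Fin (n + 1) → ℝ)} (hp : p ∈ D.domain σ χ) :
    ContDiffAt ℝ 1 (D.field P σ χ) p := by
  refine ContDiffAt.prodMk (contDiffAt_pi.2 fun i => ?_) (contDiffAt_pi.2 fun i => ?_)
  · exact D.contDiffAt_rhs P (τ := Prod.fst) (x := fun q => q.2.1) contDiffAt_fst
      contDiffAt_snd.fst hp.1 hp.2
  · exact D.contDiffAt_etaRhs (τ := Prod.fst) (x := fun q => q.2.1) (η := fun q => q.2.2)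
      contDiffAt_fst contDiffAt_snd.fst contDiffAt_snd.snd hp.1 hp.2

theorem isFlow_of_solution {a e : ℝ} {z : ℝ → (Fin (n + 1) → ℝ) × (Fin (n + 1) → ℝ)}
    (hΩ : ∀ t ∈ Ico a e, (t, z t) ∈ D.domain σ χ)
    (hz : ∀ t ∈ Ico a e, HasDerivWithinAt z (D.field P σ χ (t, z t)) (Ico a e) t) :
    D.IsFlow P σ χ a e (fun t => (z t).1) (fun t => (z t).2) where
  barrier t ht i := (hΩ t ht).2 i
  plant t ht i := by
    have h := (ContinuousLinearMap.fst ℝ (Fin (n + 1) → ℝ) (Fin (n + 1) → ℝ)).hasFDerivAt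
      |>.comp_hasDerivWithinAt t (hz t ht)
    exact hasDerivWithinAt_pi.1 h i
  aux t ht i := by
    have h := (ContinuousLinearMap.snd ℝ (Fin (n + 1) → ℝ) (Fin (n + 1) → ℝ)).hasFDerivAt
      |>.comp_hasDerivWithinAt t (hz t ht)
    exact hasDerivWithinAt_pi.1 h i

/-- The state that belongs to given errors. -/
def stateOfErr (D : Design n) (t : ℝ) (σ : Fin (n + 1) → ℕ) (χ s : Fin (n + 1) → ℝ) :
    Fin (n + 1) → ℝ :=
  Fin.cases (s 0) fun j => s j.succ + D.law t σ χ j.castSucc (s j.castSucc)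

theorem err_stateOfErr (t : ℝ) (s : Fin (n + 1) → ℝ) (i : Fin (n + 1)) :
    D.err t σ χ (D.stateOfErr t σ χ s) i = s i := by
  induction i using Fin.induction with
  | zero => rfl
  | succ i ih => rw [err_succ, virt, ih]; simp [stateOfErr]

theorem stateOfErr_err (t : ℝ) (x : Fin (n + 1) → ℝ) :
    D.stateOfErr t σ χ (D.err t σ χ x) = x := by
  funext i
  induction i using Fin.cases with
  | zero => rfl
  | succ i => simp [stateOfErr, err_succ, virt]

/-- Before the prescribed time, supervised states stay in a compact part of the domain. -/
theorem exists_compact (D : Design n) (hχ : ∀ i, 0 < χ i) (M : Fin (n + 1) → ℝ) (hM : ∀ i, 0 ≤ M i)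
    {a b : ℝ} (hb : b < D.T) :
    ∃ K, IsCompact K ∧ K ⊆ D.domain σ χ ∧ ∀ t ∈ Icc a b, ∀ x η,
      (∀ i, |D.err t σ χ x i| < χ i) → (∀ i, D.V t σ χ x i ≤ η i) → (∀ i, η i ≤ M i) →
      (t, x, η) ∈ K := by
  -- `V_i ≤ M_i` is equivalent to `s_i² ≤ χ_i² (1 - exp(-2 M_i))`, so in error coordinates the
  -- supervised states lie in a box strictly inside the barriers.
  set ρ : Fin (n + 1) → ℝ := fun i => χ i * √(1 - Real.exp (-(2 * M i))) with hρ
  have hρχ : ∀ i, ρ i < χ i := fun i => by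
    refine mul_lt_of_lt_one_right (hχ i) ?_
    rw [Real.sqrt_lt' one_pos]
    linarith [Real.exp_pos (-(2 * M i))]
  set box := Icc a b ×ˢ (Icc (-ρ) ρ ×ˢ Icc (0 : Fin (n + 1) → ℝ) M) with hbox
  set Φ : ℝ × (Fin (n + 1) → ℝ) × (Fin (n + 1) → ℝ) → ℝ × (Fin (n + 1) → ℝ) × (Fin (n + 1) → ℝ) :=
    fun p => (p.1, D.stateOfErr p.1 σ χ p.2.1, p.2.2) with hΦ
  have hin : ∀ p ∈ box, ∀ i, |p.2.1 i| < χ i := fun p hp i =>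
    (abs_le.2 ⟨hp.2.1.1 i, hp.2.1.2 i⟩).trans_lt (hρχ i)
  have hcont : ContinuousOn Φ box := by
    intro p hp
    refine ContinuousAt.continuousWithinAt ?_
    refine continuous_fst.continuousAt.prodMk (ContinuousAt.prodMk ?_
      (continuous_snd.snd).continuousAt)
    refine continuousAt_pi.2 fun i => ?_
    have hs : ∀ j, ContDiffAt ℝ 1 (fun q : ℝ × (Fin (n + 1) → ℝ) × (Fin (n + 1) → ℝ) => q.2.1 j) p :=
      fun j => contDiffAt_pi.1 contDiffAt_snd.fst j
    induction i using Fin.cases with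
    | zero => exact (hs 0).continuousAt
    | succ i =>
      exact ((hs i.succ).add (D.contDiffAt_law (τ := Prod.fst) contDiffAt_fst (hs i.castSucc)
        (hp.1.2.trans_lt hb) (hin p hp _))).continuousAt
  refine ⟨Φ '' box, (isCompact_Icc.prod (isCompact_Icc.prod isCompact_Icc)).image_of_continuousOn
    hcont, ?_, ?_⟩
  · rintro _ ⟨p, hp, rfl⟩
    refine ⟨hp.1.2.trans_lt hb, fun i => ?_⟩
    show |D.err p.1 σ χ (D.stateOfErr p.1 σ χ p.2.1) i| < χ i
    rw [err_stateOfErr]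
    exact hin p hp i
  · intro t ht x η hbar hV hη
    refine ⟨(t, D.err t σ χ x, η), ⟨ht, ⟨?_, ?_⟩, ?_, fun i => hη i⟩, ?_⟩
    rotate_left 2
    · exact fun i => (V_nonneg (hbar i)).trans (hV i)
    · simp only [hΦ, stateOfErr_err]
    all_goals
      intro i
      have h1 := margin_of_V (hbar i)
      have h2 : Real.exp (-(2 * M i)) ≤ Real.exp (-(2 * D.V t σ χ x i)) :=
        Real.exp_le_exp.2 (by linarith [hV i, hη i])
      have h3 := mul_le_mul_of_nonneg_left h2 (sq_nonneg (χ i))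
      have h4 : |D.err t σ χ x i| ≤ ρ i := by
        refine abs_le_of_sq_le_sq ?_ (mul_nonneg (hχ i).le (Real.sqrt_nonneg _))
        have h5 : 0 ≤ 1 - Real.exp (-(2 * M i)) :=
          sub_nonneg.2 (Real.exp_le_one_iff.2 (by linarith [hM i]))
        rw [mul_pow, Real.sq_sqrt h5]
        linarith
    · exact (abs_le.1 h4).1
    · exact (abs_le.1 h4).2

/-- The auxiliary variables are bounded before the prescribed time as long as the supervisory
functions are nonpositive. -/
theorem exists_aux_le (D : Design n) (P : Plant n) (σ : Fin (n + 1) → ℕ) (χ η₀ : Fin (n + 1) → ℝ)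
    {a b : ℝ} (hab : a ≤ b) (hb : b < D.T) :
    ∃ M : Fin (n + 1) → ℝ, (∀ i, η₀ i ≤ M i) ∧ ∀ c ≤ b, ∀ y w, D.IsFlow P σ χ a c y w → w a = η₀ →
      (∀ t ∈ Ico a c, ∀ i, D.supervisor t σ χ (y t) (w t) i ≤ 0) → ∀ t ∈ Ico a c, ∀ i, w t i ≤ M i := by
  have hμp : ∀ t ∈ Icc a b, 0 < D.μ t := fun t ht => D.μ_pos (ht.2.trans_lt hb)
  have hcμ : ∀ p : ℝ, ContinuousOn (fun t => D.μ t ^ p) (Icc a b) := fun p t ht =>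
    (D.hasDerivAt_μ_rpow (ht.2.trans_lt hb) p).continuousAt.continuousWithinAt
  have hne : ∀ p : ℝ, ∀ t ∈ Icc a b, D.μ t ^ p ≠ 0 := fun p t ht =>
    (Real.rpow_pos_of_pos (hμp t ht) p).ne'
  have hG : ∀ i, ∃ C, ∀ t ∈ Icc a b, ∑ j with j < i, D.c i j * D.μ t ^ D.β j * χ j ^ 2
      + ∑ j with j.val = i.val + 1, D.c i j * χ j ^ 2 / D.μ t ^ D.β i
      + D.ζ / D.μ t ^ D.β i ≤ C := by
    intro i
    have hc : ContinuousOn (fun t => ∑ j with j < i, D.c i j * D.μ t ^ D.β j * χ j ^ 2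
      + ∑ j with j.val = i.val + 1, D.c i j * χ j ^ 2 / D.μ t ^ D.β i
      + D.ζ / D.μ t ^ D.β i) (Icc a b) :=
      ((continuousOn_finsetSum _ fun j _ =>
          (continuousOn_const.mul (hcμ _)).mul continuousOn_const).add
        (continuousOn_finsetSum _ fun j _ => continuousOn_const.div (hcμ _) (hne _))).add
        (continuousOn_const.div (hcμ _) (hne _))
    obtain ⟨C, hC⟩ := isCompact_Icc.exists_bound_of_continuousOn hc
    exact ⟨C, fun t ht => (le_abs_self _).trans (hC t ht)⟩
  choose C hC using hG
  -- Since `η_i ≥ V_i ≥ 0`, the damping and the `Q`-term only decrease `η_i`; the sources are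
  -- bounded on `[a, b]` because `b < T`, so `η_i` grows at most linearly.
  refine ⟨fun i => η₀ i + |C i| * (b - a), fun i => ?_, fun c hc y w hfl hw hS t ht i => ?_⟩
  · have := mul_nonneg (abs_nonneg (C i)) (sub_nonneg.2 hab)
    linarith
  have hbd : ∀ s ∈ Ico a c, D.etaRhs s σ χ (y s) (w s) i ≤ |C i| := by
    intro s hs
    have hs' : s ∈ Icc a b := ⟨hs.1, hs.2.le.trans hc⟩
    have hm := hμp s hs'
    have hbar := hfl.barrier s hs
    have hη : 0 ≤ w s i := (V_nonneg (hbar i)).trans (sub_nonpos.1 (hS s hs i))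
    have hsq : ∀ j, D.err s σ χ (y s) j ^ 2 ≤ χ j ^ 2 := fun j => by
      linarith [sub_sq_pos (hbar j)]
    have t1 : 0 ≤ D.a i * D.μ s ^ D.β i * w s i := by have := D.a_pos i; positivity
    have t2 : 0 ≤ D.Q i * D.μ s ^ (if i = Fin.last n then D.κ else D.β i)
        * D.err s σ χ (y s) i ^ 2 := by have := D.Q_pos i; positivity
    have t3 : ∑ j with j < i, D.c i j * D.μ s ^ D.β j * D.err s σ χ (y s) j ^ 2 ≤
        ∑ j with j < i, D.c i j * D.μ s ^ D.β j * χ j ^ 2 := Finset.sum_le_sum fun j hj => by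
      have := D.c_pos i j (Or.inl (Finset.mem_filter.1 hj).2)
      exact mul_le_mul_of_nonneg_left (hsq j) (by positivity)
    have t4 : ∑ j with j.val = i.val + 1, D.c i j * D.err s σ χ (y s) j ^ 2 / D.μ s ^ D.β i ≤
        ∑ j with j.val = i.val + 1, D.c i j * χ j ^ 2 / D.μ s ^ D.β i :=
      Finset.sum_le_sum fun j hj => by
        have := D.c_pos i j (Or.inr (Finset.mem_filter.1 hj).2)
        have := hsq j
        gcongr
    have t5 : (if i = Fin.last n then D.ζ / D.μ s ^ D.β i else 0) ≤ D.ζ / D.μ s ^ D.β i := by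
      have := D.ζ_pos
      split_ifs
      · exact le_rfl
      · positivity
    have := (hC i s hs').trans (le_abs_self _)
    unfold etaRhs
    linarith
  have hanti : AntitoneOn (fun s => w s i - |C i| * s) (Ico a c) := by
    have hder : ∀ s ∈ Ico a c, HasDerivWithinAt (fun s => w s i - |C i| * s)
        (D.etaRhs s σ χ (y s) (w s) i - |C i| * 1) (Ico a c) s := fun s hs =>
      (hfl.aux s hs i).sub ((hasDerivWithinAt_id s _).const_mul _)
    refine antitoneOn_of_hasDerivWithinAt_nonpos (convex_Ico a c)
      (fun s hs => (hder s hs).continuousWithinAt)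
      (fun s hs => (hder s (interior_subset hs)).mono interior_subset) fun s hs => ?_
    linarith [hbd s (interior_subset hs)]
  have h1 := hanti ⟨le_rfl, ht.1.trans_lt ht.2⟩ ht ht.1
  simp only [hw] at h1
  have h2 : |C i| * (t - a) ≤ |C i| * (b - a) :=
    mul_le_mul_of_nonneg_left (by linarith [ht.2]) (abs_nonneg _)
  linarith

/-- With frozen parameters, a solution exists either up to the prescribed time with nonpositive
supervisory functions or until some supervisory function is positive. -/
theorem exists_flow (D : Design n) (P : Plant n) {σ : Fin (n + 1) → ℕ} {χ x₀ η₀ : Fin (n + 1) → ℝ}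
    {a : ℝ} (ha : a < D.T) (hb : ∀ i, |D.err a σ χ x₀ i| < χ i)
    (hV : ∀ i, D.V a σ χ x₀ i < η₀ i) :
    ∃ e y w, a < e ∧ e ≤ D.T ∧ D.IsFlow P σ χ a e y w ∧ y a = x₀ ∧ w a = η₀ ∧
      ((e = D.T ∧ ∀ t ∈ Ico a D.T, ∀ i, D.supervisor t σ χ (y t) (w t) i ≤ 0) ∨
        ∃ t ∈ Ico a e, ∃ i, 0 < D.supervisor t σ χ (y t) (w t) i) := by
  -- If some flow reaches a positive supervisory function, it is the one required. Otherwise all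
  -- flows are supervised, hence remain in a compact set and extend to every `c < T`; gluing gives a
  -- flow up to `T`.
  by_cases hpos : ∃ e y w, a < e ∧ e ≤ D.T ∧ D.IsFlow P σ χ a e y w ∧ y a = x₀ ∧ w a = η₀ ∧
      ∃ t ∈ Ico a e, ∃ i, 0 < D.supervisor t σ χ (y t) (w t) i
  · obtain ⟨e, y, w, h1, h2, h3, h4, h5, h6⟩ := hpos
    exact ⟨e, y, w, h1, h2, h3, h4, h5, Or.inr h6⟩
  · push Not at hpos
    have hglue := exists_solution_of_forall_lt (D.isOpen_domain σ χ)
      (fun p hp => D.contDiffAt_field P hp) ha (z₀ := (x₀, η₀))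
      (Q := fun t z => ∀ i, D.supervisor t σ χ z.1 z.2 i ≤ 0) ?_
    · obtain ⟨z, hz0, hzΩ, hz, hzQ⟩ := hglue
      exact ⟨D.T, _, _, ha, le_rfl, isFlow_of_solution hzΩ hz, by simp [hz0], by simp [hz0],
        Or.inl ⟨rfl, hzQ⟩⟩
    · intro c hac hcT
      obtain ⟨M, hM0, hM⟩ := D.exists_aux_le P σ χ η₀ hac.le hcT
      obtain ⟨K, hK, hKΩ, hKin⟩ := D.exists_compact (σ := σ)
        (fun i => (abs_nonneg _).trans_lt (hb i)) M
        (fun i => ((V_nonneg (hb i)).trans (hV i).le).trans (hM0 i)) (a := a) hcT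
      obtain ⟨c', z, hac', hc'c, hz0, hzΩ, hz, hend⟩ := exists_solution_or_exit
        (D.isOpen_domain σ χ) hK hKΩ (fun p hp => D.contDiffAt_field P hp) hac
        (hKin a ⟨le_rfl, hac.le⟩ x₀ η₀ hb (fun i => (hV i).le) hM0)
      have hfl := isFlow_of_solution hzΩ hz
      have hS := hpos c' _ _ hac' (hc'c.trans hcT.le) hfl (by simp [hz0]) (by simp [hz0])
      have hin : ∀ t ∈ Ico a c', (t, z t) ∈ K := fun t ht =>
        hKin t ⟨ht.1, ht.2.le.trans hc'c⟩ _ _ (hfl.barrier t ht)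
          (fun i => sub_nonpos.1 (hS t ht i))
          (hM c' hc'c _ _ hfl (by simp [hz0]) hS t ht)
      rcases hend with rfl | ⟨t, ht, htK⟩
      · exact ⟨z, hz0, hzΩ, hz, hS⟩
      · exact absurd (hin t ht) htK

/-- The conditions look circular in `χ'`, but `s_i` depends only on the new barriers of preceding
channels, so they can be solved one channel after another. -/
theorem exists_barrier_update (D : Design n) (t : ℝ) (σ' : Fin (n + 1) → ℕ) (χ x : Fin (n + 1) → ℝ) :
    ∃ χ' : Fin (n + 1) → ℝ, ∀ i, (χ i ≤ |D.err t σ' χ' x i| → χ' i = |D.err t σ' χ' x i| + D.ς) ∧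
      (|D.err t σ' χ' x i| < χ i → χ' i = χ i) := by
  have key : ∀ k : ℕ, ∃ χ' : Fin (n + 1) → ℝ, ∀ i : Fin (n + 1), i.val < k →
      (χ i ≤ |D.err t σ' χ' x i| → χ' i = |D.err t σ' χ' x i| + D.ς) ∧
      (|D.err t σ' χ' x i| < χ i → χ' i = χ i) := by
    intro k
    induction k with
    | zero => exact ⟨χ, fun i hi => absurd hi (Nat.not_lt_zero _)⟩
    | succ k ih =>
      obtain ⟨χ', h⟩ := ih
      set ψ : Fin (n + 1) → ℝ := fun i => if i.val < k then χ' i else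
        if χ i ≤ |D.err t σ' χ' x i| then |D.err t σ' χ' x i| + D.ς else χ i with hψ
      refine ⟨ψ, fun i hi => ?_⟩
      have he : D.err t σ' ψ x i = D.err t σ' χ' x i := D.err_congr (fun _ _ => rfl) fun j hj => by
        rw [Fin.lt_def] at hj
        exact if_pos (by omega)
      rw [he]
      by_cases hik : i.val < k
      · rw [show ψ i = χ' i from if_pos hik]
        exact h i hik
      · rw [show ψ i = if χ i ≤ |D.err t σ' χ' x i| then |D.err t σ' χ' x i| + D.ς else χ i from
          if_neg hik]
        exact ⟨fun hle => if_pos hle, fun hlt => if_neg (not_le.2 hlt)⟩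
  obtain ⟨χ', h⟩ := key (n + 1)
  exact ⟨χ', fun i => h i i.isLt⟩

theorem exists_update (D : Design n) (t : ℝ) (σ : Fin (n + 1) → ℕ) (χ x η : Fin (n + 1) → ℝ) :
    ∃ σ' χ' x' η', D.IsUpdate t σ χ x η σ' χ' x' η' := by
  classical
  set σ' : Fin (n + 1) → ℕ := fun i => if 0 ≤ D.supervisor t σ χ x η i then σ i + 1 else σ i
  obtain ⟨χ', hχ'⟩ := D.exists_barrier_update t σ' χ x
  refine ⟨σ', χ', x, fun i => if η i ≤ D.V t σ' χ' x i then D.V t σ' χ' x i + D.ε else η i,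
    rfl, fun i => ⟨fun h => if_pos h, fun h => if_neg (not_le.2 h)⟩, hχ',
    fun i => ⟨fun h => if_pos h, fun h => if_neg (not_le.2 h)⟩⟩

theorem IsUpdate.barrier_lt {t : ℝ} {σ σ' : Fin (n + 1) → ℕ} {χ x η χ' x' η' : Fin (n + 1) → ℝ}
    (h : D.IsUpdate t σ χ x η σ' χ' x' η') (i : Fin (n + 1)) : |D.err t σ' χ' x' i| < χ' i := by
  rw [h.state]
  rcases le_or_gt (χ i) |D.err t σ' χ' x i| with hle | hlt
  · rw [(h.barrier i).1 hle]; linarith [D.ς_pos]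
  · rw [(h.barrier i).2 hlt]; exact hlt

end existence

/-- The data of the closed loop at the beginning of a phase. -/
structure Node (n : ℕ) where
  time : ℝ
  σ : Fin (n + 1) → ℕ
  χ : Fin (n + 1) → ℝ
  x : Fin (n + 1) → ℝ
  η : Fin (n + 1) → ℝ

/-- A phase can start at the node. -/
structure Node.Admissible (D : Design n) (s : Node n) : Prop where
  le_T : s.time ≤ D.T
  barrier : s.time < D.T → ∀ i, |D.err s.time s.σ s.χ s.x i| < s.χ i
  V_lt : s.time < D.T → ∀ i, D.V s.time s.σ s.χ s.x i < s.η i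

/-- The flow `(y, w)` leads from the node `s` to the node `s'`. -/
def Node.Linked (D : Design n) (P : Plant n) (s s' : Node n) (y w : ℝ → Fin (n + 1) → ℝ) : Prop :=
  s.time < s'.time ∧ ∃ e, s.time < e ∧ e ≤ D.T ∧ D.IsFlow P s.σ s.χ s.time e y w ∧
    y s.time = s.x ∧ w s.time = s.η ∧
    ((s'.time = D.T ∧ e = D.T ∧
        ∀ t ∈ Ico s.time D.T, ∀ i, D.supervisor t s.σ s.χ (y t) (w t) i ≤ 0) ∨
      (s'.time < e ∧
        IsGLB {t | t ∈ Ico s.time e ∧ ∃ i, 0 < D.supervisor t s.σ s.χ (y t) (w t) i} s'.time ∧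
        D.IsUpdate s'.time s.σ s.χ (y s'.time) (w s'.time) s'.σ s'.χ s'.x s'.η))

theorem Node.Admissible.exists_next (P : Plant n) {s : Node n} (h : s.Admissible D) :
    ∃ (s' : Node n) (y w : ℝ → Fin (n + 1) → ℝ), s'.Admissible D ∧
      (s.time < D.T → s.Linked D P s' y w) ∧ (s.time = D.T → s'.time = D.T) := by
  rcases h.le_T.lt_or_eq with hlt | heq
  swap
  · exact ⟨s, fun _ => s.x, fun _ => s.η, h, fun hlt => absurd heq hlt.ne, fun _ => heq⟩
  obtain ⟨e, y, w, hae, heT, hfl, hy, hw, hend⟩ := D.exists_flow P hlt (h.barrier hlt) (h.V_lt hlt)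
  rcases hend with ⟨rfl, hS⟩ | ⟨t, ht, hti⟩
  -- The terminal node at `T` repeats the old data; admissibility is then vacuous, since it
  -- restricts only nodes before `T`.
  · exact ⟨⟨D.T, s.σ, s.χ, s.x, s.η⟩, y, w, ⟨le_rfl, fun h => absurd h (lt_irrefl _),
      fun h => absurd h (lt_irrefl _)⟩, fun _ => ⟨hlt, D.T, hae, le_rfl, hfl, hy, hw,
      Or.inl ⟨rfl, rfl, hS⟩⟩, fun _ => rfl⟩
  · set A := {t | t ∈ Ico s.time e ∧ ∃ i, 0 < D.supervisor t s.σ s.χ (y t) (w t) i} with hA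
    have hglb : IsGLB A (sInf A) := isGLB_csInf ⟨t, ht, hti⟩ ⟨s.time, fun r hr => hr.1.1⟩
    have hlt_e : sInf A < e := (hglb.1 ⟨ht, hti⟩).trans_lt ht.2
    have h0 : ∀ i, D.supervisor s.time s.σ s.χ (y s.time) (w s.time) i < 0 := fun i => by
      rw [hy, hw]; exact sub_neg.2 (h.V_lt hlt i)
    obtain ⟨hab, -, -⟩ := hfl.first_positive heT hlt_e h0 hglb
    obtain ⟨σ', χ', x', η', hup⟩ := D.exists_update (sInf A) s.σ s.χ (y (sInf A)) (w (sInf A))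
    refine ⟨⟨sInf A, σ', χ', x', η'⟩, y, w, ⟨(hlt_e.trans_le heT).le, fun _ => hup.barrier_lt,
      fun _ => hup.V_lt⟩, fun _ => ⟨hab, e, hae, heT, hfl, hy, hw, Or.inr ⟨hlt_e, hglb, hup⟩⟩,
      fun h => absurd h hlt.ne⟩

/-- Existence of a run from every admissible initial node. -/
theorem exists_run (D : Design n) (P : Plant n) {s₀ : Node n} (h₀ : s₀.Admissible D)
    (ht₀ : s₀.time = 0) :
    ∃ (ts : ℕ → ℝ) (σ : ℝ → Fin (n + 1) → ℕ) (χ x η : ℝ → Fin (n + 1) → ℝ),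
      ts 0 = 0 ∧ σ 0 = s₀.σ ∧ χ 0 = s₀.χ ∧ x 0 = s₀.x ∧ η 0 = s₀.η ∧ (∀ m, ts m ≤ D.T) ∧
      (∀ m, ts m < D.T → D.IsPhase P σ χ x η (ts m) (ts (m + 1))) ∧
      ∀ m, ts m = D.T → ts (m + 1) = D.T := by
  choose next Y W hadm hlink hfix using fun s : {s : Node n // s.Admissible D} =>
    s.2.exists_next P
  set node : ℕ → {s : Node n // s.Admissible D} := fun m =>
    Nat.rec ⟨s₀, h₀⟩ (fun _ s => ⟨next s, hadm s⟩) m with hnode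
  have hsucc : ∀ m, (node (m + 1)).1 = next (node m) := fun _ => rfl
  set ts : ℕ → ℝ := fun m => (node m).1.time with hts
  have hle : ∀ m, ts m ≤ D.T := fun m => (node m).2.le_T
  have hlk : ∀ m, ts m < D.T → (node m).1.Linked D P (node (m + 1)).1 (Y (node m)) (W (node m)) :=
    fun m hm => hlink (node m) hm
  have hafter : ∀ m, ts m = D.T → ts (m + 1) = D.T := fun m hm => hfix (node m) hm
  have hmono : Monotone ts := monotone_nat_of_le_succ fun m => by
    rcases (hle m).lt_or_eq with hm | hm
    · exact (hlk m hm).1.le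
    · rw [hm, hafter m hm]
  classical
  set idx : ℝ → ℕ := fun t => if h : ∃ m, t ∈ Ico (ts m) (ts (m + 1)) then h.choose else 0 with hidx
  have hidx_eq : ∀ m t, t ∈ Ico (ts m) (ts (m + 1)) → idx t = m := by
    intro m t ht
    have hex : ∃ m, t ∈ Ico (ts m) (ts (m + 1)) := ⟨m, ht⟩
    have h1 : idx t = hex.choose := dif_pos hex
    have h2 := hex.choose_spec
    rw [← h1] at h2
    by_contra hne
    rcases lt_or_gt_of_ne hne with hlt | hlt
    · exact absurd (h2.2.trans_le (hmono hlt)) (not_lt.2 ht.1)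
    · exact absurd (ht.2.trans_le (hmono hlt)) (not_lt.2 h2.1)
  have hidx_ts : ∀ m, ts m < D.T → idx (ts m) = m := fun m hm =>
    hidx_eq m _ ⟨le_rfl, (hlk m hm).1⟩
  have hY : ∀ m, ts m < D.T → Y (node m) (ts m) = (node m).1.x := fun m hm => by
    obtain ⟨-, e, -, -, -, h, -⟩ := hlk m hm
    exact h
  have hW : ∀ m, ts m < D.T → W (node m) (ts m) = (node m).1.η := fun m hm => by
    obtain ⟨-, e, -, -, -, -, h, -⟩ := hlk m hm
    exact h
  have h00 : ts 0 = 0 := ht₀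
  have h0T : ts 0 < D.T := h00 ▸ D.T_pos
  refine ⟨ts, fun t => (node (idx t)).1.σ, fun t => (node (idx t)).1.χ,
    fun t => Y (node (idx t)) t, fun t => W (node (idx t)) t, h00, ?_, ?_, ?_, ?_, hle, ?_, hafter⟩
  · simp only [← h00, hidx_ts 0 h0T]; rfl
  · simp only [← h00, hidx_ts 0 h0T]; rfl
  · simp only [← h00, hidx_ts 0 h0T, hY 0 h0T]; rfl
  · simp only [← h00, hidx_ts 0 h0T, hW 0 h0T]; rfl
  · intro m hm
    obtain ⟨hlt, e, hae, heT, hfl, hy, hw, hend⟩ := hlk m hm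
    refine ⟨e, hae, heT, Y (node m), W (node m), ?_, ?_, ?_, fun t ht => ?_, ?_⟩
    · simp only [hidx_ts m hm]; exact hfl
    · simp only [hidx_ts m hm]
    · simp only [hidx_ts m hm]
    · simp only [hidx_ts m hm, hidx_eq m t ht, and_self]
    · simp only [hidx_ts m hm]
      rcases hend with h | ⟨hlt_e, hglb, hup⟩
      · exact Or.inl h
      · have hT' : ts (m + 1) < D.T := hlt_e.trans_le heT
        refine Or.inr ⟨hlt_e, hglb, ?_⟩
        simp only [hidx_ts (m + 1) hT', hY (m + 1) hT', hW (m + 1) hT']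
        exact hup

end Design

/-! ### Boundedness of the signals and convergence of the state -/

namespace Design

variable {n : ℕ} {D : Design n} {P : Plant n}

/-- The sum of the magnitudes of all signals. -/
def total (D : Design n) (t : ℝ) (σ : Fin (n + 1) → ℕ) (χ x η : Fin (n + 1) → ℝ) : ℝ :=
  ∑ i, (|x i| + |η i| + |χ i| + σ i + |D.Θ σ i| + |D.err t σ χ x i| + |D.virt t σ χ x i|
    + |D.V t σ χ x i|)

theorem bounds_of_total_le {t C : ℝ} {σ : Fin (n + 1) → ℕ} {χ x η : Fin (n + 1) → ℝ}
    (h : D.total t σ χ x η ≤ C) :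
    |D.input t σ χ x| ≤ C ∧
      ∀ i, |x i| ≤ C ∧ |η i| ≤ C ∧ |χ i| ≤ C ∧ (σ i : ℝ) ≤ C ∧ |D.Θ σ i| ≤ C ∧
        |D.err t σ χ x i| ≤ C ∧ |D.virt t σ χ x i| ≤ C ∧ |D.V t σ χ x i| ≤ C ∧
        |D.supervisor t σ χ x η i| ≤ C := by
  have key : ∀ i, |x i| + |η i| + |χ i| + σ i + |D.Θ σ i| + |D.err t σ χ x i|
      + |D.virt t σ χ x i| + |D.V t σ χ x i| ≤ C := fun i =>
    (Finset.single_le_sum (f := fun i => |x i| + |η i| + |χ i| + σ i + |D.Θ σ i|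
      + |D.err t σ χ x i| + |D.virt t σ χ x i| + |D.V t σ χ x i|)
      (fun j _ => by positivity) (Finset.mem_univ i)).trans h
  have all : ∀ i, |x i| ≤ C ∧ |η i| ≤ C ∧ |χ i| ≤ C ∧ (σ i : ℝ) ≤ C ∧ |D.Θ σ i| ≤ C ∧
        |D.err t σ χ x i| ≤ C ∧ |D.virt t σ χ x i| ≤ C ∧ |D.V t σ χ x i| ≤ C ∧
        |D.supervisor t σ χ x η i| ≤ C := by
    intro i
    have h1 := key i
    have h2 := abs_nonneg (x i)
    have h3 := abs_nonneg (η i)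
    have h4 := abs_nonneg (χ i)
    have h5 : (0 : ℝ) ≤ σ i := Nat.cast_nonneg _
    have h6 := abs_nonneg (D.Θ σ i)
    have h7 := abs_nonneg (D.err t σ χ x i)
    have h8 := abs_nonneg (D.virt t σ χ x i)
    have h9 := abs_nonneg (D.V t σ χ x i)
    have h10 : |D.supervisor t σ χ x η i| ≤ |D.V t σ χ x i| + |η i| := abs_sub _ _
    refine ⟨?_, ?_, ?_, ?_, ?_, ?_, ?_, ?_, ?_⟩ <;> linarith
  exact ⟨(all (Fin.last n)).2.2.2.2.2.2.1, all⟩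

/-- The signals are bounded in a phase that ends with a switching. -/
theorem IsSwitch.exists_total_le {σ : ℝ → Fin (n + 1) → ℕ} {χ x η : ℝ → Fin (n + 1) → ℝ}
    {a b e : ℝ} {y w : ℝ → Fin (n + 1) → ℝ} (h : D.IsSwitch P σ χ x η a b e y w) :
    ∃ C, ∀ t ∈ Ico a b, D.total t (σ t) (χ t) (x t) (η t) ≤ C := by
  have hsub : Icc a b ⊆ Ico a e := fun t ht => ⟨ht.1, ht.2.trans_lt h.lt_end⟩
  have hy := h.flow.continuousOn_state.mono hsub
  have hw := h.flow.continuousOn_aux.mono hsub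
  have herr : ∀ i, ContinuousOn (fun t => D.err t (σ a) (χ a) (y t) i) (Icc a b) := fun i t ht =>
    (D.hasDerivWithinAt_err ((hsub ht).2.trans_le h.end_le) (h.flow.plant t (hsub ht))
      fun j _ => h.flow.barrier t (hsub ht) j).continuousWithinAt.mono hsub
  have hvirt : ∀ i, ContinuousOn (fun t => D.virt t (σ a) (χ a) (y t) i) (Icc a b) := fun i t ht =>
    (D.hasDerivWithinAt_law ((hsub ht).2.trans_le h.end_le)
      (D.hasDerivWithinAt_err ((hsub ht).2.trans_le h.end_le) (h.flow.plant t (hsub ht))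
        fun j _ => h.flow.barrier t (hsub ht) j)
      (h.flow.barrier t (hsub ht) i)).continuousWithinAt.mono hsub
  have hV : ∀ i, ContinuousOn (fun t => D.V t (σ a) (χ a) (y t) i) (Icc a b) := fun i t ht =>
    (hasDerivWithinAt_V ((hsub ht).2.trans_le h.end_le) (h.flow.plant t (hsub ht))
      fun j _ => h.flow.barrier t (hsub ht) j).continuousWithinAt.mono hsub
  have hc : ContinuousOn (fun t => D.total t (σ a) (χ a) (y t) (w t)) (Icc a b) := by
    unfold total
    refine continuousOn_finsetSum _ fun i _ => ?_
    have h1 := (continuousOn_pi.1 hy i).abs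
    have h2 := (continuousOn_pi.1 hw i).abs
    exact ((((((h1.add h2).add continuousOn_const).add continuousOn_const).add
      continuousOn_const).add (herr i).abs).add (hvirt i).abs).add (hV i).abs
  obtain ⟨C, hC⟩ := isCompact_Icc.exists_bound_of_continuousOn hc
  refine ⟨C, fun t ht => ?_⟩
  obtain ⟨h1, h2, h3, h4⟩ := h.signals t ht
  rw [h1, h2, h3, h4]
  exact (le_abs_self _).trans (hC t ⟨ht.1, ht.2.le⟩)

section final

variable {σ : Fin (n + 1) → ℕ} {χ : Fin (n + 1) → ℝ} {a : ℝ} {y w : ℝ → Fin (n + 1) → ℝ}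

theorem IsFlow.supervised (h : D.IsFlow P σ χ a D.T y w) (ha : 0 ≤ a)
    (hS : ∀ t ∈ Ico a D.T, ∀ i, D.supervisor t σ χ (y t) (w t) i ≤ 0) :
    D.Supervised (Fin.last n) σ χ a D.T y w where
  nonneg := ha
  le_T := le_rfl
  barrier t ht j _ := h.barrier t ht j
  cont j _ := continuousOn_pi.1 h.continuousOn_aux j
  aux t ht j _ := (h.aux t ht j).mono_of_mem_nhdsWithin
    (mem_of_superset (Ico_mem_nhdsGE ht.2) (Ico_subset_Ico_left ht.1))
  V_le t ht j _ := sub_nonpos.1 (hS t ht j)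

/-- In a phase lasting until the prescribed time all signals are bounded and the state decays. -/
theorem Supervised.exists_total_le (h : D.Supervised (Fin.last n) σ χ a D.T y w) :
    ∃ C, ∀ t ∈ Ico a D.T, D.total t σ χ (y t) (w t) ≤ C ∧ ∀ i, |y t i| ≤ C * (D.μ t)⁻¹ := by
  obtain ⟨B, hB0, hB⟩ := h.exists_margin
  set A := ∑ j, B * (D.K j + D.U j * B) * B with hA
  have hterm : ∀ j, 0 ≤ B * (D.K j + D.U j * B) * B := fun j => by
    have := D.K_pos j
    have := D.U_pos j
    positivity
  have hA0 : 0 ≤ A := Finset.sum_nonneg fun j _ => hterm j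
  have hAj : ∀ j, B * (D.K j + D.U j * B) * B ≤ A := fun j =>
    Finset.single_le_sum (f := fun j => B * (D.K j + D.U j * B) * B) (fun j _ => hterm j)
      (Finset.mem_univ j)
  have hpt : ∀ t ∈ Ico a D.T, ∀ j, |w t j| ≤ B ∧ |D.V t σ χ (y t) j| ≤ B ∧
      |D.err t σ χ (y t) j| ≤ B * (D.μ t)⁻¹ ∧ |D.virt t σ χ (y t) j| ≤ A ∧
      (j < Fin.last n → |D.virt t σ χ (y t) j| ≤ A * (D.μ t)⁻¹) := by
    intro t ht j
    obtain ⟨h1, h2, h3, h4, h5⟩ := hB t ht j (Fin.le_last j)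
    have h0 := h.nonneg.trans ht.1
    have hm1 := D.one_le_μ h0 ht.2
    have hm0 : 0 < D.μ t := by linarith
    have hb := h.barrier t ht j (Nat.le_succ_of_le (Fin.le_last j))
    have hV0 := V_nonneg hb
    have hVw := h.V_le t ht j (Fin.le_last j)
    have hs0 := abs_nonneg (D.err t σ χ (y t) j)
    have hK := D.K_pos j
    have hU := D.U_pos j
    have hv := abs_virt_le hB0 h0 ht.2 h1 h2
    refine ⟨by rw [abs_of_nonneg (hV0.trans hVw)]; exact h5,
      by rw [abs_of_nonneg hV0]; exact hVw.trans h5, ?_, ?_, fun hj => ?_⟩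
    · rw [← div_eq_mul_inv, le_div_iff₀ hm0, mul_comm]
      refine le_trans (mul_le_mul_of_nonneg_right ?_ hs0) h4
      conv_lhs => rw [← Real.rpow_one (D.μ t)]
      exact D.rpow_le_rpow_μ h0 ht.2 (D.one_lt_β _).le
    · refine hv.trans ((mul_le_mul_of_nonneg_left ?_ (by positivity)).trans (hAj j))
      exact (mul_le_mul_of_nonneg_right (D.rpow_le_rpow_μ h0 ht.2 (D.β_mono (Fin.le_last j)))
        hs0).trans h4
    -- Below the last channel `β_j + 1 ≤ 3 β_j ≤ β_n`, which leaves a spare factor `1/μ`. The last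
    -- virtual control, the input, is only bounded.
    · have h6 : D.μ t ^ D.β j * |D.err t σ χ (y t) j| ≤ B * (D.μ t)⁻¹ := by
        rw [← div_eq_mul_inv, le_div_iff₀ hm0, mul_right_comm, ← Real.rpow_add_one hm0.ne']
        refine le_trans (mul_le_mul_of_nonneg_right ?_ hs0) h4
        have h7 := D.three_mul_β_le hj
        have h8 := D.one_lt_β j
        exact D.rpow_le_rpow_μ h0 ht.2 (by linarith)
      refine hv.trans ((mul_le_mul_of_nonneg_left h6 (by positivity)).trans ?_)
      rw [← mul_assoc]
      exact mul_le_mul_of_nonneg_right (hAj j) (inv_pos.2 hm0).le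
  have hstate : ∀ t ∈ Ico a D.T, ∀ i, |y t i| ≤ (A + B) * (D.μ t)⁻¹ := by
    intro t ht i
    have hm0 : 0 ≤ (D.μ t)⁻¹ := (inv_pos.2 (D.μ_pos ht.2)).le
    induction i using Fin.cases with
    | zero =>
      have := (hpt t ht 0).2.2.1
      rw [err_zero] at this
      linarith [mul_nonneg hA0 hm0]
    | succ k =>
      have h1 := (hpt t ht k.succ).2.2.1
      have h2 := (hpt t ht k.castSucc).2.2.2.2 (Fin.castSucc_lt_last k)
      have h3 : y t k.succ = D.err t σ χ (y t) k.succ + D.virt t σ χ (y t) k.castSucc := by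
        rw [err_succ]; ring
      rw [h3]
      refine (abs_add_le _ _).trans ?_
      linarith
  set C := ∑ i, ((A + B) + B + |χ i| + σ i + |D.Θ σ i| + B + A + B) with hC
  have hCi : ∀ i, (A + B) + B + |χ i| + σ i + |D.Θ σ i| + B + A + B ≤ C := fun i =>
    Finset.single_le_sum (f := fun i => (A + B) + B + |χ i| + σ i + |D.Θ σ i| + B + A + B)
      (fun j _ => by positivity) (Finset.mem_univ i)
  refine ⟨C, fun t ht => ⟨?_, fun i => (hstate t ht i).trans ?_⟩⟩
  · have hm1 : (D.μ t)⁻¹ ≤ 1 := inv_le_one_of_one_le₀ (D.one_le_μ (h.nonneg.trans ht.1) ht.2)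
    refine Finset.sum_le_sum fun i _ => ?_
    obtain ⟨h1, h2, h3, h4, -⟩ := hpt t ht i
    have h5 := hstate t ht i
    have h6 := mul_le_of_le_one_right hB0 hm1
    have h7 := mul_le_of_le_one_right (add_nonneg hA0 hB0) hm1
    linarith
  · refine mul_le_mul_of_nonneg_right ?_ (inv_pos.2 (D.μ_pos ht.2)).le
    have h1 := hCi i
    have h2 := abs_nonneg (χ i)
    have h3 : (0 : ℝ) ≤ σ i := Nat.cast_nonneg _
    have h4 := abs_nonneg (D.Θ σ i)
    linarith

end final

theorem IsClosedLoop.isRun {x0 χ0 : Fin (n + 1) → ℝ} {ts : ℕ → ℝ} {σ : ℝ → Fin (n + 1) → ℕ}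
    {χ x η : ℝ → Fin (n + 1) → ℝ} (h : D.IsClosedLoop P x0 χ0 ts σ χ x η) :
    D.IsRun P ts σ χ x η where
  start := h.start
  V_init i := by
    rw [h.aux_init, h.gain_init, h.barrier_init, h.state_init]
    linarith [D.ε_pos]
  phase := h.phase

/-- There is a last phase, preceded by finitely many switchings. -/
theorem IsRun.exists_last_phase (hf : ∀ i : Fin n, P.f i.castSucc 0 = 0) {ts : ℕ → ℝ}
    {σ : ℝ → Fin (n + 1) → ℕ} {χ x η : ℝ → Fin (n + 1) → ℝ} (h : D.IsRun P ts σ χ x η) :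
    ∃ N y w, 0 ≤ ts N ∧ ts N < D.T ∧
      (∀ m < N, ∃ e y w, D.IsSwitch P σ χ x η (ts m) (ts (m + 1)) e y w) ∧
      D.IsFlow P (σ (ts N)) (χ (ts N)) (ts N) D.T y w ∧
      (∀ t ∈ Ico (ts N) D.T, ∀ i, D.supervisor t (σ (ts N)) (χ (ts N)) (y t) (w t) i ≤ 0) ∧
      ∀ t ∈ Ico (ts N) D.T, σ t = σ (ts N) ∧ χ t = χ (ts N) ∧ x t = y t ∧ η t = w t := by
  classical
  have hex := h.exists_eq_T hf
  have hpos : Nat.find hex ≠ 0 := fun h0 => by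
    have h1 := Nat.find_spec hex
    rw [h0, h.start] at h1
    exact absurd D.T_pos (not_lt.2 h1)
  obtain ⟨N, hN⟩ := Nat.exists_eq_succ_of_ne_zero hpos
  -- `N + 1` is the first index with `T ≤ ts (N + 1)`, so phase `N` is the last one and all earlier
  -- phases end with a switching.
  have hlt : ∀ k ≤ N, ts k < D.T := fun k hk => not_le.1 (Nat.find_min hex (by omega))
  have hTN : D.T ≤ ts (N + 1) := by
    have := Nat.find_spec hex
    rwa [hN] at this
  have hsw : ∀ m < N, ∃ e y w, D.IsSwitch P σ χ x η (ts m) (ts (m + 1)) e y w := fun m hm =>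
    h.exists_switch fun k hk => hlt k (hk.trans hm)
  have hnn : ∀ m ≤ N, 0 ≤ ts m := by
    intro m
    induction m with
    | zero => exact fun _ => h.start.ge
    | succ m ih =>
      intro hm
      obtain ⟨e, y, w, hs⟩ := hsw m hm
      exact (ih (Nat.le_of_succ_le hm)).trans hs.lt.le
  obtain ⟨e, -, heT, y, w, hfl, -, -, hsig, hend⟩ := h.phase N (hlt N le_rfl)
  rcases hend with ⟨hb, rfl, hS⟩ | ⟨hb, -⟩
  · rw [hb] at hsig
    exact ⟨N, y, w, hnn N le_rfl, hlt N le_rfl, hsw, hfl, hS, hsig⟩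
  · exact absurd (hb.trans_le heT) (not_lt.2 hTN)

end Design
end PrescribedTime

end

theorem corollary2 (n : ℕ) (P : PrescribedTime.Plant n) (D : PrescribedTime.Design n)
    (hf : ∀ i : Fin n, P.f i.castSucc 0 = 0)
    (x0 χ0 : Fin (n + 1) → ℝ)
    (hχ0 : ∀ i, |D.err 0 (PrescribedTime.Design.σinit n) χ0 x0 i| < χ0 i) :
    (∃ (ts : ℕ → ℝ) (σ : ℝ → Fin (n + 1) → ℕ) (χ x η : ℝ → Fin (n + 1) → ℝ),
      D.IsClosedLoop P x0 χ0 ts σ χ x η) ∧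
    ∀ (ts : ℕ → ℝ) (σ : ℝ → Fin (n + 1) → ℕ) (χ x η : ℝ → Fin (n + 1) → ℝ),
      D.IsClosedLoop P x0 χ0 ts σ χ x η →
      (∃ C : ℝ, ∀ t ∈ Set.Ico 0 D.T,
        |D.input t (σ t) (χ t) (x t)| ≤ C ∧
        ∀ i, |x t i| ≤ C ∧ |η t i| ≤ C ∧ |χ t i| ≤ C ∧ (σ t i : ℝ) ≤ C ∧
          |D.Θ (σ t) i| ≤ C ∧ |D.err t (σ t) (χ t) (x t) i| ≤ C ∧
          |D.virt t (σ t) (χ t) (x t) i| ≤ C ∧ |D.V t (σ t) (χ t) (x t) i| ≤ C ∧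
          |D.supervisor t (σ t) (χ t) (x t) (η t) i| ≤ C) ∧
      ∀ i, Filter.Tendsto (fun t => x t i) (nhdsWithin D.T (Set.Iio D.T)) (nhds 0) := by
  constructor
  · set s₀ : PrescribedTime.Design.Node n := ⟨0, PrescribedTime.Design.σinit n, χ0, x0,
      fun i => D.V 0 (PrescribedTime.Design.σinit n) χ0 x0 i + D.ε⟩
    have h₀ : s₀.Admissible D := ⟨D.T_pos.le, fun _ => hχ0, fun _ i => by
      show D.V 0 _ _ _ i < D.V 0 _ _ _ i + D.ε
      linarith [D.ε_pos]⟩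
    obtain ⟨ts, σ, χ, x, η, h1, h2, h3, h4, h5, h6, h7, h8⟩ := D.exists_run P h₀ rfl
    have hrun : D.IsRun P ts σ χ x η := ⟨h1, fun i => by
      rw [h2, h3, h4, h5]
      exact h₀.V_lt D.T_pos i, h7⟩
    -- The recursive construction alone does not exclude accumulation of the switching times before
    -- `T`; finiteness of switchings does.
    obtain ⟨m, hm⟩ := hrun.exists_eq_T hf
    exact ⟨ts, σ, χ, x, η, h1, h4, h2, h3, fun i => by rw [h5], h7, h8,
      fun τ hτ => ⟨m, hτ.trans_le hm⟩⟩
  · intro ts σ χ x η h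
    obtain ⟨N, y, w, hN0, hNT, hsw, hfl, hS, hsig⟩ := h.isRun.exists_last_phase hf
    obtain ⟨C, hC⟩ := (hfl.supervised hN0 hS).exists_total_le
    refine ⟨?_, fun i => ?_⟩
    -- Bounds on the finitely many phases before the last one are combined by taking maxima.
    · have hpre : ∀ m ≤ N, ∃ C, ∀ t ∈ Set.Ico 0 (ts m), D.total t (σ t) (χ t) (x t) (η t) ≤ C := by
        intro m
        induction m with
        | zero => exact fun _ => ⟨0, fun t ht => absurd (h.start ▸ ht.2) (not_lt.2 ht.1)⟩
        | succ m ih =>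
          intro hm
          obtain ⟨C₁, hC₁⟩ := ih (Nat.le_of_succ_le hm)
          obtain ⟨e, y, w, hs⟩ := hsw m hm
          obtain ⟨C₂, hC₂⟩ := hs.exists_total_le
          refine ⟨max C₁ C₂, fun t ht => ?_⟩
          rcases lt_or_ge t (ts m) with hlt | hge
          · exact (hC₁ t ⟨ht.1, hlt⟩).trans (le_max_left _ _)
          · exact (hC₂ t ⟨hge, ht.2⟩).trans (le_max_right _ _)
      obtain ⟨C₁, hC₁⟩ := hpre N le_rfl
      refine ⟨max C₁ C, fun t ht => PrescribedTime.Design.bounds_of_total_le ?_⟩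
      rcases lt_or_ge t (ts N) with hlt | hge
      · exact (hC₁ t ⟨ht.1, hlt⟩).trans (le_max_left _ _)
      · obtain ⟨e1, e2, e3, e4⟩ := hsig t ⟨hge, ht.2⟩
        rw [e1, e2, e3, e4]
        exact (hC t ⟨hge, ht.2⟩).1.trans (le_max_right _ _)
    · have hlim : Filter.Tendsto (fun t => C * (D.μ t)⁻¹) (nhdsWithin D.T (Set.Iio D.T)) (nhds 0) := by
        have := (D.tendsto_μ.inv_tendsto_atTop).const_mul C
        rwa [mul_zero] at this
      refine squeeze_zero_norm' ?_ hlim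
      filter_upwards [Ico_mem_nhdsLT hNT] with t ht
      rw [(hsig t ht).2.2.1]
      exact (hC t ht).2 i
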